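/- A $0$–$1$ matrix $A$ \emph{contains} a $0$–$1$ matrix $X$ if $X$ can be obtained from $A$ by deleting rows and columns and changing some $1$s to $0$s. Let $\operatorname{Ex}(X,n)$ be the maximum number of $1$s in an $n\times n$ $0$–$1$ matrix that does not contain $X$. Define $a_{1,j}=2^j$ for $j\ge 1$, $a_{i,1}=2$ for $i\ge 2$, and $a_{i,j}=w\cdot a_{i-1,w}$ with $w=a_{i,j-1}$ for $i,j\ge 2$, and let $\alpha(n)=\min\{i\ge 1 : a_{i,3}\ge n\}$ be the inverse-Ackermann function. **Theorem.** For a permutation $\pi$ of $k\ge 1$ elements let $P_\pi$ be its $k\times k$ permutation matrix, and let $Q=P_\pi\otimes\begin{pmatrix}0&1&0\\1&0&1\end{pmatrix}$ (Kronecker product), a $2k\times 3k$ matrix with exactly one $1$ in each column. Then $$\operatorname{Ex}(Q,n)\;\le\; n\cdot\left(2^{O(k^2)}+O(\alpha(n))^{3k-2}\right)2^{\alpha(n)}\;=\;n\cdot 2^{O(k^2)+(1+o(1))\alpha(n)} .$$ Explicitly: there are absolute constants $C,D>0$ and a sequence $\varepsilon(n)\to 0$ as $n\to\infty$, none of them depending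 on $k$ or $\pi$, such that for all $k\ge 1$, all permutations $\pi$ of $k$ elements and all $n\ge 1$, $$\operatorname{Ex}(Q,n)\;\le\; n\left(2^{Ck^2}+(C\,\alpha(n))^{3k-2}\right)2^{\alpha(n)}\;\le\; n\cdot 2^{Dk^2+(1+\varepsilon(n))\alpha(n)} .$$ -/

import Mathlib

/-- 0--1 matrices with `n` rows and `m` columns; the entries are the two elements `0` and `1`. -/
abbrev ZeroOneMatrix (n m : ℕ) : Type := Matrix (Fin n) (Fin m) (ZMod 2)

namespace ZeroOneMatrix

/-- The weight of a 0--1 matrix: its number of 1s. -/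
def weight {n m : ℕ} (A : ZeroOneMatrix n m) : ℕ :=
  (Finset.univ.filter fun p : Fin n × Fin m => A p.1 p.2 = 1).card

/-- `A` contains the pattern `P`: there are rows `r 0 < r 1 < ⋯` and columns `c 0 < c 1 < ⋯` of `A`
such that `A` has a 1 wherever `P` has one. -/
def Contains {p q n m : ℕ} (P : ZeroOneMatrix p q) (A : ZeroOneMatrix n m) : Prop :=
  ∃ (r : Fin p → Fin n) (c : Fin q → Fin m), StrictMono r ∧ StrictMono c ∧
    ∀ i j, P i j = 1 → A (r i) (c j) = 1

open Classical in
/-- The maximum weight of an `n × m` 0--1 matrix that does not contain `P`. -/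
noncomputable def exRect {p q : ℕ} (P : ZeroOneMatrix p q) (n m : ℕ) : ℕ :=
  (Finset.univ.filter fun A : ZeroOneMatrix n m => ¬ Contains P A).sup weight

/-- The extremal function of `P` for square matrices. -/
noncomputable def ex {p q : ℕ} (P : ZeroOneMatrix p q) (n : ℕ) : ℕ := exRect P n n

/-- The hat pattern; its first row is the upper one. -/
def hat : ZeroOneMatrix 2 3 :=
  !![0, 1, 0;
     1, 0, 1]

/-- The Kronecker product of 0--1 matrices, with rows and columns in their usual
(block, then position inside the block) order. -/
def kron {p q p' q' : ℕ} (P : ZeroOneMatrix p q) (R : ZeroOneMatrix p' q') :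
    ZeroOneMatrix (p * p') (q * q') :=
  Matrix.reindex finProdFinEquiv finProdFinEquiv (Matrix.kronecker P R)

/-- The `2k × 3k` pattern in which every 1 of the permutation matrix of `π` is replaced by a hat
and every 0 by a zero block. The permutation matrix has its 1s at the positions `(i, π i)`. -/
def permHat {k : ℕ} (π : Equiv.Perm (Fin k)) : ZeroOneMatrix (k * 2) (k * 3) :=
  kron (Equiv.Perm.permMatrix (ZMod 2) π) hat

end ZeroOneMatrix

/-- Ackermann's function `a i j` for `i, j ≥ 1`, in the version
`a 1 j = 2 ^ j`, `a i 1 = 2` for `i ≥ 2`, and `a i j = w * a (i - 1) w` with `w = a i (j - 1)` for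
`i, j ≥ 2`. The values at `i = 0` and at `i ≥ 2`, `j = 0` are irrelevant. -/
def ackTable : ℕ → ℕ → ℕ
  | 0, _ => 0
  | 1, j => 2 ^ j
  | _ + 2, 0 => 0
  | _ + 2, 1 => 2
  | i + 2, j + 2 => ackTable (i + 2) (j + 1) * ackTable (i + 1) (ackTable (i + 2) (j + 1))
termination_by i j => (i, j)

theorem two_pow_le_ackTable (i : ℕ) : ∀ j, 2 ≤ j → 2 ^ (i + 1) ≤ ackTable (i + 1) j := by
  induction i with
  | zero =>
    intro j hj
    rw [ackTable]
    exact Nat.pow_le_pow_right (by norm_num) (by omega)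
  | succ i ih =>
    have key : ∀ j, 2 ≤ ackTable (i + 2) (j + 1) ∧ 2 ^ (i + 2) ≤ ackTable (i + 2) (j + 2) := by
      intro j
      have step : ∀ j, 2 ≤ ackTable (i + 2) (j + 1) → 2 ^ (i + 2) ≤ ackTable (i + 2) (j + 2) := by
        intro j h
        rw [ackTable, pow_succ, mul_comm]
        exact Nat.mul_le_mul h (ih _ h)
      induction j with
      | zero =>
        have h : 2 ≤ ackTable (i + 2) (0 + 1) := by rw [ackTable]
        exact ⟨h, step 0 h⟩
      | succ j ihj =>
        have h : 2 ≤ ackTable (i + 2) (j + 1 + 1) :=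
          le_trans (Nat.le_self_pow (by omega) 2) ihj.2
        exact ⟨h, step (j + 1) h⟩
    intro j hj
    obtain ⟨j, rfl⟩ : ∃ l, j = l + 2 := ⟨j - 2, by omega⟩
    exact (key j).2

theorem exists_le_ackTable (m j : ℕ) (hj : 2 ≤ j) : ∃ i, 1 ≤ i ∧ m ≤ ackTable i j :=
  ⟨m + 1, by omega, le_trans (le_trans (Nat.le_succ m) (Nat.lt_two_pow_self (n := m + 1)).le)
    (two_pow_le_ackTable m j hj)⟩

/-- The two-parameter inverse-Ackermann function
`α(n, m) = min {i ≥ 1 : a i j ≥ m}`, where `j = max {3, ⌈n / m⌉}`. -/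
noncomputable def invAck₂ (n m : ℕ) : ℕ :=
  Nat.find (exists_le_ackTable m (max 3 ⌈(n : ℚ) / (m : ℚ)⌉₊) (le_max_of_le_left (by norm_num)))

/-- The inverse-Ackermann function `α(n) = α(n, n)`. -/
noncomputable def invAck (n : ℕ) : ℕ := invAck₂ n n

open Finset

/-! Every column of Q contains exactly one 1, so Q is the function `hatRank` sending a column to the
row of its 1. For each interval of u columns of Q, the weight of a set of ones avoiding that
subpattern is bounded in the form μ · (rows + β · cols), where rows and cols count the nonzero ones
(`WeightBound`). The bound is proved by induction on u and along the Ackermann table.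

The engine is `recursion_step`. Cut the columns into groups of W. Rows living in a single group are
handled by the bound for at most W columns. Every other row is global, and its ones are of three
kinds.

Ones in the first group of their row have a one of the same row further right. After passing to
every second row, a copy of the pattern without its last column could be completed by such a one in
an adjacent or equal row (`not_hasPattern_of_thin`), so these ones obey the bound for u - 1 columns.
The last group is symmetric.

Middle ones that are the first or last of their row within a group number at most twice the weight
of the matrix in which each group is contracted to one column. That matrix avoids the same pattern
and has far fewer columns. This factor 2, once per level of the table, produces 2^α(n).

For the remaining inner ones the rows are also cut into groups of W. By the Marcus–Tardos theorem
(`card_le_of_not_grid`) only linearly many blocks contain a hat; since rows extend to both sides of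
the group, the ones there obey the bound for u - 2 columns. In a block without a hat each column has
at most one inner one, and after contraction two of them in one column would bound a hat. So the
contracted matrix avoids the permutation pattern with every 1 doubled vertically, and has linear
weight (`card_le_of_not_hasDouble`).

The row coefficients thus need μ(u,i+1) ≥ 2μ(u,i) + 2μ(u-1,i+1) + cμ(u-2,i+1) + c with c = 2^O(k).
`rowCoeff` solves this by 2^i times the (u-2)-th power of an expression linear in i, up to a bounded
term; u = 3k gives the exponent 3k - 2. In most lemmas `k + 1` stands for the size of the
permutation. -/

namespace HatPattern

/-! ### Grids and the Marcus–Tardos linear bound -/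

/-- `S` contains the all-ones `l × k` matrix as an interval minor. -/
def Grid (l k : ℕ) (S : Finset (ℕ × ℕ)) : Prop :=
  ∃ p : ℕ → ℕ → ℕ × ℕ, (∀ i j, i < l → j < k → p i j ∈ S) ∧
    (∀ i i' j j', i < i' → i' < l → j < k → j' < k → (p i j).1 < (p i' j').1) ∧
    (∀ i i' j j', i < l → i' < l → j < j' → j' < k → (p i j).2 < (p i' j').2)

/-- Monotone maps reflect strict inequalities, so a grid found after a contraction lifts point by
point. -/
theorem Grid.of_map {l k : ℕ} {S T : Finset (ℕ × ℕ)} {f g : ℕ → ℕ} (hf : Monotone f)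
    (hg : Monotone g) (h : ∀ p ∈ T, ∃ q ∈ S, p.1 = f q.1 ∧ p.2 = g q.2) (hT : Grid l k T) :
    Grid l k S := by
  obtain ⟨p, hp, h1, h2⟩ := hT
  choose! q hqS hq1 hq2 using h
  refine ⟨fun i j => q (p i j), fun i j hi hj => hqS _ (hp i j hi hj), ?_, ?_⟩
  · intro i i' j j' hi hi' hj hj'
    apply hf.reflect_lt
    rw [← hq1 _ (hp i j (hi.trans hi') hj), ← hq1 _ (hp i' j' hi' hj')]
    exact h1 i i' j j' hi hi' hj hj'
  · intro i i' j j' hi hi' hj hj'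
    apply hg.reflect_lt
    rw [← hq2 _ (hp i j hi (hj.trans hj')), ← hq2 _ (hp i' j' hi' hj')]
    exact h2 i i' j j' hi hi' hj hj'

theorem Grid.mono {l k : ℕ} {S T : Finset (ℕ × ℕ)} (h : T ⊆ S) (hT : Grid l k T) :
    Grid l k S :=
  hT.of_map monotone_id monotone_id fun p hp => ⟨p, h hp, rfl, rfl⟩

theorem Grid.of_swap {l k : ℕ} {S : Finset (ℕ × ℕ)} (h : Grid l k (S.image Prod.swap)) :
    Grid k l S := by
  obtain ⟨p, hp, h1, h2⟩ := h
  refine ⟨fun i j => (p j i).swap, ?_, ?_, ?_⟩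
  · intro i j hi hj
    obtain ⟨q, hq, e⟩ := mem_image.1 (hp j i hj hi)
    dsimp only
    rw [← e, Prod.swap_swap]; exact hq
  · intro i i' j j' hi hi' hj hj'
    exact h2 j j' i i' hj hj' hi hi'
  · intro i i' j j' hi hi' hj hj'
    exact h1 j j' i i' hj hj' hi hi'

theorem exists_enum (R : Finset ℕ) : ∃ e : ℕ → ℕ, (∀ i < R.card, e i ∈ R) ∧
    (∀ i j, i < j → j < R.card → e i < e j) ∧ ∀ r ∈ R, ∃ i < R.card, e i = r := by
  refine ⟨fun i => if h : i < R.card then R.orderEmbOfFin rfl ⟨i, h⟩ else 0, ?_, ?_, ?_⟩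
  · intro i hi
    simp [hi]
  · intro i j hij hj
    simp [hj, hij.trans hj, hij]
  · intro r hr
    have : r ∈ Set.range (R.orderEmbOfFin rfl) := by simpa using hr
    obtain ⟨⟨i, hi⟩, h⟩ := this
    exact ⟨i, hi, by simp [hi, h]⟩

theorem grid_one {l : ℕ} {T : Finset (ℕ × ℕ)} (h : l ≤ (T.image Prod.fst).card) :
    Grid l 1 T := by
  obtain ⟨e, he, hlt, -⟩ := exists_enum (T.image Prod.fst)
  have : ∀ i < l, ∃ p ∈ T, p.1 = e i := fun i hi => by
    simpa only [mem_image] using he i (hi.trans_le h)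
  choose! p hp hpe using this
  refine ⟨fun i _ => p i, fun i j hi _ => hp i hi, ?_, fun i i' j j' _ _ _ _ => by omega⟩
  intro i i' j j' hi hi' _ _
  simp only [hpe i (hi.trans hi'), hpe i' hi']
  exact hlt i i' hi (hi'.trans_le h)

/-- A matrix with `2 ^ τ` columns and at least `2 ^ k` ones in each nonzero row, without
`l × (k + 1)` grid, has at most `l * 4 ^ τ` nonzero rows. -/
theorem card_rows_le_of_not_grid (l τ : ℕ) : ∀ (k a : ℕ) (T : Finset (ℕ × ℕ)),
    (∀ p ∈ T, a ≤ p.2 ∧ p.2 < a + 2 ^ τ) →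
    (∀ p ∈ T, 2 ^ k ≤ (T.filter fun q => q.1 = p.1).card) → ¬ Grid l (k + 1) T →
    (T.image Prod.fst).card ≤ l * 4 ^ τ := by
  induction τ with
  | zero =>
    intro k a T hT hk hG
    rcases Nat.eq_zero_or_pos k with rfl | hk0
    · by_contra! h
      exact hG (grid_one (by omega))
    · have : T = ∅ := by
        rw [eq_empty_iff_forall_notMem]
        intro p hp
        have h1 := hk p hp
        have h2 : (T.filter fun q => q.1 = p.1).card ≤ 1 := by
          rw [card_le_one]
          intro x hx y hy
          simp only [mem_filter] at hx hy
          have := hT x hx.1; have := hT y hy.1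
          ext
          · rw [hx.2, hy.2]
          · simp at *; omega
        have h3 : 2 ^ 1 ≤ 2 ^ k := Nat.pow_le_pow_right (by norm_num) hk0
        omega
      simp [this]
  | succ τ ih =>
    intro k a T hT hk hG
    rcases Nat.eq_zero_or_pos k with rfl | hk0
    · by_contra! h
      refine hG (grid_one (le_trans ?_ h.le))
      exact Nat.le_mul_of_pos_right _ (by positivity)
    obtain ⟨k, rfl⟩ : ∃ k', k = k' + 1 := ⟨k - 1, by omega⟩
    set mid := a + 2 ^ τ with hmid
    have hpow : 2 ^ (τ + 1) = 2 ^ τ + 2 ^ τ := by ring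
    -- A row lies in the left half, or in the right half, or meets both. In the last case one of the
    -- halves has at least half of its ones. The four classes give the factor 4 per halving.
    let L := T.filter fun p => ∀ q ∈ T, q.1 = p.1 → q.2 < mid
    let R := T.filter fun p => ∀ q ∈ T, q.1 = p.1 → mid ≤ q.2
    let B := T.filter fun p => p.2 < mid ∧ (∃ q ∈ T, q.1 = p.1 ∧ mid ≤ q.2) ∧
      2 ^ k ≤ (T.filter fun q => q.1 = p.1 ∧ q.2 < mid).card
    let C := T.filter fun p => mid ≤ p.2 ∧ (∃ q ∈ T, q.1 = p.1 ∧ q.2 < mid) ∧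
      2 ^ k ≤ (T.filter fun q => q.1 = p.1 ∧ mid ≤ q.2).card
    have hL : (L.image Prod.fst).card ≤ l * 4 ^ τ := by
      refine ih (k + 1) a L ?_ ?_ fun h => hG (h.mono (filter_subset _ _))
      · intro p hp
        have hp' := mem_filter.1 hp
        exact ⟨(hT p hp'.1).1, hp'.2 p hp'.1 rfl⟩
      · intro p hp
        have hp' := mem_filter.1 hp
        refine (hk p hp'.1).trans (card_le_card fun q hq => ?_)
        simp only [L, mem_filter] at hq ⊢
        exact ⟨⟨hq.1, fun x hx hxq => hp'.2 x hx (hxq.trans hq.2)⟩, hq.2⟩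
    have hR : (R.image Prod.fst).card ≤ l * 4 ^ τ := by
      refine ih (k + 1) mid R ?_ ?_ fun h => hG (h.mono (filter_subset _ _))
      · intro p hp
        have hp' := mem_filter.1 hp
        have := (hT p hp'.1).2
        exact ⟨hp'.2 p hp'.1 rfl, by omega⟩
      · intro p hp
        have hp' := mem_filter.1 hp
        refine (hk p hp'.1).trans (card_le_card fun q hq => ?_)
        simp only [R, mem_filter] at hq ⊢
        exact ⟨⟨hq.1, fun x hx hxq => hp'.2 x hx (hxq.trans hq.2)⟩, hq.2⟩
    have hB : (B.image Prod.fst).card ≤ l * 4 ^ τ := by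
      refine ih k a B ?_ ?_ ?_
      · intro p hp
        have hp' := mem_filter.1 hp
        exact ⟨(hT p hp'.1).1, hp'.2.1⟩
      · intro p hp
        have hp' := mem_filter.1 hp
        refine hp'.2.2.2.trans (card_le_card fun q hq => ?_)
        simp only [mem_filter] at hq
        simp only [B, mem_filter, hq.2.1, and_true]
        exact ⟨hq.1, hq.2.2, hp'.2.2⟩
      · rintro ⟨p, hp, h1, h2⟩
        apply hG
        have hpB : ∀ i j, i < l → j < k + 1 → p i j ∈ B := hp
        have : ∀ i < l, ∃ q ∈ T, q.1 = (p i 0).1 ∧ mid ≤ q.2 := fun i hi =>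
          (mem_filter.1 (hpB i 0 hi (by omega))).2.2.1
        choose! q hqT hq1 hq2 using this
        -- All rows of `B` also meet the right half, so such ones form an additional last grid
        -- column.
        refine ⟨fun i j => if j < k + 1 then p i j else q i, ?_, ?_, ?_⟩
        · intro i j hi hj
          dsimp only
          split_ifs with h
          · exact filter_subset _ _ (hp i j hi h)
          · exact hqT i hi
        · intro i i' j j' hi hi' hj hj'
          dsimp only
          split_ifs with h h' h'
          · exact h1 i i' j j' hi hi' h h'
          · rw [hq1 i' hi']; exact h1 i i' j 0 hi hi' h (by omega)
          · rw [hq1 i (hi.trans hi')]; exact h1 i i' 0 j' hi hi' (by omega) h'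
          · rw [hq1 i' hi', hq1 i (hi.trans hi')]; exact h1 i i' 0 0 hi hi' (by omega) (by omega)
        · intro i i' j j' hi hi' hj hj'
          dsimp only
          split_ifs with h h' h'
          · exact h2 i i' j j' hi hi' hj h'
          · exact lt_of_lt_of_le (mem_filter.1 (hpB i j hi h)).2.1 (hq2 i' hi')
          · omega
          · omega
    have hC : (C.image Prod.fst).card ≤ l * 4 ^ τ := by
      refine ih k mid C ?_ ?_ ?_
      · intro p hp
        have hp' := mem_filter.1 hp
        have := (hT p hp'.1).2
        exact ⟨hp'.2.1, by omega⟩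
      · intro p hp
        have hp' := mem_filter.1 hp
        refine hp'.2.2.2.trans (card_le_card fun q hq => ?_)
        simp only [mem_filter] at hq
        simp only [C, mem_filter, hq.2.1, and_true]
        exact ⟨hq.1, hq.2.2, hp'.2.2⟩
      · rintro ⟨p, hp, h1, h2⟩
        apply hG
        have hpC : ∀ i j, i < l → j < k + 1 → p i j ∈ C := hp
        have : ∀ i < l, ∃ q ∈ T, q.1 = (p i 0).1 ∧ q.2 < mid := fun i hi =>
          (mem_filter.1 (hpC i 0 hi (by omega))).2.2.1
        choose! q hqT hq1 hq2 using this
        refine ⟨fun i j => if j = 0 then q i else p i (j - 1), ?_, ?_, ?_⟩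
        · intro i j hi hj
          dsimp only
          split_ifs with h
          · exact hqT i hi
          · exact filter_subset _ _ (hp i _ hi (by omega))
        · intro i i' j j' hi hi' hj hj'
          dsimp only
          split_ifs with h h' h'
          · rw [hq1 i' hi', hq1 i (hi.trans hi')]; exact h1 i i' 0 0 hi hi' (by omega) (by omega)
          · rw [hq1 i (hi.trans hi')]; exact h1 i i' 0 _ hi hi' (by omega) (by omega)
          · rw [hq1 i' hi']; exact h1 i i' _ 0 hi hi' (by omega) (by omega)
          · exact h1 i i' _ _ hi hi' (by omega) (by omega)
        · intro i i' j j' hi hi' hj hj'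
          dsimp only
          split_ifs with h h' h'
          · omega
          · exact lt_of_lt_of_le (hq2 i hi) (mem_filter.1 (hpC i' _ hi' (by omega))).2.1
          · omega
          · exact h2 i i' _ _ hi hi' (by omega) (by omega)
    have hcov : T.image Prod.fst ⊆
        ((L.image Prod.fst ∪ R.image Prod.fst) ∪ (B.image Prod.fst ∪ C.image Prod.fst)) := by
      intro r hr
      obtain ⟨p, hp, rfl⟩ := mem_image.1 hr
      simp only [mem_union, mem_image]
      by_cases h1 : ∀ q ∈ T, q.1 = p.1 → q.2 < mid
      · exact Or.inl (Or.inl ⟨p, mem_filter.2 ⟨hp, h1⟩, rfl⟩)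
      by_cases h2 : ∀ q ∈ T, q.1 = p.1 → mid ≤ q.2
      · exact Or.inl (Or.inr ⟨p, mem_filter.2 ⟨hp, h2⟩, rfl⟩)
      push Not at h1 h2
      obtain ⟨x, hx, hxp, hxm⟩ := h1
      obtain ⟨y, hy, hyp, hym⟩ := h2
      right
      have hsplit : (T.filter fun q => q.1 = p.1).card =
          (T.filter fun q => q.1 = p.1 ∧ q.2 < mid).card +
          (T.filter fun q => q.1 = p.1 ∧ mid ≤ q.2).card := by
        rw [← card_filter_add_card_filter_not (s := T.filter fun q => q.1 = p.1)
          (fun q => q.2 < mid), filter_filter, filter_filter]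
        simp only [not_lt]
      have := hk p hp
      rw [hsplit, pow_succ] at this
      rcases le_or_gt (2 ^ k) (T.filter fun q => q.1 = p.1 ∧ q.2 < mid).card with h | h
      · refine Or.inl ⟨y, mem_filter.2 ⟨hy, hym, ⟨x, hx, hxp.trans hyp.symm, hxm⟩, ?_⟩, hyp⟩
        rw [hyp]; exact h
      · refine Or.inr ⟨x, mem_filter.2 ⟨hx, hxm, ⟨y, hy, hyp.trans hxp.symm, hym⟩, ?_⟩, hxp⟩
        rw [hxp]; omega
    have h1 := card_le_card hcov
    have h2 := card_union_le (L.image Prod.fst ∪ R.image Prod.fst)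
      (B.image Prod.fst ∪ C.image Prod.fst)
    have h3 := card_union_le (L.image Prod.fst) (R.image Prod.fst)
    have h4 := card_union_le (B.image Prod.fst) (C.image Prod.fst)
    have : l * 4 ^ (τ + 1) = 4 * (l * 4 ^ τ) := by ring
    omega

/-- The block of side `t` containing a position. -/
def block (t : ℕ) (p : ℕ × ℕ) : ℕ × ℕ := (p.1 / t, p.2 / t)

theorem Grid.of_block {l k t : ℕ} {S : Finset (ℕ × ℕ)} (h : Grid l k (S.image (block t))) :
    Grid l k S := by
  refine h.of_map (f := fun x => x / t) (g := fun x => x / t)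
    (fun a b hab => Nat.div_le_div_right hab) (fun a b hab => Nat.div_le_div_right hab) ?_
  intro p hp
  obtain ⟨q, hq, rfl⟩ := mem_image.1 hp
  exact ⟨q, hq, rfl, rfl⟩

theorem card_filter_block_le {t : ℕ} (ht : 0 < t) (S : Finset (ℕ × ℕ)) (b : ℕ × ℕ) :
    (S.filter fun p => block t p = b).card ≤ t * t := by
  have : (S.filter fun p => block t p = b) ⊆
      Ico (b.1 * t) (b.1 * t + t) ×ˢ Ico (b.2 * t) (b.2 * t + t) := by
    intro p hp
    simp only [mem_filter, block, Prod.ext_iff] at hp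
    simp only [mem_product, mem_Ico]
    have h1 := hp.2.1; have h2 := hp.2.2
    rw [Nat.div_eq_iff ht] at h1 h2
    omega
  simpa using card_le_card this

/-- Within a vertical strip of blocks, contract the rows but keep the columns: the wide blocks
become rows with at least `2 ^ k` ones among `2 ^ τ` columns, and `card_rows_le_of_not_grid`
applies. -/
theorem card_wide_blocks_le {l k τ n : ℕ} {S : Finset (ℕ × ℕ)} (hS : ∀ p ∈ S, p.2 < n)
    (hG : ¬ Grid l (k + 1) S)
    (hw : ∀ p ∈ S, 2 ^ k ≤ ((S.filter fun q => block (2 ^ τ) q = block (2 ^ τ) p).image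
      Prod.snd).card) :
    (S.image (block (2 ^ τ))).card ≤ l * 4 ^ τ * (n / 2 ^ τ + 1) := by
  set t := 2 ^ τ with ht
  have ht0 : 0 < t := by positivity
  have h1 : ((S.image (block t)).image Prod.snd).card ≤ n / t + 1 := by
    have : (S.image (block t)).image Prod.snd ⊆ range (n / t + 1) := by
      intro v hv
      simp only [mem_image, exists_exists_and_eq_and] at hv
      obtain ⟨p, hp, rfl⟩ := hv
      rw [mem_range, Nat.lt_succ_iff]
      exact Nat.div_le_div_right (hS p hp).le
    simpa using card_le_card this
  refine (card_le_mul_card_image (f := Prod.snd) _ (l * 4 ^ τ) ?_).trans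
    (Nat.mul_le_mul_left _ h1)
  intro v _
  let T := (S.filter fun p => p.2 / t = v).image fun p => (p.1 / t, p.2)
  have hT : ((S.image (block t)).filter fun b => b.2 = v).card ≤ (T.image Prod.fst).card := by
    refine card_le_card_of_injOn Prod.fst ?_ ?_
    · intro b hb
      simp only [coe_filter, mem_image, Set.mem_ofPred_eq] at hb
      obtain ⟨⟨p, hp, rfl⟩, hv⟩ := hb
      simp only [T, coe_image, Set.mem_image, coe_filter, Set.mem_ofPred_eq]
      exact ⟨_, ⟨p, ⟨hp, hv⟩, rfl⟩, rfl⟩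
    · intro b hb b' hb' h
      simp only [coe_filter, Set.mem_ofPred_eq] at hb hb'
      exact Prod.ext h (hb.2.trans hb'.2.symm)
  refine hT.trans (card_rows_le_of_not_grid l τ k (v * t) T ?_ ?_ ?_)
  · intro p hp
    obtain ⟨q, hq, rfl⟩ := mem_image.1 hp
    have := (mem_filter.1 hq).2
    rw [Nat.div_eq_iff ht0] at this
    dsimp only
    omega
  · intro p hp
    obtain ⟨q, hq, rfl⟩ := mem_image.1 hp
    have hq' := mem_filter.1 hq
    refine (hw q hq'.1).trans ?_
    refine card_le_card_of_injOn (fun c => (q.1 / t, c)) ?_ ?_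
    · intro c hc
      simp only [coe_image, Set.mem_image, coe_filter, Set.mem_ofPred_eq, block,
        Prod.mk.injEq] at hc
      obtain ⟨x, ⟨hx, hx1, hx2⟩, rfl⟩ := hc
      simp only [T, coe_filter, mem_image, mem_filter, Set.mem_ofPred_eq, and_true]
      exact ⟨x, ⟨hx, hx2.trans hq'.2⟩, by rw [hx1]⟩
    · intro c _ c' _ h
      exact (Prod.ext_iff.1 h).2
  · intro h
    apply hG
    refine h.of_map (f := fun x => x / t) (g := id)
      (fun a b hab => Nat.div_le_div_right hab) monotone_id ?_
    intro p hp
    obtain ⟨q, hq, rfl⟩ := mem_image.1 hp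
    exact ⟨q, (mem_filter.1 hq).1, rfl, rfl⟩

/-- The constant in the linear bound for matrices without `(k + 1) × (k + 1)` grid. -/
def gridConst (k : ℕ) : ℕ := 8 * (k + 1) * (4 ^ (k + 1)) ^ 3

theorem card_le_of_not_grid (k : ℕ) : ∀ (n : ℕ) (S : Finset (ℕ × ℕ)), S ⊆ range n ×ˢ range n →
    ¬ Grid (k + 1) (k + 1) S → S.card ≤ gridConst k * n := by
  intro n
  induction n using Nat.strong_induction_on with
  | _ n ih =>
  intro S hSn hG
  -- A block neither wide nor tall has at most (2^k)² ones, and the contracted matrix has side at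
  -- most 2n/t. With t = 4 · (2^k)² the recursive term is half of the claimed bound.
  set t := 2 ^ (2 * (k + 1)) with ht
  have ht4 : t = 4 ^ (k + 1) := by rw [ht, pow_mul]; norm_num
  have hts : t = 4 * (2 ^ k * 2 ^ k) := by rw [ht]; ring
  have ht0 : 0 < t := by positivity
  have ht1 : 4 ≤ t := by
    rw [hts]; exact Nat.le_mul_of_pos_right _ (by positivity)
  have hc : gridConst k = 8 * (k + 1) * t ^ 3 := by rw [gridConst, ht4]
  have hmem : ∀ p ∈ S, p.1 < n ∧ p.2 < n := fun p hp => by simpa using hSn hp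
  rcases lt_or_ge n t with hnt | hnt
  · have h1 := card_le_card hSn
    simp only [card_product, card_range] at h1
    refine h1.trans (Nat.mul_le_mul_right _ (hnt.le.trans ?_))
    rw [hc]
    calc t = 1 * t ^ 1 := by ring
      _ ≤ 8 * (k + 1) * t ^ 3 := Nat.mul_le_mul (by omega) (Nat.pow_le_pow_right ht0 (by omega))
  set m := n / t + 1 with hm
  have hmn : m < n := by
    have : n / t ≤ n / 4 := Nat.div_le_div_left ht1 (by norm_num)
    omega
  have hmt : m * t ≤ 2 * n := by
    have := Nat.div_mul_le_self n t
    rw [hm, add_mul, one_mul]; omega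
  let W := S.filter fun p => 2 ^ k ≤ ((S.filter fun q => block t q = block t p).image Prod.snd).card
  let H := S.filter fun p => 2 ^ k ≤ ((S.filter fun q => block t q = block t p).image Prod.fst).card
  let R := S.filter fun p => ((S.filter fun q => block t q = block t p).image Prod.snd).card < 2 ^ k ∧
    ((S.filter fun q => block t q = block t p).image Prod.fst).card < 2 ^ k
  have hcov : S ⊆ (W ∪ H) ∪ R := by
    intro p hp
    simp only [W, H, R, mem_union, mem_filter, hp, true_and]
    omega
  have hW : W.card ≤ (t * t) * ((k + 1) * (t * t) * m) := by
    refine (card_le_mul_card_image (f := block t) W (t * t)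
      fun b _ => card_filter_block_le ht0 W b).trans (Nat.mul_le_mul_left _ ?_)
    have := card_wide_blocks_le (l := k + 1) (k := k) (τ := 2 * (k + 1)) (n := n) (S := W)
      (fun p hp => (hmem p (filter_subset _ _ hp)).2) (fun h => hG (h.mono (filter_subset _ _))) ?_
    · rw [← ht] at this
      convert this using 3
      rw [ht, ← mul_pow]; norm_num
    · intro p hp
      rw [← ht]
      refine (mem_filter.1 hp).2.trans (card_le_card (image_subset_image ?_))
      intro q hq
      simp only [W, mem_filter] at hq ⊢
      refine ⟨⟨hq.1, ?_⟩, hq.2⟩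
      rw [hq.2]; exact (mem_filter.1 hp).2
  have hH : H.card ≤ (t * t) * ((k + 1) * (t * t) * m) := by
    refine (card_le_mul_card_image (f := block t) H (t * t)
      fun b _ => card_filter_block_le ht0 H b).trans (Nat.mul_le_mul_left _ ?_)
    have hsw : ∀ p : ℕ × ℕ, block t p.swap = (block t p).swap := fun p => rfl
    have := card_wide_blocks_le (l := k + 1) (k := k) (τ := 2 * (k + 1)) (n := n)
      (S := H.image Prod.swap) ?_ (fun h => hG (h.of_swap.mono (filter_subset _ _))) ?_
    · rw [← ht] at this
      have e : (H.image Prod.swap).image (block t) = (H.image (block t)).image Prod.swap := by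
        rw [image_image, image_image]; rfl
      rw [e, card_image_of_injective _ Prod.swap_injective] at this
      convert this using 3
      rw [ht, ← mul_pow]; norm_num
    · intro p hp
      obtain ⟨q, hq, rfl⟩ := mem_image.1 hp
      exact (hmem q (filter_subset _ _ hq)).1
    · intro p hp
      obtain ⟨q, hq, rfl⟩ := mem_image.1 hp
      rw [← ht]
      refine (mem_filter.1 hq).2.trans (card_le_card ?_)
      intro r hr
      obtain ⟨x, hx, rfl⟩ := mem_image.1 hr
      rw [mem_filter] at hx
      refine mem_image.2 ⟨x.swap, mem_filter.2 ⟨mem_image_of_mem _ (mem_filter.2 ⟨hx.1, ?_⟩), ?_⟩, rfl⟩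
      · rw [hx.2]; exact (mem_filter.1 hq).2
      · rw [hsw, hsw, hx.2]
  have hR : R.card ≤ (2 ^ k * 2 ^ k) * (gridConst k * m) := by
    refine (card_le_mul_card_image (f := block t) R (2 ^ k * 2 ^ k) ?_).trans
      (Nat.mul_le_mul_left _ (ih m hmn _ ?_ ?_))
    · intro b hb
      obtain ⟨p, hp, rfl⟩ := mem_image.1 hb
      have hp' := (mem_filter.1 hp).2
      have : (R.filter fun q => block t q = block t p) ⊆
          ((S.filter fun q => block t q = block t p).image Prod.fst) ×ˢ
          ((S.filter fun q => block t q = block t p).image Prod.snd) := by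
        intro q hq
        have hq' := mem_filter.1 hq
        have : q ∈ S.filter fun q => block t q = block t p :=
          mem_filter.2 ⟨filter_subset _ _ hq'.1, hq'.2⟩
        exact mem_product.2 ⟨mem_image_of_mem _ this, mem_image_of_mem _ this⟩
      refine (card_le_card this).trans ?_
      rw [card_product]
      exact Nat.mul_le_mul hp'.2.le hp'.1.le
    · intro b hb
      obtain ⟨p, hp, rfl⟩ := mem_image.1 hb
      have := hmem p (filter_subset _ _ hp)
      simp only [mem_product, mem_range, block, hm, Nat.lt_succ_iff]
      exact ⟨Nat.div_le_div_right this.1.le, Nat.div_le_div_right this.2.le⟩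
    · exact fun h => hG (h.of_block.mono (filter_subset _ _))
  have h1 := card_le_card hcov
  have h2 := card_union_le (W ∪ H) R
  have h3 := card_union_le W H
  have e1 : (t * t) * ((k + 1) * (t * t) * m) ≤ (k + 1) * t ^ 3 * (2 * n) := by
    calc (t * t) * ((k + 1) * (t * t) * m) = (k + 1) * t ^ 3 * (m * t) := by ring
      _ ≤ _ := Nat.mul_le_mul_left _ hmt
  have e2 : 4 * ((2 ^ k * 2 ^ k) * (gridConst k * m)) ≤ gridConst k * (2 * n) := by
    calc 4 * ((2 ^ k * 2 ^ k) * (gridConst k * m)) = gridConst k * (m * t) := by rw [hts]; ring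
      _ ≤ _ := Nat.mul_le_mul_left _ hmt
  have e3 : gridConst k * (2 * n) = 8 * ((k + 1) * t ^ 3 * (2 * n)) := by rw [hc]; ring
  have e4 : gridConst k * (2 * n) = 2 * (gridConst k * n) := by ring
  omega

/-! ### Segment families and doubled permutation patterns -/

/-- A family of vertical segments `(x, y, c)`, standing for the rows `x ≤ r ≤ y` of column `c`;
segments in the same column may share an endpoint but do not overlap otherwise. -/
def IsSegFamily (F : Finset (ℕ × ℕ × ℕ)) : Prop :=
  (∀ s ∈ F, s.1 < s.2.1) ∧
    ∀ s ∈ F, ∀ s' ∈ F, s.2.2 = s'.2.2 → s ≠ s' → s.2.1 ≤ s'.1 ∨ s'.2.1 ≤ s.1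

/-- The family contains `k` segments in increasing columns with disjoint row ranges ordered
by `σ`. -/
def HasFormation (σ : ℕ → ℕ) (k : ℕ) (F : Finset (ℕ × ℕ × ℕ)) : Prop :=
  ∃ p : ℕ → ℕ × ℕ × ℕ, (∀ v < k, p v ∈ F) ∧
    (∀ v v', v < v' → v' < k → (p v).2.2 < (p v').2.2) ∧
    (∀ v v', v < k → v' < k → σ v < σ v' → (p v).2.1 < (p v').1)

theorem IsSegFamily.subset {F G : Finset (ℕ × ℕ × ℕ)} (h : IsSegFamily F) (hG : G ⊆ F) :
    IsSegFamily G :=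
  ⟨fun s hs => h.1 s (hG hs), fun s hs s' hs' => h.2 s (hG hs) s' (hG hs')⟩

/-- At least `s` columns have a segment inside the rows `z ≤ r < z'`. -/
def WideRows (U : Finset (ℕ × ℕ × ℕ)) (s z z' : ℕ) : Prop :=
  s ≤ ((U.filter fun e => z ≤ e.1 ∧ e.2.1 < z').image fun e => e.2.2).card

theorem exists_column_of_few {U : Finset (ℕ × ℕ × ℕ)} {s : ℕ}
    (h : (U.image fun e => e.2.2).card ≤ s) :
    ∃ D ⊆ U, (∀ e ∈ D, ∀ e' ∈ D, e.2.2 = e'.2.2) ∧ U.card ≤ s * D.card := by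
  rcases U.eq_empty_or_nonempty with rfl | hU
  · exact ⟨∅, by simp, by simp, by simp⟩
  obtain ⟨c, -, hc⟩ := exists_max_image (U.image fun e : ℕ × ℕ × ℕ => e.2.2)
    (fun c => (U.filter fun e : ℕ × ℕ × ℕ => e.2.2 = c).card) (hU.image _)
  refine ⟨U.filter fun e => e.2.2 = c, filter_subset _ _, ?_, ?_⟩
  · intro e he e' he'
    exact (mem_filter.1 he).2.trans (mem_filter.1 he').2.symm
  · refine (card_le_mul_card_image (f := fun e => e.2.2) U _ hc).trans ?_
    rw [mul_comm]
    exact Nat.mul_le_mul_right _ h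

/-- A greedy sweep downwards: close a row range as soon as it is wide. If this cannot be done `q`
times, then between consecutive cuts the segments use fewer than `s` columns, and the fullest of
these columns keeps a 1/s share of pairwise non-overlapping segments. Each cut wastes at most `2 *
t` segments. -/
theorem exists_disjoint_segments {U : Finset (ℕ × ℕ × ℕ)} (hU : IsSegFamily U) {s t : ℕ}
    (hs : 0 < s) (ht : (U.image fun e => e.2.2).card ≤ t) : ∀ (q z : ℕ),
    (¬ ∃ ζ : ℕ → ℕ, ζ 0 = z ∧ ∀ i < q, WideRows U s (ζ i) (ζ (i + 1))) →
    ∃ D ⊆ U, (∀ e ∈ D, z ≤ e.1) ∧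
      (∀ e ∈ D, ∀ e' ∈ D, e ≠ e' → e.2.1 ≤ e'.1 ∨ e'.2.1 ≤ e.1) ∧
      (U.filter fun e => z ≤ e.1).card ≤ s * D.card + 2 * t * q := by
  intro q
  induction q with
  | zero =>
    intro z h
    exact absurd ⟨fun _ => z, rfl, fun i hi => by omega⟩ h
  | succ q ih =>
    intro z h
    by_cases hz : ∃ z', WideRows U s z z'
    · obtain ⟨z', hw, hmin⟩ : ∃ z', WideRows U s z z' ∧ ∀ y < z', ¬ WideRows U s z y := by
        classical
        exact ⟨Nat.find hz, Nat.find_spec hz, fun y hy => Nat.find_min hz hy⟩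
      obtain ⟨D₁, hD₁, hD₁z, hD₁d, hD₁c⟩ := ih z' (by
        rintro ⟨ζ, h0, hζ⟩
        apply h
        refine ⟨fun i => if i = 0 then z else ζ (i - 1), by simp, fun i hi => ?_⟩
        rcases Nat.eq_zero_or_pos i with rfl | hi0
        · simpa [h0] using hw
        · have := hζ (i - 1) (by omega)
          rw [show i - 1 + 1 = i by omega] at this
          simpa [show i ≠ 0 by omega] using this)
      obtain ⟨D₂, hD₂, hD₂c, hD₂n⟩ : ∃ D₂ ⊆ U.filter fun e => z ≤ e.1 ∧ e.2.1 + 1 < z',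
          (∀ e ∈ D₂, ∀ e' ∈ D₂, e.2.2 = e'.2.2) ∧
            (U.filter fun e => z ≤ e.1 ∧ e.2.1 + 1 < z').card ≤ s * D₂.card := by
        apply exists_column_of_few
        rcases Nat.eq_zero_or_pos z' with h0 | h0
        · simp [h0]
        · have := hmin (z' - 1) (by omega)
          rw [WideRows, not_le] at this
          refine le_trans (card_le_card (image_subset_image ?_)) this.le
          intro e he
          rw [mem_filter] at he ⊢
          exact ⟨he.1, he.2.1, by omega⟩
      have hD₂' : ∀ e ∈ D₂, e ∈ U ∧ z ≤ e.1 ∧ e.2.1 + 1 < z' := fun e he => mem_filter.1 (hD₂ he)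
      have hzz' : ∀ e ∈ D₂, e.1 < z' := fun e he => by
        have := hU.1 e (hD₂' e he).1
        have := (hD₂' e he).2.2
        omega
      refine ⟨D₁ ∪ D₂, union_subset hD₁ fun e he => (hD₂' e he).1, ?_, ?_, ?_⟩
      · intro e he
        rcases mem_union.1 he with he | he
        · have h1 := hD₁z e he
          by_contra! hlt
          obtain ⟨c, hc⟩ := card_pos.1 (hs.trans_le hw)
          obtain ⟨x, hx, -⟩ := mem_image.1 hc
          have hx' := mem_filter.1 hx
          have := hU.1 x hx'.1
          have := hx'.2
          omega
        · exact (hD₂' e he).2.1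
      · intro e he e' he' hne
        rcases mem_union.1 he with he | he <;> rcases mem_union.1 he' with he' | he'
        · exact hD₁d e he e' he' hne
        · exact Or.inr ((Nat.le_of_succ_le (hD₂' e' he').2.2.le).trans (hD₁z e he))
        · exact Or.inl ((Nat.le_of_succ_le (hD₂' e he).2.2.le).trans (hD₁z e' he'))
        · exact hU.2 e (hD₂' e he).1 e' (hD₂' e' he').1 (hD₂c e he e' he') hne
      -- Besides the segments beyond the cut and those covered by minimality of `z'`, there remain
      -- those crossing row `z'` and those ending exactly at `z' - 1`. Each of these two classes has
      -- at most one segment per column.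
      · have hcov : (U.filter fun e => z ≤ e.1) ⊆ ((U.filter fun e => z' ≤ e.1) ∪
            (U.filter fun e => z ≤ e.1 ∧ e.2.1 + 1 < z')) ∪
              ((U.filter fun e => e.1 < z' ∧ z' ≤ e.2.1) ∪ U.filter fun e => e.2.1 + 1 = z') := by
          intro e he
          rw [mem_filter] at he
          simp only [mem_union, mem_filter, he.1, he.2, true_and]
          omega
        have hinj : ∀ P : ℕ × ℕ × ℕ → Prop, ∀ [DecidablePred P],
            (∀ e ∈ U, ∀ e' ∈ U, P e → P e' → ¬ e.2.1 ≤ e'.1) → (U.filter P).card ≤ t := by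
          intro P _ hP
          refine le_trans ?_ ht
          refine card_le_card_of_injOn (fun e => e.2.2) ?_ ?_
          · intro e he
            exact mem_coe.2 (mem_image_of_mem _ (mem_filter.1 (mem_coe.1 he)).1)
          · intro e he e' he' hee
            have h1 := mem_filter.1 (mem_coe.1 he)
            have h2 := mem_filter.1 (mem_coe.1 he')
            by_contra hne
            rcases hU.2 e h1.1 e' h2.1 hee hne with h | h
            · exact hP e h1.1 e' h2.1 h1.2 h2.2 h
            · exact hP e' h2.1 e h1.1 h2.2 h1.2 h
        have hcross : (U.filter fun e => e.1 < z' ∧ z' ≤ e.2.1).card ≤ t :=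
          hinj _ fun e he e' he' h h' => by omega
        have hend : (U.filter fun e => e.2.1 + 1 = z').card ≤ t :=
          hinj _ fun e he e' he' h h' => by have := hU.1 e' he'; omega
        have hdisj : Disjoint D₁ D₂ := by
          rw [disjoint_left]
          intro e h1 h2
          have := hD₁z e h1
          have := hzz' e h2
          omega
        rw [card_union_of_disjoint hdisj]
        have h1 := card_le_card hcov
        have h2 := card_union_le ((U.filter fun e => z' ≤ e.1) ∪
            (U.filter fun e => z ≤ e.1 ∧ e.2.1 + 1 < z'))
          ((U.filter fun e => e.1 < z' ∧ z' ≤ e.2.1) ∪ U.filter fun e => e.2.1 + 1 = z')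
        have h3 := card_union_le (U.filter fun e => z' ≤ e.1)
          (U.filter fun e => z ≤ e.1 ∧ e.2.1 + 1 < z')
        have h4 := card_union_le (U.filter fun e => e.1 < z' ∧ z' ≤ e.2.1)
          (U.filter fun e => e.2.1 + 1 = z')
        rw [mul_add, mul_add, mul_one]
        omega
    · push Not at hz
      obtain ⟨D, hD, hDc, hDn⟩ : ∃ D ⊆ U.filter fun e => z ≤ e.1,
          (∀ e ∈ D, ∀ e' ∈ D, e.2.2 = e'.2.2) ∧
            (U.filter fun e => z ≤ e.1).card ≤ s * D.card := by
        apply exists_column_of_few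
        have := hz ((U.sup fun e => e.2.1) + 1)
        rw [WideRows, not_le] at this
        refine le_trans (card_le_card (image_subset_image ?_)) this.le
        intro e he
        rw [mem_filter] at he ⊢
        exact ⟨he.1, he.2, Nat.lt_succ_of_le (le_sup (f := fun e : ℕ × ℕ × ℕ => e.2.1) he.1)⟩
      have hD' : ∀ e ∈ D, e ∈ U ∧ z ≤ e.1 := fun e he => mem_filter.1 (hD he)
      exact ⟨D, fun e he => (hD' e he).1, fun e he => (hD' e he).2,
        fun e he e' he' => hU.2 e (hD' e he).1 e' (hD' e' he').1 (hDc e he e' he'), by omega⟩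

/-- Contracting groups of `2 ^ τ` columns. -/
theorem exists_column_contraction {σ : ℕ → ℕ} {k τ m n : ℕ} (hσ : ∀ v < k + 1, σ v < k + 1)
    {F : Finset (ℕ × ℕ × ℕ)} (hF : IsSegFamily F) (hFf : ¬ HasFormation σ (k + 1) F)
    (hm : ∀ e ∈ F, e.2.2 < m) (hn : ∀ e ∈ F, e.2.1 ≤ n) :
    ∃ G : Finset (ℕ × ℕ × ℕ), IsSegFamily G ∧ ¬ HasFormation σ (k + 1) G ∧
      (∀ e ∈ G, e.2.2 < m / 2 ^ τ + 1) ∧ (∀ e ∈ G, e.2.1 ≤ n) ∧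
      F.card ≤ 2 ^ k * G.card + (m / 2 ^ τ + 1) * (2 * 2 ^ τ * ((k + 1) * 4 ^ τ + 1)) := by
  set t := 2 ^ τ with ht
  have ht0 : 0 < t := by positivity
  let U : ℕ → Finset (ℕ × ℕ × ℕ) := fun v => F.filter fun e => e.2.2 / t = v
  have hUF : ∀ v, U v ⊆ F := fun v => filter_subset _ _
  have hUcol : ∀ v, ((U v).image fun e => e.2.2) ⊆ Ico (v * t) (v * t + t) := by
    intro v c hc
    obtain ⟨e, he, rfl⟩ := mem_image.1 hc
    have := (mem_filter.1 he).2
    rw [Nat.div_eq_iff ht0] at this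
    rw [mem_Ico]; omega
  have key : ∀ v, ∃ D ⊆ U v,
      (∀ e ∈ D, ∀ e' ∈ D, e ≠ e' → e.2.1 ≤ e'.1 ∨ e'.2.1 ≤ e.1) ∧
      (U v).card ≤ 2 ^ k * D.card + 2 * t * ((k + 1) * 4 ^ τ + 1) := by
    intro v
    obtain ⟨D, hD, -, hDd, hDc⟩ := exists_disjoint_segments (hF.subset (hUF v)) (s := 2 ^ k)
      (t := t) (by positivity) (by simpa using card_le_card (hUcol v)) ((k + 1) * 4 ^ τ + 1) 0 (by
        rintro ⟨ζ, -, hζ⟩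
        set q := (k + 1) * 4 ^ τ + 1
        have hmono : ∀ i j, i ≤ j → j ≤ q → ζ i ≤ ζ j := by
          intro i j hij
          induction j, hij using Nat.le_induction with
          | base => intro _; exact le_rfl
          | succ j hij ih =>
            intro hj
            refine (ih (by omega)).trans ?_
            obtain ⟨c, hc⟩ := card_pos.1 (lt_of_lt_of_le (by positivity) (hζ j (by omega)))
            obtain ⟨x, hx, -⟩ := mem_image.1 hc
            have hx' := mem_filter.1 hx
            have := (hF.subset (hUF v)).1 x hx'.1
            omega
        -- Row `i` records the columns with a segment inside the `i`-th wide range. With `q` rows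
        -- this matrix is too tall to avoid a grid, and the grid entries `(σ a, a)` give a
        -- formation.
        let T : Finset (ℕ × ℕ) := (range q).biUnion fun i =>
          ((U v).filter fun e => ζ i ≤ e.1 ∧ e.2.1 < ζ (i + 1)).image fun e => (i, e.2.2)
        have hT : ∀ p : ℕ × ℕ, p ∈ T ↔ p.1 < q ∧ ∃ e ∈ U v, ζ p.1 ≤ e.1 ∧ e.2.1 < ζ (p.1 + 1) ∧
            e.2.2 = p.2 := by
          rintro ⟨i, c⟩
          simp only [T, mem_biUnion, mem_range, mem_image, mem_filter, Prod.mk.injEq]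
          constructor
          · rintro ⟨j, hj, e, ⟨he, h1, h2⟩, rfl, rfl⟩
            exact ⟨hj, e, he, h1, h2, rfl⟩
          · rintro ⟨hj, e, he, h1, h2, rfl⟩
            exact ⟨i, hj, e, ⟨he, h1, h2⟩, rfl, rfl⟩
        have hrow : ∀ i < q, 2 ^ k ≤ (T.filter fun x => x.1 = i).card := by
          intro i hi
          refine (hζ i hi).trans (card_le_card_of_injOn (fun c => (i, c)) ?_ ?_)
          · intro c hc
            obtain ⟨e, he, rfl⟩ := mem_image.1 (mem_coe.1 hc)
            have he' := mem_filter.1 he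
            rw [mem_coe, mem_filter, hT]
            exact ⟨⟨hi, e, he'.1, he'.2.1, he'.2.2, rfl⟩, rfl⟩
          · intro c _ c' _ h
            exact (Prod.ext_iff.1 h).2
        have hG : Grid (k + 1) (k + 1) T := by
          by_contra hG
          have := card_rows_le_of_not_grid (k + 1) τ k (v * t) T ?_ ?_ hG
          · have h2 : range q ⊆ T.image Prod.fst := by
              intro i hi
              rw [mem_range] at hi
              obtain ⟨x, hx⟩ := card_pos.1 (lt_of_lt_of_le (by positivity) (hrow i hi))
              rw [mem_filter] at hx
              exact mem_image.2 ⟨x, hx⟩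
            have h3 := card_le_card h2
            rw [card_range] at h3
            omega
          · intro p hp
            obtain ⟨-, e, he, -, -, h⟩ := (hT p).1 hp
            have := hUcol v (mem_image_of_mem _ he)
            rw [mem_Ico] at this
            rw [← h, ← ht]; exact this
          · intro p hp
            exact hrow p.1 ((hT p).1 hp).1
        obtain ⟨p, hp, h1, h2⟩ := hG
        have hp' : ∀ a < k + 1, p (σ a) a ∈ T := fun a ha => hp _ _ (hσ a ha) ha
        have : ∀ a < k + 1, ∃ e ∈ U v, ζ (p (σ a) a).1 ≤ e.1 ∧ e.2.1 < ζ ((p (σ a) a).1 + 1) ∧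
            e.2.2 = (p (σ a) a).2 := fun a ha => ((hT _).1 (hp' a ha)).2
        choose! e he he1 he2 he3 using this
        refine hFf ⟨e, fun a ha => hUF v (he a ha), ?_, ?_⟩
        · intro a b hab hb
          rw [he3 a (hab.trans hb), he3 b hb]
          exact h2 _ _ _ _ (hσ a (hab.trans hb)) (hσ b hb) hab hb
        · intro a b ha hb hab
          have hlt := h1 _ _ a b hab (hσ b hb) ha hb
          exact (he2 a ha).trans_le ((hmono _ _ hlt ((hT _).1 (hp' b hb)).1.le).trans (he1 b hb)))
    refine ⟨D, hD, hDd, ?_⟩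
    simpa using hDc
  choose D hDU hDd hDc using key
  -- The chosen segments of a group do not overlap, so they can share a single column.
  let G := (range (m / t + 1)).biUnion fun v => (D v).image fun e => (e.1, e.2.1, v)
  have hG : ∀ g : ℕ × ℕ × ℕ, g ∈ G ↔ g.2.2 < m / t + 1 ∧ ∃ e ∈ D g.2.2, e.1 = g.1 ∧
      e.2.1 = g.2.1 := by
    rintro ⟨x, y, c⟩
    simp only [G, mem_biUnion, mem_range, mem_image, Prod.mk.injEq]
    constructor
    · rintro ⟨v, hv, e, he, h1, h2, rfl⟩
      exact ⟨hv, e, he, h1, h2⟩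
    · rintro ⟨hv, e, he, h1, h2⟩
      exact ⟨c, hv, e, he, h1, h2, rfl⟩
  have hDF : ∀ v, ∀ e ∈ D v, e ∈ F ∧ e.2.2 / t = v := fun v e he => mem_filter.1 (hDU v he)
  refine ⟨G, ⟨?_, ?_⟩, ?_, ?_, ?_, ?_⟩
  · intro g hg
    obtain ⟨-, e, he, h1, h2⟩ := (hG g).1 hg
    rw [← h1, ← h2]
    exact hF.1 e (hDF _ e he).1
  · intro g hg g' hg' hc hne
    obtain ⟨-, e, he, h1, h2⟩ := (hG g).1 hg
    obtain ⟨-, e', he', h1', h2'⟩ := (hG g').1 hg'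
    rw [← h1, ← h2, ← h1', ← h2']
    rw [← hc] at he'
    refine hDd _ e he e' he' ?_
    rintro rfl
    exact hne (Prod.ext (h1.symm.trans h1') (Prod.ext (h2.symm.trans h2') hc))
  · rintro ⟨p, hp, h1, h2⟩
    have : ∀ a < k + 1, ∃ e ∈ D (p a).2.2, e.1 = (p a).1 ∧ e.2.1 = (p a).2.1 :=
      fun a ha => ((hG _).1 (hp a ha)).2
    choose! e he he1 he2 using this
    refine hFf ⟨e, fun a ha => (hDF _ _ (he a ha)).1, ?_, ?_⟩
    · intro a b hab hb
      have := h1 a b hab hb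
      rw [← (hDF _ _ (he a (hab.trans hb))).2, ← (hDF _ _ (he b hb)).2] at this
      exact lt_of_not_ge fun h => this.not_ge (Nat.div_le_div_right h)
    · intro a b ha hb hab
      rw [he2 a ha, he1 b hb]
      exact h2 a b ha hb hab
  · intro g hg
    exact ((hG g).1 hg).1
  · intro g hg
    obtain ⟨-, e, he, h1, h2⟩ := (hG g).1 hg
    rw [← h2]
    exact hn e (hDF _ e he).1
  · have hcardG : G.card = ∑ v ∈ range (m / t + 1), (D v).card := by
      rw [card_biUnion]
      · refine sum_congr rfl fun v _ => card_image_of_injOn ?_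
        intro e he e' he' h
        simp only [Prod.mk.injEq, and_true] at h
        by_contra hne
        have h1 := hDd v e he e' he' hne
        have h2 := hF.1 e (hDF v e he).1
        have h3 := hF.1 e' (hDF v e' he').1
        omega
      · intro v _ v' _ hvv
        refine disjoint_left.2 fun g hg hg' => ?_
        obtain ⟨e, -, rfl⟩ := mem_image.1 hg
        obtain ⟨e', -, h⟩ := mem_image.1 hg'
        exact hvv (Prod.ext_iff.1 (Prod.ext_iff.1 h).2).2.symm
    have hcardF : F.card = ∑ v ∈ range (m / t + 1), (U v).card := by
      refine card_eq_sum_card_fiberwise (f := fun e : ℕ × ℕ × ℕ => e.2.2 / t) fun e he => ?_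
      rw [mem_coe, mem_range, Nat.lt_succ_iff]
      exact Nat.div_le_div_right (hm e (mem_coe.1 he)).le
    rw [hcardF, hcardG, mul_sum]
    refine (sum_le_sum fun v _ => hDc v).trans ?_
    rw [sum_add_distrib, sum_const, card_range, smul_eq_mul]

theorem IsSegFamily.fst_inj {F : Finset (ℕ × ℕ × ℕ)} (hF : IsSegFamily F)
    {e e' : ℕ × ℕ × ℕ} (he : e ∈ F) (he' : e' ∈ F) (h : e.1 = e'.1) (hc : e.2.2 = e'.2.2) :
    e = e' := by
  by_contra hne
  have := hF.2 e he e' he' hc hne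
  have := hF.1 e he
  have := hF.1 e' he'
  omega

/-- Contracting groups of `t` rows. -/
theorem exists_row_contraction {σ : ℕ → ℕ} {k t m n : ℕ} (ht : 0 < t)
    (hσ : ∀ v < k + 1, σ v < k + 1)
    {F : Finset (ℕ × ℕ × ℕ)} (hF : IsSegFamily F) (hFf : ¬ HasFormation σ (k + 1) F)
    (hm : ∀ e ∈ F, e.2.2 < m) (hn : ∀ e ∈ F, e.2.1 ≤ n) (hnm : n / t < m) :
    ∃ G : Finset (ℕ × ℕ × ℕ), IsSegFamily G ∧ ¬ HasFormation σ (k + 1) G ∧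
      (∀ e ∈ G, e.2.2 < m) ∧ (∀ e ∈ G, e.2.1 ≤ m) ∧
      F.card ≤ G.card + t * (gridConst k * m) := by
  -- Segments crossing a boundary between row groups survive contraction. Those inside one row group
  -- become points, and a grid of such points would yield a formation, so Marcus–Tardos bounds their
  -- number.
  let A := F.filter fun e => e.1 / t < e.2.1 / t
  let B := F.filter fun e => e.1 / t = e.2.1 / t
  have hA : ∀ e ∈ A, e ∈ F ∧ e.1 / t < e.2.1 / t := fun e he => mem_filter.1 he
  have hB : ∀ e ∈ B, e ∈ F ∧ e.1 / t = e.2.1 / t := fun e he => mem_filter.1 he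
  let φ : ℕ × ℕ × ℕ → ℕ × ℕ × ℕ := fun e => (e.1 / t, e.2.1 / t, e.2.2)
  have hsep : ∀ e ∈ A, ∀ e' ∈ A, e.2.2 = e'.2.2 → e ≠ e' →
      e.2.1 / t ≤ e'.1 / t ∨ e'.2.1 / t ≤ e.1 / t := by
    intro e he e' he' hc hne
    rcases hF.2 e (hA e he).1 e' (hA e' he').1 hc hne with h | h
    · exact Or.inl (Nat.div_le_div_right h)
    · exact Or.inr (Nat.div_le_div_right h)
  refine ⟨A.image φ, ⟨?_, ?_⟩, ?_, ?_, ?_, ?_⟩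
  · intro g hg
    obtain ⟨e, he, rfl⟩ := mem_image.1 hg
    exact (hA e he).2
  · intro g hg g' hg' hc hne
    obtain ⟨e, he, rfl⟩ := mem_image.1 hg
    obtain ⟨e', he', rfl⟩ := mem_image.1 hg'
    exact hsep e he e' he' hc fun h => hne (by rw [h])
  · rintro ⟨p, hp, h1, h2⟩
    have : ∀ a < k + 1, ∃ e ∈ A, φ e = p a := fun a ha => mem_image.1 (hp a ha)
    choose! e he hep using this
    refine hFf ⟨e, fun a ha => (hA _ (he a ha)).1, ?_, ?_⟩
    · intro a b hab hb
      have := h1 a b hab hb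
      rw [← hep a (hab.trans hb), ← hep b hb] at this
      exact this
    · intro a b ha hb hab
      have h3 := h2 a b ha hb hab
      rw [← hep a ha, ← hep b hb] at h3
      exact lt_of_not_ge fun h => h3.not_ge (Nat.div_le_div_right h)
  · intro g hg
    obtain ⟨e, he, rfl⟩ := mem_image.1 hg
    exact hm e (hA e he).1
  · intro g hg
    obtain ⟨e, he, rfl⟩ := mem_image.1 hg
    exact (Nat.div_le_div_right (hn e (hA e he).1)).trans hnm.le
  · have hAcard : (A.image φ).card = A.card := by
      refine card_image_of_injOn fun e he e' he' h => ?_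
      by_contra hne
      have h1 := hA e he
      have h2 := hA e' he'
      simp only [φ, Prod.mk.injEq] at h
      have := hsep e he e' he' h.2.2 hne
      omega
    have hBcard : B.card ≤ t * (gridConst k * m) := by
      refine (card_le_mul_card_image (f := fun e => (e.1 / t, e.2.2)) B t ?_).trans
        (Nat.mul_le_mul_left _ (card_le_of_not_grid k m _ ?_ ?_))
      · rintro ⟨w, c⟩ -
        have : (B.filter fun e => (e.1 / t, e.2.2) = (w, c)).card ≤
            (Ico (w * t) (w * t + t)).card := by
          refine card_le_card_of_injOn (fun e => e.1) ?_ ?_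
          · intro e he
            have h := (Prod.ext_iff.1 (mem_filter.1 (mem_coe.1 he)).2).1
            dsimp only at h
            rw [Nat.div_eq_iff ht] at h
            rw [mem_coe, mem_Ico]
            dsimp only
            omega
          · intro e he e' he' h
            have h1 := mem_filter.1 (mem_coe.1 he)
            have h2 := mem_filter.1 (mem_coe.1 he')
            exact hF.fst_inj (hB e h1.1).1 (hB e' h2.1).1 h
              ((Prod.ext_iff.1 h1.2).2.trans (Prod.ext_iff.1 h2.2).2.symm)
        simpa using this
      · intro g hg
        obtain ⟨e, he, rfl⟩ := mem_image.1 hg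
        have h1 := hm e (hB e he).1
        have h2 : e.1 / t ≤ n / t :=
          (hB e he).2.le.trans (Nat.div_le_div_right (hn e (hB e he).1))
        simp only [mem_product, mem_range]
        omega
      · rintro ⟨p, hp, h1, h2⟩
        have : ∀ a < k + 1, ∃ e ∈ B, (e.1 / t, e.2.2) = p (σ a) a :=
          fun a ha => mem_image.1 (hp _ _ (hσ a ha) ha)
        choose! e he hep using this
        refine hFf ⟨e, fun a ha => (hB _ (he a ha)).1, ?_, ?_⟩
        · intro a b hab hb
          have := h2 _ _ _ _ (hσ a (hab.trans hb)) (hσ b hb) hab hb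
          rw [← hep a (hab.trans hb), ← hep b hb] at this
          exact this
        · intro a b ha hb hab
          have := h1 _ _ a b hab (hσ b hb) ha hb
          rw [← hep a ha, ← hep b hb] at this
          dsimp only at this
          rw [(hB _ (he a ha)).2] at this
          exact lt_of_not_ge fun h => this.not_ge (Nat.div_le_div_right h)
    have h1 : F.card ≤ A.card + B.card := by
      refine le_trans (card_le_card ?_) (card_union_le A B)
      intro e he
      have := hF.1 e he
      have : e.1 / t ≤ e.2.1 / t := Nat.div_le_div_right this.le
      simp only [A, B, mem_union, mem_filter, he, true_and]
      omega
    omega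

/-- The constant in the linear bound for segment families without formation. -/
def segConst (k : ℕ) : ℕ :=
  4 * (2 * ((k + 1) * 4 ^ (k + 2) + 1) + 2 ^ k * gridConst k)

theorem card_le_of_not_hasFormation {σ : ℕ → ℕ} {k : ℕ} (hσ : ∀ v < k + 1, σ v < k + 1) :
    ∀ (n : ℕ) (F : Finset (ℕ × ℕ × ℕ)), IsSegFamily F → ¬ HasFormation σ (k + 1) F →
      (∀ e ∈ F, e.2.2 < n) → (∀ e ∈ F, e.2.1 ≤ n) → F.card ≤ segConst k * n := by
  intro n
  induction n using Nat.strong_induction_on with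
  | _ n ih =>
  intro F hF hFf hm hn
  -- Column contraction loses a factor 2^k and the new side is at most 2n/t; t = 4 · 2^k leaves half
  -- of the bound for the error terms.
  set t := 2 ^ (k + 2) with ht
  have hts : t = 4 * 2 ^ k := by rw [ht]; ring
  have ht0 : 0 < t := by positivity
  have ht4 : 4 ≤ t := by
    rw [hts]; exact Nat.le_mul_of_pos_right _ (by positivity)
  have htt : 4 ^ (k + 2) = t * t := by rw [ht, ← mul_pow]; norm_num
  rcases lt_or_ge n t with hnt | hnt
  · have h1 : F.card ≤ (range n ×ˢ range n).card := by
      refine card_le_card_of_injOn (fun e => (e.1, e.2.2)) ?_ ?_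
      · intro e he
        have h1 := hm e he
        have h2 := hn e he
        have h3 := hF.1 e he
        simp only [coe_product, Set.mem_prod, mem_coe, mem_range]
        omega
      · intro e he e' he' h
        exact hF.fst_inj he he' (Prod.ext_iff.1 h).1 (Prod.ext_iff.1 h).2
    rw [card_product, card_range] at h1
    refine h1.trans (Nat.mul_le_mul_right _ (hnt.le.trans ?_))
    rw [segConst, htt]
    nlinarith [Nat.zero_le (2 ^ k * gridConst k), Nat.mul_le_mul ht4 ht4,
      Nat.zero_le (k * (t * t))]
  set m := n / t + 1 with hmdef
  have hmn : m < n := by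
    have : n / t ≤ n / 4 := Nat.div_le_div_left ht4 (by norm_num)
    omega
  have hmt : m * t ≤ 2 * n := by
    have := Nat.div_mul_le_self n t
    rw [hmdef, add_mul, one_mul]; omega
  obtain ⟨G, hG, hGf, hGm, hGn, hGc⟩ := exists_column_contraction (τ := k + 2) hσ hF hFf hm hn
  rw [← ht, ← hmdef] at hGm hGc
  obtain ⟨H, hH, hHf, hHm, hHn, hHc⟩ := exists_row_contraction ht0 hσ hG hGf hGm hGn (by omega)
  have h1 := ih m hmn H hH hHf hHm hHn
  have h2 : 2 ^ k * G.card ≤ 2 ^ k * (segConst k * m + t * (gridConst k * m)) :=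
    Nat.mul_le_mul_left _ (by omega)
  have e1 : 2 * (2 ^ k * (segConst k * m)) ≤ segConst k * n := by
    have : 4 * (2 ^ k * (segConst k * m)) ≤ segConst k * (2 * n) :=
      calc 4 * (2 ^ k * (segConst k * m)) = segConst k * (m * t) := by rw [hts]; ring
        _ ≤ _ := Nat.mul_le_mul_left _ hmt
    have : segConst k * (2 * n) = 2 * (segConst k * n) := by ring
    omega
  have e2 : 2 * (2 ^ k * (t * (gridConst k * m)) + m * (2 * t * ((k + 1) * 4 ^ (k + 2) + 1))) ≤
      segConst k * n := by
    calc _ = 2 * (2 * ((k + 1) * 4 ^ (k + 2) + 1) + 2 ^ k * gridConst k) * (m * t) := by ring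
      _ ≤ 2 * (2 * ((k + 1) * 4 ^ (k + 2) + 1) + 2 ^ k * gridConst k) * (2 * n) :=
        Nat.mul_le_mul_left _ hmt
      _ = segConst k * n := by rw [segConst]; ring
  rw [mul_add] at h2
  omega

/-- The ones contain the permutation pattern in which every one is doubled vertically. -/
def HasDouble (σ : ℕ → ℕ) (k : ℕ) (N : Finset (ℕ × ℕ)) : Prop :=
  ∃ a b c : ℕ → ℕ, (∀ v < k, (a v, c v) ∈ N ∧ (b v, c v) ∈ N ∧ a v < b v) ∧
    (∀ v v', v < v' → v' < k → c v < c v') ∧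
    (∀ v v', v < k → v' < k → σ v < σ v' → b v < a v')

/-- Join every one to the next one below it in its column. These segments form a family in which a
formation is a doubled permutation pattern; only the last one of each column starts no segment. -/
theorem card_le_of_not_hasDouble {σ : ℕ → ℕ} {k n m : ℕ} (hσ : ∀ v < k + 1, σ v < k + 1)
    {N : Finset (ℕ × ℕ)} (hN : N ⊆ range n ×ˢ range m) (hD : ¬ HasDouble σ (k + 1) N) :
    N.card ≤ (segConst k + 1) * (n + m) := by
  classical
  let nxt : ℕ × ℕ → Finset ℕ := fun p => (N.filter fun q => q.2 = p.2 ∧ p.1 < q.1).image Prod.fst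
  have hnxt : ∀ p y, y ∈ nxt p ↔ (y, p.2) ∈ N ∧ p.1 < y := by
    intro p y
    simp only [nxt, mem_image, mem_filter]
    constructor
    · rintro ⟨⟨a, b⟩, ⟨h1, h2, h3⟩, rfl⟩
      simp only at h2 h3
      subst h2
      exact ⟨h1, h3⟩
    · rintro ⟨h1, h2⟩
      exact ⟨_, ⟨h1, rfl, h2⟩, rfl⟩
  let A := N.filter fun p => (nxt p).Nonempty
  let f : ℕ × ℕ → ℕ × ℕ × ℕ := fun p => (p.1, sInf (nxt p : Set ℕ), p.2)
  have hf : ∀ p ∈ A, (p.1, p.2) ∈ N ∧ (sInf (nxt p : Set ℕ), p.2) ∈ N ∧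
      p.1 < sInf (nxt p : Set ℕ) := by
    intro p hp
    have hp' := mem_filter.1 hp
    have : sInf (nxt p : Set ℕ) ∈ nxt p := by
      have := Nat.sInf_mem (s := (nxt p : Set ℕ)) hp'.2
      exact this
    exact ⟨hp'.1, (hnxt _ _).1 this⟩
  have hA : (A.image f).card = A.card :=
    card_image_of_injective _ fun p q h => by
      simp only [f, Prod.mk.injEq] at h
      exact Prod.ext h.1 h.2.2
  have hle : ∀ p ∈ A, ∀ q ∈ A, p.2 = q.2 → p.1 < q.1 → sInf (nxt p : Set ℕ) ≤ q.1 := by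
    intro p hp q hq h h'
    refine Nat.sInf_le ?_
    rw [mem_coe, hnxt, h]
    exact ⟨(hf q hq).1, h'⟩
  have hfam : IsSegFamily (A.image f) := by
    refine ⟨?_, ?_⟩
    · intro e he
      obtain ⟨p, hp, rfl⟩ := mem_image.1 he
      exact (hf p hp).2.2
    · intro e he e' he' hc hne
      obtain ⟨p, hp, rfl⟩ := mem_image.1 he
      obtain ⟨q, hq, rfl⟩ := mem_image.1 he'
      change p.2 = q.2 at hc
      rcases lt_trichotomy p.1 q.1 with h | h | h
      · exact Or.inl (hle p hp q hq hc h)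
      · exact absurd (congrArg f (Prod.ext h hc)) hne
      · exact Or.inr (hle q hq p hp hc.symm h)
  have hmem : ∀ p ∈ N, p.1 < n ∧ p.2 < m := fun p hp => by simpa using hN hp
  have h1 : (A.image f).card ≤ segConst k * (n + m) := by
    refine card_le_of_not_hasFormation hσ _ _ hfam ?_ ?_ ?_
    · rintro ⟨p, hp, h1, h2⟩
      have hp' : ∀ v < k + 1, ((p v).1, (p v).2.2) ∈ N ∧ ((p v).2.1, (p v).2.2) ∈ N ∧
          (p v).1 < (p v).2.1 := by
        intro v hv
        obtain ⟨q, hq, h⟩ := mem_image.1 (hp v hv)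
        rw [← h]
        exact hf q hq
      exact hD ⟨fun v => (p v).1, fun v => (p v).2.1, fun v => (p v).2.2, hp', h1, h2⟩
    · intro e he
      obtain ⟨p, hp, rfl⟩ := mem_image.1 he
      have := hmem _ (hf p hp).1
      simp only [f] at this ⊢
      omega
    · intro e he
      obtain ⟨p, hp, rfl⟩ := mem_image.1 he
      have := hmem _ (hf p hp).2.1
      simp only [f] at this ⊢
      omega
  have h2 : (N.filter fun p => ¬ (nxt p).Nonempty).card ≤ m := by
    have : (N.filter fun p => ¬ (nxt p).Nonempty).card ≤ (range m).card := by
      refine card_le_card_of_injOn Prod.snd ?_ ?_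
      · intro p hp
        exact mem_coe.2 (mem_range.2 (hmem p (mem_filter.1 (mem_coe.1 hp)).1).2)
      · intro p hp q hq h
        have hp' := mem_filter.1 (mem_coe.1 hp)
        have hq' := mem_filter.1 (mem_coe.1 hq)
        by_contra hne
        have : p.1 ≠ q.1 := fun h' => hne (Prod.ext h' h)
        rcases lt_or_gt_of_ne this with h' | h'
        · exact hp'.2 ⟨q.1, (hnxt _ _).2 ⟨by rw [h]; exact hq'.1, h'⟩⟩
        · exact hq'.2 ⟨p.1, (hnxt _ _).2 ⟨by rw [← h]; exact hp'.1, h'⟩⟩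
    simpa using this
  have h3 := card_filter_add_card_filter_not (s := N) fun p => (nxt p).Nonempty
  change A.card + _ = _ at h3
  rw [add_mul, one_mul]
  omega

/-! ### Consecutive groups and thin sets of rows -/

theorem rank_injOn (C : Finset ℕ) :
    Set.InjOn (fun c => (C.filter fun x => x < c).card) (C : Set ℕ) := by
  have : StrictMonoOn (fun c => (C.filter fun x => x < c).card) (C : Set ℕ) := by
    intro c hc c' hc' h
    refine card_lt_card ⟨fun x hx => ?_, fun hsub => ?_⟩
    · rw [mem_filter] at hx ⊢
      exact ⟨hx.1, hx.2.trans h⟩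
    · have := hsub (mem_filter.2 ⟨hc, h⟩)
      simp at this
  exact this.injOn

/-- A set of integers can be cut into consecutive groups of `w` elements. -/
theorem exists_groups (C : Finset ℕ) {w : ℕ} (hw : 0 < w) :
    ∃ q : ℕ → ℕ, Monotone q ∧ (∀ c ∈ C, q c * w < C.card) ∧
      ∀ v, (C.filter fun c => q c = v).card ≤ w := by
  -- The group index is defined on all of ℕ through the rank in `C`, which makes it monotone
  -- everywhere.
  refine ⟨fun c => (C.filter fun x => x < c).card / w, ?_, ?_, ?_⟩
  · intro a b hab
    refine Nat.div_le_div_right (card_le_card fun x hx => ?_)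
    rw [mem_filter] at hx ⊢
    exact ⟨hx.1, hx.2.trans_le hab⟩
  · intro c hc
    refine lt_of_le_of_lt (Nat.div_mul_le_self _ _) (card_lt_card ?_)
    exact filter_ssubset.2 ⟨c, hc, lt_irrefl c⟩
  · intro v
    have : (C.filter fun c => (C.filter fun x => x < c).card / w = v).card ≤
        (Ico (v * w) (v * w + w)).card := by
      refine card_le_card_of_injOn (fun c => (C.filter fun x => x < c).card) ?_ ?_
      · intro c hc
        have h := (mem_filter.1 (mem_coe.1 hc)).2
        rw [Nat.div_eq_iff hw] at h
        rw [mem_coe, mem_Ico]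
        dsimp only
        omega
      · exact (rank_injOn C).mono fun c hc => (mem_filter.1 (mem_coe.1 hc)).1
    simpa using this

/-- Directly below and directly above each element of `R'`, as seen from `R'`, there is an
element of `R`. -/
def Thin (R' R : Finset ℕ) : Prop :=
  ∀ y ∈ R', (∃ z ∈ R, z < y ∧ ∀ y' ∈ R', y' < y → y' < z) ∧
    ∃ z ∈ R, y < z ∧ ∀ y' ∈ R', y < y' → z < y'

theorem exists_thin (R : Finset ℕ) : ∃ R₀ R₁ : Finset ℕ, R₀ ⊆ R ∧ R₁ ⊆ R ∧ Disjoint R₀ R₁ ∧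
    (R \ (R₀ ∪ R₁)).card ≤ 2 ∧ Thin R₀ R ∧ Thin R₁ R := by
  obtain ⟨e, he, hlt, hsurj⟩ := exists_enum R
  set n := R.card
  -- Interior indices of parity `b`: neighbours of opposite parity serve as separators, and only the
  -- first and the last element of `R` are lost.
  let I : ℕ → Finset ℕ := fun b => (range n).filter fun i => i % 2 = b ∧ 1 ≤ i ∧ i + 1 < n
  have hI : ∀ b i, i ∈ I b ↔ i % 2 = b ∧ 1 ≤ i ∧ i + 1 < n := by
    intro b i
    simp only [I, mem_filter, mem_range]
    omega
  have hlt' : ∀ i < n, ∀ j < n, e i < e j → i < j := by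
    intro i hi j hj h
    by_contra! hji
    rcases hji.eq_or_lt with rfl | hji
    · exact lt_irrefl _ h
    · exact lt_asymm h (hlt j i hji hi)
  have hsub : ∀ b, (I b).image e ⊆ R := by
    intro b r hr
    obtain ⟨i, hi, rfl⟩ := mem_image.1 hr
    have := (hI b i).1 hi
    exact he i (by omega)
  have hthin : ∀ b, Thin ((I b).image e) R := by
    intro b y hy
    obtain ⟨i, hi, rfl⟩ := mem_image.1 hy
    have hi' := (hI b i).1 hi
    refine ⟨⟨e (i - 1), he _ (by omega), hlt _ _ (by omega) (by omega), ?_⟩,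
      ⟨e (i + 1), he _ (by omega), hlt _ _ (by omega) (by omega), ?_⟩⟩
    · intro y' hy' h
      obtain ⟨j, hj, rfl⟩ := mem_image.1 hy'
      have hj' := (hI b j).1 hj
      have := hlt' j (by omega) i (by omega) h
      exact hlt _ _ (by omega) (by omega)
    · intro y' hy' h
      obtain ⟨j, hj, rfl⟩ := mem_image.1 hy'
      have hj' := (hI b j).1 hj
      have := hlt' i (by omega) j (by omega) h
      exact hlt _ _ (by omega) (by omega)
  refine ⟨(I 0).image e, (I 1).image e, hsub 0, hsub 1, ?_, ?_, hthin 0, hthin 1⟩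
  · rw [disjoint_left]
    intro r h0 h1
    obtain ⟨i, hi, rfl⟩ := mem_image.1 h0
    obtain ⟨j, hj, h⟩ := mem_image.1 h1
    have hi' := (hI 0 i).1 hi
    have hj' := (hI 1 j).1 hj
    rcases lt_trichotomy i j with hij | hij | hij
    · exact (hlt i j hij (by omega)).ne' h
    · omega
    · exact (hlt j i hij (by omega)).ne h
  · have : R \ ((I 0).image e ∪ (I 1).image e) ⊆ {e 0, e (n - 1)} := by
      intro r hr
      rw [mem_sdiff, mem_union, not_or] at hr
      obtain ⟨i, hi, rfl⟩ := hsurj r hr.1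
      have h0 : i ∉ I 0 := fun h => hr.2.1 (mem_image_of_mem _ h)
      have h1 : i ∉ I 1 := fun h => hr.2.2 (mem_image_of_mem _ h)
      rw [hI] at h0 h1
      have : i = 0 ∨ i = n - 1 := by omega
      rw [mem_insert, mem_singleton]
      rcases this with h | h
      · exact Or.inl (by rw [h])
      · exact Or.inr (by rw [h])
    exact (card_le_card this).trans card_le_two

/-! ### Patterns with a single one in each column -/

/-- The ones `S` contain the pattern with columns `X` whose unique one in column `x` lies in the
row of rank `ρ x`. -/
def HasPattern (ρ : ℕ → ℕ) (X : Finset ℕ) (S : Finset (ℕ × ℕ)) : Prop :=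
  ∃ p : ℕ → ℕ × ℕ, (∀ x ∈ X, p x ∈ S) ∧ (∀ x ∈ X, ∀ y ∈ X, x < y → (p x).2 < (p y).2) ∧
    (∀ x ∈ X, ∀ y ∈ X, ρ x < ρ y → (p x).1 < (p y).1) ∧
    ∀ x ∈ X, ∀ y ∈ X, ρ x = ρ y → (p x).1 = (p y).1

theorem HasPattern.mono {ρ : ℕ → ℕ} {X Y : Finset ℕ} {S T : Finset (ℕ × ℕ)} (hXY : X ⊆ Y)
    (hST : S ⊆ T) : HasPattern ρ Y S → HasPattern ρ X T := by
  rintro ⟨p, h1, h2, h3, h4⟩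
  exact ⟨p, fun x hx => hST (h1 x (hXY hx)), fun x hx y hy => h2 x (hXY hx) y (hXY hy),
    fun x hx y hy => h3 x (hXY hx) y (hXY hy), fun x hx y hy => h4 x (hXY hx) y (hXY hy)⟩

/-- A pattern in thin rows can be completed by one column in an adjacent row. -/
theorem not_hasPattern_of_thin {ρ : ℕ → ℕ} {X : Finset ℕ} {e : ℕ} (he : e ∉ X)
    (hX : X.Nonempty) {S T : Finset (ℕ × ℕ)} {R R' : Finset ℕ}
    (hS : ¬ HasPattern ρ (insert e X) S) (hTS : T ⊆ S) (hT : ∀ p ∈ T, p.1 ∈ R')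
    (hR'R : R' ⊆ R) (hthin : Thin R' R)
    (hR : ∀ z ∈ R, ∃ p ∈ S, p.1 = z ∧ (∀ x ∈ X, x < e → ∀ t ∈ T, t.2 < p.2) ∧
      ∀ x ∈ X, e < x → ∀ t ∈ T, p.2 < t.2) : ¬ HasPattern ρ X T := by
  rintro ⟨p, hp, h1, h2, h3⟩
  -- The row for column `e`: the row already used for that rank, else one just above the next larger
  -- rank used, else one just below the largest.
  have hz : ∃ z ∈ R, (∀ x ∈ X, ρ x < ρ e → (p x).1 < z) ∧ (∀ x ∈ X, ρ e < ρ x → z < (p x).1) ∧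
      ∀ x ∈ X, ρ x = ρ e → (p x).1 = z := by
    by_cases hEq : ∃ x ∈ X, ρ x = ρ e
    · obtain ⟨x, hx, hxe⟩ := hEq
      exact ⟨(p x).1, hR'R (hT _ (hp x hx)), fun y hy h => h2 y hy x hx (by omega),
        fun y hy h => h2 x hx y hy (by omega), fun y hy h => h3 y hy x hx (by omega)⟩
    push Not at hEq
    by_cases hGt : (X.filter fun x => ρ e < ρ x).Nonempty
    · obtain ⟨x, hx, hmin⟩ := exists_min_image _ ρ hGt
      rw [mem_filter] at hx
      obtain ⟨⟨z, hz, hzx, hz'⟩, -⟩ := hthin _ (hT _ (hp x hx.1))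
      refine ⟨z, hz, fun y hy h => ?_, fun y hy h => ?_, fun y hy h => absurd h (hEq y hy)⟩
      · exact hz' _ (hT _ (hp y hy)) (h2 y hy x hx.1 (by omega))
      · refine hzx.trans_le ?_
        rcases (hmin y (mem_filter.2 ⟨hy, h⟩)).eq_or_lt with h' | h'
        · exact (h3 x hx.1 y hy h').le
        · exact (h2 x hx.1 y hy h').le
    · have hlt : ∀ y ∈ X, ρ y < ρ e := by
        intro y hy
        have h4 : ¬ ρ e < ρ y := fun h => hGt ⟨y, mem_filter.2 ⟨hy, h⟩⟩
        have := hEq y hy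
        omega
      obtain ⟨x, hx, hmax⟩ := exists_max_image X ρ hX
      obtain ⟨-, z, hz, hzx, -⟩ := hthin _ (hT _ (hp x hx))
      refine ⟨z, hz, fun y hy _ => lt_of_le_of_lt ?_ hzx,
        fun y hy h => absurd h (by have := hlt y hy; omega),
        fun y hy h => absurd h (hEq y hy)⟩
      rcases (hmax y hy).eq_or_lt with h' | h'
      · exact (h3 y hy x hx h').le
      · exact (h2 y hy x hx h').le
  obtain ⟨z, hzR, hz1, hz2, hz3⟩ := hz
  obtain ⟨p', hp'S, hp'z, hc1, hc2⟩ := hR z hzR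
  apply hS
  have hu : ∀ x ∈ X, Function.update p e p' x = p x := fun x hx =>
    Function.update_of_ne (by rintro rfl; exact he hx) _ _
  refine ⟨Function.update p e p', ?_, ?_, ?_, ?_⟩
  · intro x hx
    rcases mem_insert.1 hx with rfl | hx
    · simpa using hp'S
    · rw [hu x hx]; exact hTS (hp x hx)
  · intro x hx₀ y hy₀ hxy
    rcases mem_insert.1 hx₀ with rfl | hx <;> rcases mem_insert.1 hy₀ with rfl | hy
    · omega
    · rw [hu y hy, Function.update_self]
      exact hc2 y hy hxy _ (hp y hy)
    · rw [hu x hx, Function.update_self]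
      exact hc1 x hx hxy _ (hp x hx)
    · rw [hu x hx, hu y hy]
      exact h1 x hx y hy hxy
  · intro x hx₀ y hy₀ hxy
    rcases mem_insert.1 hx₀ with rfl | hx <;> rcases mem_insert.1 hy₀ with rfl | hy
    · omega
    · rw [hu y hy, Function.update_self, hp'z]
      exact hz2 y hy hxy
    · rw [hu x hx, Function.update_self, hp'z]
      exact hz1 x hx hxy
    · rw [hu x hx, hu y hy]
      exact h2 x hx y hy hxy
  · intro x hx₀ y hy₀ hxy
    rcases mem_insert.1 hx₀ with rfl | hx <;> rcases mem_insert.1 hy₀ with rfl | hy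
    · rfl
    · rw [hu y hy, Function.update_self, hp'z]
      exact (hz3 y hy hxy.symm).symm
    · rw [hu x hx, Function.update_self, hp'z]
      exact hz3 x hx hxy
    · rw [hu x hx, hu y hy]
      exact h3 x hx y hy hxy

/-- The set of nonzero rows. -/
def rows (S : Finset (ℕ × ℕ)) : Finset ℕ := S.image Prod.fst

/-- The set of nonzero columns. -/
def cols (S : Finset (ℕ × ℕ)) : Finset ℕ := S.image Prod.snd

theorem rows_mono {S T : Finset (ℕ × ℕ)} (h : S ⊆ T) : rows S ⊆ rows T := image_subset_image h

theorem cols_mono {S T : Finset (ℕ × ℕ)} (h : S ⊆ T) : cols S ⊆ cols T := image_subset_image h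

theorem mem_rows {S : Finset (ℕ × ℕ)} {r : ℕ} : r ∈ rows S ↔ ∃ p ∈ S, p.1 = r := mem_image

theorem mem_cols {S : Finset (ℕ × ℕ)} {c : ℕ} : c ∈ cols S ↔ ∃ p ∈ S, p.2 = c := mem_image

theorem card_le_card_rows_mul (S : Finset (ℕ × ℕ)) :
    S.card ≤ (rows S).card * (cols S).card := by
  rw [← card_product]
  exact card_le_card fun p hp => mem_product.2 ⟨mem_rows.2 ⟨p, hp, rfl⟩, mem_cols.2 ⟨p, hp, rfl⟩⟩

theorem card_le_of_split_rows {T : Finset (ℕ × ℕ)} {R₀ R₁ : Finset ℕ}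
    (h : (rows T \ (R₀ ∪ R₁)).card ≤ 2) :
    T.card ≤ (T.filter fun p => p.1 ∈ R₀).card + (T.filter fun p => p.1 ∈ R₁).card +
      2 * (cols T).card := by
  set E := T.filter fun p => p.1 ∉ R₀ ∧ p.1 ∉ R₁ with hE
  have hcov : T ⊆ ((T.filter fun p => p.1 ∈ R₀) ∪ (T.filter fun p => p.1 ∈ R₁)) ∪ E := by
    intro p hp
    simp only [E, mem_union, mem_filter, hp, true_and]
    tauto
  have h1 : rows E ⊆ rows T \ (R₀ ∪ R₁) := by
    intro r hr
    obtain ⟨p, hp, rfl⟩ := mem_rows.1 hr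
    have hp' := mem_filter.1 hp
    rw [mem_sdiff, mem_union, not_or]
    exact ⟨mem_rows.2 ⟨p, hp'.1, rfl⟩, hp'.2⟩
  have h2 : E.card ≤ 2 * (cols T).card :=
    (card_le_card_rows_mul E).trans (Nat.mul_le_mul ((card_le_card h1).trans h)
      (card_le_card (cols_mono (filter_subset _ _))))
  have h3 := card_le_card hcov
  have h4 := card_union_le ((T.filter fun p => p.1 ∈ R₀) ∪ (T.filter fun p => p.1 ∈ R₁)) E
  have h5 := card_union_le (T.filter fun p => p.1 ∈ R₀) (T.filter fun p => p.1 ∈ R₁)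
  omega

theorem card_rows_split {T : Finset (ℕ × ℕ)} {R₀ R₁ : Finset ℕ} (h : Disjoint R₀ R₁) :
    (rows (T.filter fun p => p.1 ∈ R₀)).card + (rows (T.filter fun p => p.1 ∈ R₁)).card ≤
      (rows T).card := by
  rw [← card_union_of_disjoint]
  · exact card_le_card (union_subset (rows_mono (filter_subset _ _)) (rows_mono (filter_subset _ _)))
  · rw [disjoint_left] at h ⊢
    intro r h0 h1
    obtain ⟨p, hp, rfl⟩ := mem_rows.1 h0
    obtain ⟨q, hq, hqp⟩ := mem_rows.1 h1
    exact h (mem_filter.1 hp).2 (hqp ▸ (mem_filter.1 hq).2)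

/-- A bound for the weight of matrices with at most `M` columns avoiding a pattern. -/
def WeightBound (ρ : ℕ → ℕ) (X : Finset ℕ) (M : ℕ) (μ β : ℝ) : Prop :=
  ∀ S : Finset (ℕ × ℕ), ¬ HasPattern ρ X S → (cols S).card ≤ M →
    (S.card : ℝ) ≤ μ * ((rows S).card + β * (cols S).card)

/-- Each of the two thin halves of the rows avoids the pattern without column `e`, since a one
beyond `T` completes it. The row counts of the halves add up, while the columns are counted twice;
the two discarded rows cost `2 * (cols T).card`. -/
theorem card_le_of_one_sided {ρ : ℕ → ℕ} {X : Finset ℕ} {e M : ℕ} {μ β : ℝ} (hμ : 0 ≤ μ)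
    (hβ : 0 ≤ β) (hB : WeightBound ρ X M μ β) (he : e ∉ X) (hX : X.Nonempty)
    {S T : Finset (ℕ × ℕ)} (hS : ¬ HasPattern ρ (insert e X) S) (hTS : T ⊆ S)
    (hM : (cols T).card ≤ M)
    (hT : ∀ z ∈ rows T, ∃ p ∈ S, p.1 = z ∧ (∀ x ∈ X, x < e → ∀ t ∈ T, t.2 < p.2) ∧
      ∀ x ∈ X, e < x → ∀ t ∈ T, p.2 < t.2) :
    (T.card : ℝ) ≤ μ * ((rows T).card + 2 * β * (cols T).card) + 2 * (cols T).card := by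
  obtain ⟨R₀, R₁, hR₀, hR₁, hdisj, hcard, ht₀, ht₁⟩ := exists_thin (rows T)
  have key : ∀ R', R' ⊆ rows T → Thin R' (rows T) →
      ((T.filter fun p => p.1 ∈ R').card : ℝ) ≤
        μ * ((rows (T.filter fun p => p.1 ∈ R')).card + β * (cols T).card) := by
    intro R' hR' ht'
    have hsub : (T.filter fun p => p.1 ∈ R') ⊆ T := filter_subset _ _
    have hc := card_le_card (cols_mono hsub)
    refine (hB _ ?_ (hc.trans hM)).trans ?_
    · refine not_hasPattern_of_thin he hX hS (hsub.trans hTS) (fun p hp => (mem_filter.1 hp).2)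
        hR' ht' fun z hz => ?_
      obtain ⟨p, hp, hpz, h1, h2⟩ := hT z hz
      exact ⟨p, hp, hpz, fun x hx hxe t ht => h1 x hx hxe t (hsub ht),
        fun x hx hxe t ht => h2 x hx hxe t (hsub ht)⟩
    · have : ((cols (T.filter fun p => p.1 ∈ R')).card : ℝ) ≤ (cols T).card := by
        exact_mod_cast hc
      gcongr
  have h0 := key R₀ hR₀ ht₀
  have h1 := key R₁ hR₁ ht₁
  have h2 : (T.card : ℝ) ≤ (T.filter fun p => p.1 ∈ R₀).card + (T.filter fun p => p.1 ∈ R₁).card +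
      2 * (cols T).card := by exact_mod_cast card_le_of_split_rows hcard
  have h3 : ((rows (T.filter fun p => p.1 ∈ R₀)).card : ℝ) +
      (rows (T.filter fun p => p.1 ∈ R₁)).card ≤ (rows T).card := by
    exact_mod_cast card_rows_split hdisj
  have h4 := mul_le_mul_of_nonneg_left h3 hμ
  linarith

/-- Thin the rows once to remove the last column of the pattern, then again within each half to
remove the first. Hence 4 = 2 · 2 for the columns and 6 = 2 · 2 + 2 for the discarded rows. -/
theorem card_le_of_two_sided {ρ : ℕ → ℕ} {X : Finset ℕ} {e₁ e₂ M : ℕ} {μ β : ℝ} (hμ : 0 ≤ μ)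
    (hβ : 0 ≤ β) (hB : WeightBound ρ X M μ β) (he : e₁ < e₂) (he₁ : ∀ x ∈ X, e₁ < x)
    (he₂ : ∀ x ∈ X, x < e₂) (hX : X.Nonempty) {S T : Finset (ℕ × ℕ)}
    (hS : ¬ HasPattern ρ (insert e₂ (insert e₁ X)) S) (hTS : T ⊆ S) (hM : (cols T).card ≤ M)
    (hL : ∀ z ∈ rows T, ∃ p ∈ S, p.1 = z ∧ ∀ t ∈ T, p.2 < t.2)
    (hR : ∀ z ∈ rows T, ∃ p ∈ S, p.1 = z ∧ ∀ t ∈ T, t.2 < p.2) :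
    (T.card : ℝ) ≤ μ * ((rows T).card + 4 * β * (cols T).card) + 6 * (cols T).card := by
  obtain ⟨R₀, R₁, hR₀, hR₁, hdisj, hcard, ht₀, ht₁⟩ := exists_thin (rows T)
  have key : ∀ R', R' ⊆ rows T → Thin R' (rows T) →
      ((T.filter fun p => p.1 ∈ R').card : ℝ) ≤
        μ * ((rows (T.filter fun p => p.1 ∈ R')).card + 2 * β * (cols T).card) +
          2 * (cols T).card := by
    intro R' hR' ht'
    have hsub : (T.filter fun p => p.1 ∈ R') ⊆ T := filter_subset _ _
    have hc := card_le_card (cols_mono hsub)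
    -- `U` must retain the ones to the left of `T`, needed to remove `e₁`, but stay to the left of
    -- the ones that supply column `e₂`.
    set U := S.filter fun p => p.1 ∈ R' ∧ ∃ t ∈ T, p.2 ≤ t.2 with hU
    have hUS : ¬ HasPattern ρ (insert e₁ X) U := by
      refine not_hasPattern_of_thin (e := e₂) ?_ (insert_nonempty _ _) hS (filter_subset _ _)
        (fun p hp => (mem_filter.1 hp).2.1) hR' ht' fun z hz => ?_
      · rw [mem_insert]
        rintro (h | h)
        · omega
        · exact lt_irrefl _ (he₂ _ h)
      · obtain ⟨p, hp, hpz, h⟩ := hR z hz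
        refine ⟨p, hp, hpz, fun x _ _ u hu => ?_, fun x hx hxe => ?_⟩
        · obtain ⟨t, ht, hut⟩ := (mem_filter.1 hu).2.2
          exact hut.trans_lt (h t ht)
        · rcases mem_insert.1 hx with rfl | hx
          · omega
          · have := he₂ x hx
            omega
    have := card_le_of_one_sided hμ hβ hB (fun h => lt_irrefl _ (he₁ _ h)) hX hUS
      (T := T.filter fun p => p.1 ∈ R') ?_ (hc.trans hM) ?_
    · have hc' : ((cols (T.filter fun p => p.1 ∈ R')).card : ℝ) ≤ (cols T).card := by
        exact_mod_cast hc
      refine this.trans ?_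
      gcongr
    · intro p hp
      have hp' := mem_filter.1 hp
      exact mem_filter.2 ⟨hTS hp'.1, hp'.2, p, hp'.1, le_rfl⟩
    · intro z hz
      obtain ⟨t, ht, htz⟩ := mem_rows.1 hz
      have ht' := mem_filter.1 ht
      obtain ⟨p, hp, hpz, h⟩ := hL z (rows_mono hsub hz)
      refine ⟨p, mem_filter.2 ⟨hp, ?_, t, ht'.1, (h t ht'.1).le⟩, hpz, fun x hx hxe => ?_,
        fun x _ _ u hu => h u (hsub hu)⟩
      · rw [hpz, ← htz]; exact ht'.2
      · have := he₁ x hx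
        omega
  have h0 := key R₀ hR₀ ht₀
  have h1 := key R₁ hR₁ ht₁
  have h2 : (T.card : ℝ) ≤ (T.filter fun p => p.1 ∈ R₀).card + (T.filter fun p => p.1 ∈ R₁).card +
      2 * (cols T).card := by exact_mod_cast card_le_of_split_rows hcard
  have h3 : ((rows (T.filter fun p => p.1 ∈ R₀)).card : ℝ) +
      (rows (T.filter fun p => p.1 ∈ R₁)).card ≤ (rows T).card := by
    exact_mod_cast card_rows_split hdisj
  have h4 := mul_le_mul_of_nonneg_left h3 hμ
  linarith

/-! ### Hats inside blocks -/

/-- The rank of the row of the one in column `x` of the pattern made of hats, the `v`-th of which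
lies in the pair of rows of rank `σ v`. -/
def hatRank (σ : ℕ → ℕ) (x : ℕ) : ℕ := 2 * σ (x / 3) + if x % 3 = 1 then 0 else 1

theorem hasPattern_of_hats {σ : ℕ → ℕ} {k : ℕ}
    (hσ : ∀ v v', v < k → v' < k → σ v = σ v' → v = v') {S : Finset (ℕ × ℕ)}
    {a b c₁ c₂ c₃ : ℕ → ℕ}
    (h : ∀ v < k, (b v, c₁ v) ∈ S ∧ (a v, c₂ v) ∈ S ∧ (b v, c₃ v) ∈ S ∧ a v < b v ∧
      c₁ v < c₂ v ∧ c₂ v < c₃ v)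
    (hc : ∀ v v', v < v' → v' < k → c₃ v < c₁ v')
    (hr : ∀ v v', v < k → v' < k → σ v < σ v' → b v < a v') :
    HasPattern (hatRank σ) (range (3 * k)) S := by
  have hdiv : ∀ x ∈ range (3 * k), x / 3 < k := fun x hx => by
    rw [mem_range] at hx
    omega
  refine ⟨fun x => if x % 3 = 1 then (a (x / 3), c₂ (x / 3)) else
    (b (x / 3), if x % 3 = 0 then c₁ (x / 3) else c₃ (x / 3)), ?_, ?_, ?_, ?_⟩
  · intro x hx
    obtain ⟨h1, h2, h3, -⟩ := h _ (hdiv x hx)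
    dsimp only
    split_ifs <;> assumption
  · intro x hx y hy hxy
    obtain ⟨-, -, -, -, h1, h2⟩ := h _ (hdiv x hx)
    obtain ⟨-, -, -, -, h3, h4⟩ := h _ (hdiv y hy)
    have hle : x / 3 ≤ y / 3 := Nat.div_le_div_right hxy.le
    rcases hle.eq_or_lt with he | hlt
    · dsimp only
      rw [← he] at h3 h4 ⊢
      have : x % 3 < y % 3 := by omega
      split_ifs <;> dsimp only <;> omega
    · have := hc _ _ hlt (hdiv y hy)
      dsimp only
      split_ifs <;> dsimp only <;> omega
  · intro x hx y hy hxy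
    obtain ⟨-, -, -, h1, -⟩ := h _ (hdiv x hx)
    obtain ⟨-, -, -, h2, -⟩ := h _ (hdiv y hy)
    have hxy' : σ (x / 3) ≤ σ (y / 3) := by
      unfold hatRank at hxy
      split_ifs at hxy <;> omega
    rcases hxy'.eq_or_lt with he | hlt
    · have he' := hσ _ _ (hdiv x hx) (hdiv y hy) he
      unfold hatRank at hxy
      dsimp only
      rw [he'] at hxy h1 ⊢
      split_ifs at hxy ⊢ <;> dsimp only <;> omega
    · have := hr _ _ (hdiv x hx) (hdiv y hy) hlt
      dsimp only
      split_ifs <;> dsimp only <;> omega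
  · intro x hx y hy hxy
    have he : σ (x / 3) = σ (y / 3) := by
      unfold hatRank at hxy
      split_ifs at hxy <;> omega
    have he' := hσ _ _ (hdiv x hx) (hdiv y hy) he
    unfold hatRank at hxy
    dsimp only
    rw [he'] at hxy ⊢
    split_ifs at hxy ⊢ <;> dsimp only <;> omega

/-- There is a hat within the row groups from `A` to `B` and the column group `C`. -/
def HatIn (M : Finset (ℕ × ℕ)) (ω q : ℕ → ℕ) (A B C : ℕ) : Prop :=
  ∃ a b c₁ c₂ c₃, (b, c₁) ∈ M ∧ (a, c₂) ∈ M ∧ (b, c₃) ∈ M ∧ a < b ∧ c₁ < c₂ ∧ c₂ < c₃ ∧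
    A ≤ ω a ∧ ω b ≤ B ∧ q c₁ = C ∧ q c₃ = C

theorem hasPattern_of_hatIn {σ : ℕ → ℕ} {k : ℕ}
    (hσ : ∀ v v', v < k → v' < k → σ v = σ v' → v = v') {M : Finset (ℕ × ℕ)} {ω q : ℕ → ℕ}
    (hω : Monotone ω) (hq : Monotone q) {A B C : ℕ → ℕ}
    (h : ∀ v < k, HatIn M ω q (A v) (B v) (C v)) (hC : ∀ v v', v < v' → v' < k → C v < C v')
    (hr : ∀ v v', v < k → v' < k → σ v < σ v' → B v < A v') :
    HasPattern (hatRank σ) (range (3 * k)) M := by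
  unfold HatIn at h
  choose! a b c₁ c₂ c₃ h1 h2 h3 h4 h5 h6 h7 h8 h9 h10 using h
  refine hasPattern_of_hats hσ (fun v hv => ⟨h1 v hv, h2 v hv, h3 v hv, h4 v hv, h5 v hv, h6 v hv⟩)
    (fun v v' hvv hv' => hq.reflect_lt ?_) (fun v v' hv hv' hvv => hω.reflect_lt ?_)
  · rw [h10 v (hvv.trans hv'), h9 v' hv']
    exact hC v v' hvv hv'
  · exact (h8 v hv).trans_lt ((hr v v' hv hv' hvv).trans_le (h7 v' hv'))

section Middle

variable {σ : ℕ → ℕ} {k : ℕ} {M : Finset (ℕ × ℕ)} {ω q : ℕ → ℕ} {W n b : ℕ}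

/-- In a grid of blocks each containing a hat, the hats of the blocks `(σ v, v)` form the whole
forbidden pattern. -/
theorem card_hat_blocks_le (hσ : ∀ v < k + 1, σ v < k + 1)
    (hσi : ∀ v v', v < k + 1 → v' < k + 1 → σ v = σ v' → v = v')
    (hM : ¬ HasPattern (hatRank σ) (range (3 * (k + 1))) M) (hω : Monotone ω) (hq : Monotone q)
    {Θ : Finset (ℕ × ℕ)} (hΘ : Θ ⊆ range n ×ˢ range b)
    (hh : ∀ p ∈ Θ, HatIn M ω q p.1 p.1 p.2) : Θ.card ≤ gridConst k * (n + b) := by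
  refine card_le_of_not_grid k (n + b) Θ (fun p hp => ?_) ?_
  · have := hΘ hp
    simp only [mem_product, mem_range] at this ⊢
    omega
  · rintro ⟨p, hp, h1, h2⟩
    refine hM (hasPattern_of_hatIn hσi hω hq (A := fun v => (p (σ v) v).1)
      (B := fun v => (p (σ v) v).1) (C := fun v => (p (σ v) v).2)
      (fun v hv => hh _ (hp _ _ (hσ v hv) hv)) ?_ ?_)
    · intro v v' hvv hv'
      exact h2 _ _ _ _ (hσ v (hvv.trans hv')) (hσ v' hv') hvv hv'
    · intro v v' hv hv' hvv
      exact h1 _ _ _ _ hvv (hσ v' hv') hv hv'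

/-- The points other than the first and the last of their row in their column group. -/
def IsInner (M : Finset (ℕ × ℕ)) (q : ℕ → ℕ) (p : ℕ × ℕ) : Prop :=
  (∃ p' ∈ M, p'.1 = p.1 ∧ q p'.2 = q p.2 ∧ p'.2 < p.2) ∧
    ∃ p' ∈ M, p'.1 = p.1 ∧ q p'.2 = q p.2 ∧ p.2 < p'.2

/-- The one above `p'` is the tip of the hat, and the ones left and right of `p'` in its row and
group are the base. -/
theorem IsInner.hatIn {p p' : ℕ × ℕ} (hp : p ∈ M) (h : IsInner M q p') (hc : p.2 = p'.2)
    (hr : p.1 < p'.1) : HatIn M ω q (ω p.1) (ω p'.1) (q p'.2) := by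
  obtain ⟨⟨x, hx, hx1, hx2, hx3⟩, y, hy, hy1, hy2, hy3⟩ := h
  refine ⟨p.1, p'.1, x.2, p.2, y.2, ?_, hp, ?_, hr, by omega, by omega, le_rfl, le_rfl, hx2, hy2⟩
  · rw [← hx1]; exact hx
  · rw [← hy1]; exact hy

-- Every one is the first of its row in its column group, or the last, or inner.
open Classical in
theorem card_le_two_mul_add_inner (M : Finset (ℕ × ℕ)) (q : ℕ → ℕ) :
    M.card ≤ 2 * (M.image fun p => (p.1, q p.2)).card + (M.filter (IsInner M q)).card := by
  set L := M.filter fun p => ¬ ∃ p' ∈ M, p'.1 = p.1 ∧ q p'.2 = q p.2 ∧ p'.2 < p.2 with hL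
  set R := M.filter fun p => ¬ ∃ p' ∈ M, p'.1 = p.1 ∧ q p'.2 = q p.2 ∧ p.2 < p'.2 with hR
  have hLc : L.card ≤ (M.image fun p => (p.1, q p.2)).card := by
    refine card_le_card_of_injOn (fun p => (p.1, q p.2)) ?_ ?_
    · intro p hp
      exact mem_coe.2 (mem_image_of_mem _ (mem_filter.1 (mem_coe.1 hp)).1)
    · intro p hp p' hp' h
      have h1 := mem_filter.1 (mem_coe.1 hp)
      have h2 := mem_filter.1 (mem_coe.1 hp')
      simp only [Prod.mk.injEq] at h
      refine Prod.ext h.1 (le_antisymm ?_ ?_)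
      · exact not_lt.1 fun hlt => h1.2 ⟨p', h2.1, h.1.symm, h.2.symm, hlt⟩
      · exact not_lt.1 fun hlt => h2.2 ⟨p, h1.1, h.1, h.2, hlt⟩
  have hRc : R.card ≤ (M.image fun p => (p.1, q p.2)).card := by
    refine card_le_card_of_injOn (fun p => (p.1, q p.2)) ?_ ?_
    · intro p hp
      exact mem_coe.2 (mem_image_of_mem _ (mem_filter.1 (mem_coe.1 hp)).1)
    · intro p hp p' hp' h
      have h1 := mem_filter.1 (mem_coe.1 hp)
      have h2 := mem_filter.1 (mem_coe.1 hp')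
      simp only [Prod.mk.injEq] at h
      refine Prod.ext h.1 (le_antisymm ?_ ?_)
      · exact not_lt.1 fun hlt => h2.2 ⟨p, h1.1, h.1, h.2, hlt⟩
      · exact not_lt.1 fun hlt => h1.2 ⟨p', h2.1, h.1.symm, h.2.symm, hlt⟩
  have hcov : M ⊆ (L ∪ R) ∪ M.filter (IsInner M q) := by
    intro p hp
    simp only [L, R, mem_union, mem_filter, hp, true_and, IsInner]
    rw [← not_and_or]
    exact (Classical.em _).symm
  have h1 := card_le_card hcov
  have h2 := card_union_le (L ∪ R) (M.filter (IsInner M q))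
  have h3 := card_union_le L R
  omega

theorem sum_card_filter_snd {T : Finset (ℕ × ℕ)} (hb : ∀ p ∈ T, q p.2 < b) :
    ∑ v ∈ range b, (T.filter fun p => q p.2 = v).card = T.card :=
  (card_eq_sum_card_fiberwise (f := fun p : ℕ × ℕ => q p.2)
    fun p hp => mem_coe.2 (mem_range.2 (hb p (mem_coe.1 hp)))).symm

/-- Inner points in blocks without hats. -/
theorem card_inner_le (hσ : ∀ v < k + 1, σ v < k + 1)
    (hσi : ∀ v v', v < k + 1 → v' < k + 1 → σ v = σ v' → v = v')
    (hM : ¬ HasPattern (hatRank σ) (range (3 * (k + 1))) M) (hω : Monotone ω) (hq : Monotone q)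
    (hωn : ∀ r ∈ rows M, ω r < n) (hqb : ∀ c ∈ cols M, q c < b)
    (hqW : ∀ v, ((cols M).filter fun c => q c = v).card ≤ W)
    {I : Finset (ℕ × ℕ)} (hIM : I ⊆ M)
    (hI : ∀ p ∈ I, IsInner M q p ∧ ¬ HatIn M ω q (ω p.1) (ω p.1) (q p.2)) :
    I.card ≤ W * ((segConst k + 1) * (n + b)) := by
  have hIb : ∀ p ∈ I, q p.2 < b := fun p hp => hqb _ (mem_cols.2 ⟨p, hIM hp, rfl⟩)
  -- In each column group keep only the column with most inner ones, at the cost of a factor `W`.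
  have hcc : ∀ v, ∃ c, ∀ c' ∈ cols (I.filter fun p => q p.2 = v),
      ((I.filter fun p => q p.2 = v).filter fun p => p.2 = c').card ≤
        ((I.filter fun p => q p.2 = v).filter fun p => p.2 = c).card := by
    intro v
    obtain ⟨c, -, hc⟩ := exists_max_image (insert 0 (cols (I.filter fun p => q p.2 = v)))
      (fun c => ((I.filter fun p => q p.2 = v).filter fun p => p.2 = c).card)
      (insert_nonempty _ _)
    exact ⟨c, fun c' hc' => hc c' (mem_insert_of_mem hc')⟩
  choose cc hcc using hcc
  set J := I.filter fun p => p.2 = cc (q p.2) with hJ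
  have hJI : ∀ p ∈ J, p ∈ I ∧ p.2 = cc (q p.2) := fun p hp => mem_filter.1 hp
  have hIJ : I.card ≤ W * J.card := by
    rw [← sum_card_filter_snd hIb, ← sum_card_filter_snd (T := J) fun p hp => hIb p (hJI p hp).1,
      mul_sum]
    refine sum_le_sum fun v _ => ?_
    refine (card_le_mul_card_image (f := Prod.snd) _ _ (hcc v)).trans ?_
    rw [mul_comm]
    refine Nat.mul_le_mul ((card_le_card fun c hc => ?_).trans (hqW v)) (card_le_card fun p hp => ?_)
    · obtain ⟨p, hp, rfl⟩ := mem_image.1 hc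
      have hp' := mem_filter.1 hp
      exact mem_filter.2 ⟨mem_cols.2 ⟨p, hIM hp'.1, rfl⟩, hp'.2⟩
    · simp only [J, mem_filter] at hp ⊢
      refine ⟨⟨hp.1.1, ?_⟩, hp.1.2⟩
      rw [hp.1.2]; exact hp.2
  -- Two kept ones of the same block share a column, and the lower one, being inner, would give a
  -- hat inside the block.
  have hinj : Set.InjOn (fun p : ℕ × ℕ => (ω p.1, q p.2)) (J : Set (ℕ × ℕ)) := by
    intro p hp p' hp' h
    obtain ⟨h1, h2⟩ := hJI p (mem_coe.1 hp)
    obtain ⟨h1', h2'⟩ := hJI p' (mem_coe.1 hp')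
    simp only [Prod.mk.injEq] at h
    have hc : p.2 = p'.2 := by rw [h2, h2', h.2]
    refine Prod.ext ?_ hc
    rcases lt_trichotomy p.1 p'.1 with hlt | he | hlt
    · have := (hI p' h1').1.hatIn (ω := ω) (hIM h1) hc hlt
      rw [h.1] at this
      exact absurd this (hI p' h1').2
    · exact he
    · have := (hI p h1).1.hatIn (ω := ω) (hIM h1') hc.symm hlt
      rw [← h.1] at this
      exact absurd this (hI p h1).2
  refine hIJ.trans (Nat.mul_le_mul_left _ ?_)
  rw [← card_image_of_injOn hinj]
  refine card_le_of_not_hasDouble hσ ?_ ?_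
  · intro x hx
    obtain ⟨p, hp, rfl⟩ := mem_image.1 hx
    have hpI := (hJI p hp).1
    exact mem_product.2 ⟨mem_range.2 (hωn _ (mem_rows.2 ⟨p, hIM hpI, rfl⟩)),
      mem_range.2 (hIb p hpI)⟩
  -- Two contracted ones in one column come from one column of `M`, so a hat lies between their row
  -- groups. A doubled permutation therefore becomes the full hat pattern.
  · rintro ⟨A, B, C, h, hC, hr⟩
    refine hM (hasPattern_of_hatIn hσi hω hq (A := A) (B := B) (C := C) ?_ hC hr)
    intro v hv
    obtain ⟨hA, hB, hAB⟩ := h v hv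
    obtain ⟨p, hp, hpe⟩ := mem_image.1 hA
    obtain ⟨p', hp', hpe'⟩ := mem_image.1 hB
    simp only [Prod.mk.injEq] at hpe hpe'
    obtain ⟨h1, h2⟩ := hJI p hp
    obtain ⟨h1', h2'⟩ := hJI p' hp'
    have := (hI p' h1').1.hatIn (ω := ω) (hIM h1) (by rw [h2, h2', hpe.2, hpe'.2])
      (hω.reflect_lt (by rw [hpe.1, hpe'.1]; exact hAB))
    rwa [hpe.1, hpe'.1, hpe'.2] at this

/-- Up to the points in blocks with a hat, a row has about two points in a column group. -/
theorem exists_hat_part (hσ : ∀ v < k + 1, σ v < k + 1)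
    (hσi : ∀ v v', v < k + 1 → v' < k + 1 → σ v = σ v' → v = v')
    (hM : ¬ HasPattern (hatRank σ) (range (3 * (k + 1))) M) (hω : Monotone ω) (hq : Monotone q)
    (hωn : ∀ r ∈ rows M, ω r < n) (hqb : ∀ c ∈ cols M, q c < b)
    (hωW : ∀ w, ((rows M).filter fun r => ω r = w).card ≤ W)
    (hqW : ∀ v, ((cols M).filter fun c => q c = v).card ≤ W) :
    ∃ H ⊆ M, M.card ≤ 2 * (M.image fun p => (p.1, q p.2)).card +
        W * ((segConst k + 1) * (n + b)) + H.card ∧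
      ∑ v ∈ range b, (rows (H.filter fun p => q p.2 = v)).card ≤
        W * (gridConst k * (n + b)) := by
  classical
  set H := M.filter fun p => HatIn M ω q (ω p.1) (ω p.1) (q p.2) with hH
  have hHM : ∀ p ∈ H, p ∈ M ∧ HatIn M ω q (ω p.1) (ω p.1) (q p.2) := fun p hp => mem_filter.1 hp
  refine ⟨H, filter_subset _ _, ?_, ?_⟩
  · have h1 := card_le_two_mul_add_inner M q
    set I := (M.filter (IsInner M q)).filter fun p => ¬ HatIn M ω q (ω p.1) (ω p.1) (q p.2) with hI
    have h2 : I.card ≤ W * ((segConst k + 1) * (n + b)) := by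
      refine card_inner_le hσ hσi hM hω hq hωn hqb hqW (fun p hp => ?_) fun p hp => ?_
      · exact (mem_filter.1 (mem_filter.1 hp).1).1
      · exact ⟨(mem_filter.1 (mem_filter.1 hp).1).2, (mem_filter.1 hp).2⟩
    have h3 : (M.filter (IsInner M q)).card ≤ I.card + H.card := by
      refine le_trans (card_le_card fun p hp => ?_) (card_union_le I H)
      have hp' := mem_filter.1 hp
      simp only [I, H, mem_union, mem_filter, hp'.1, hp'.2, true_and]
      tauto
    omega
  -- A block meets at most `W` rows, so the rows met by `H`, counted once per column group, are at
  -- most `W` times the number of blocks with a hat.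
  · set Θ := H.image fun p => (ω p.1, q p.2) with hΘ
    have hΘc : Θ.card ≤ gridConst k * (n + b) := by
      refine card_hat_blocks_le hσ hσi hM hω hq ?_ ?_
      · intro x hx
        obtain ⟨p, hp, rfl⟩ := mem_image.1 hx
        have hpM := (hHM p hp).1
        exact mem_product.2 ⟨mem_range.2 (hωn _ (mem_rows.2 ⟨p, hpM, rfl⟩)),
          mem_range.2 (hqb _ (mem_cols.2 ⟨p, hpM, rfl⟩))⟩
      · intro x hx
        obtain ⟨p, hp, rfl⟩ := mem_image.1 hx
        exact (hHM p hp).2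
    refine le_trans ?_ (Nat.mul_le_mul_left W hΘc)
    have hsum : ∑ v ∈ range b, (Θ.filter fun x => x.2 = v).card = Θ.card := by
      refine sum_card_filter_snd (q := id) fun x hx => ?_
      obtain ⟨p, hp, rfl⟩ := mem_image.1 hx
      exact hqb _ (mem_cols.2 ⟨p, (hHM p hp).1, rfl⟩)
    rw [← hsum, mul_sum]
    refine sum_le_sum fun v _ => ?_
    refine (card_le_mul_card_image (f := ω) _ W fun w _ => ?_).trans (Nat.mul_le_mul_left _ ?_)
    · refine (card_le_card (filter_subset_filter _ (rows_mono ?_))).trans (hωW w)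
      exact (filter_subset _ _).trans (filter_subset _ _)
    · refine card_le_card_of_injOn (fun w => (w, v)) ?_ fun w _ w' _ h => (Prod.ext_iff.1 h).1
      intro w hw
      obtain ⟨r, hr, rfl⟩ := mem_image.1 (mem_coe.1 hw)
      obtain ⟨p, hp, rfl⟩ := mem_rows.1 hr
      have hp' := mem_filter.1 hp
      exact mem_coe.2 (mem_filter.2 ⟨mem_image.2 ⟨p, hp'.1, by rw [hp'.2]⟩, rfl⟩)

end Middle

/-! ### Local, first, last and middle ones -/

section Decomposition

variable {ρ : ℕ → ℕ} {S T : Finset (ℕ × ℕ)} {q : ℕ → ℕ} {W b : ℕ}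

/-- The row of `p` has a one in an earlier column group. -/
def HasEarlier (S : Finset (ℕ × ℕ)) (q : ℕ → ℕ) (p : ℕ × ℕ) : Prop :=
  ∃ p' ∈ S, p'.1 = p.1 ∧ q p'.2 < q p.2

/-- The row of `p` has a one in a later column group. -/
def HasLater (S : Finset (ℕ × ℕ)) (q : ℕ → ℕ) (p : ℕ × ℕ) : Prop :=
  ∃ p' ∈ S, p'.1 = p.1 ∧ q p.2 < q p'.2

theorem sum_card_cols_le (hTS : T ⊆ S) (hqb : ∀ c ∈ cols S, q c < b) :
    ∑ v ∈ range b, (cols (T.filter fun p => q p.2 = v)).card ≤ (cols S).card := by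
  rw [card_eq_sum_card_fiberwise (f := q) (s := cols S) (t := range b)
    fun c hc => mem_coe.2 (mem_range.2 (hqb c (mem_coe.1 hc)))]
  refine sum_le_sum fun v _ => card_le_card fun c hc => ?_
  obtain ⟨p, hp, rfl⟩ := mem_cols.1 hc
  have hp' := mem_filter.1 hp
  exact mem_filter.2 ⟨mem_cols.2 ⟨p, hTS hp'.1, rfl⟩, hp'.2⟩

theorem sum_card_rows_le (h : ∀ p ∈ T, ∀ p' ∈ T, p.1 = p'.1 → q p.2 = q p'.2) :
    ∑ v ∈ range b, (rows (T.filter fun p => q p.2 = v)).card ≤ (rows T).card := by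
  rw [← card_biUnion]
  · refine card_le_card fun r hr => ?_
    obtain ⟨v, -, hr⟩ := mem_biUnion.1 hr
    exact rows_mono (filter_subset _ _) hr
  · intro v _ v' _ hvv
    refine disjoint_left.2 fun r hr hr' => ?_
    obtain ⟨p, hp, rfl⟩ := mem_rows.1 hr
    obtain ⟨p', hp', hpp⟩ := mem_rows.1 hr'
    rw [mem_filter] at hp hp'
    exact hvv (hp.2.symm.trans ((h p hp.1 p' hp'.1 hpp.symm).trans hp'.2))

/-- Column counts always add up over the groups, but a row may meet several groups, so the total of
the row counts enters as a separate quantity `R`. -/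
theorem card_le_of_group_bounds {A B R : ℝ} (hA : 0 ≤ A) (hB : 0 ≤ B) (hTS : T ⊆ S)
    (hqb : ∀ c ∈ cols S, q c < b)
    (hR : ((∑ v ∈ range b, (rows (T.filter fun p => q p.2 = v)).card : ℕ) : ℝ) ≤ R)
    (h : ∀ v, ((T.filter fun p => q p.2 = v).card : ℝ) ≤
      A * (rows (T.filter fun p => q p.2 = v)).card +
        B * (cols (T.filter fun p => q p.2 = v)).card) :
    (T.card : ℝ) ≤ A * R + B * (cols S).card := by
  have h1 : (T.card : ℝ) = ∑ v ∈ range b, ((T.filter fun p => q p.2 = v).card : ℝ) := by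
    rw [← sum_card_filter_snd (T := T) (q := q) (b := b)
      fun p hp => hqb _ (mem_cols.2 ⟨p, hTS hp, rfl⟩)]
    push_cast
    rfl
  have h2 : ((∑ v ∈ range b, (cols (T.filter fun p => q p.2 = v)).card : ℕ) : ℝ) ≤
      (cols S).card := by exact_mod_cast sum_card_cols_le hTS hqb
  rw [h1]
  refine (sum_le_sum fun v _ => h v).trans ?_
  rw [sum_add_distrib, ← mul_sum, ← mul_sum]
  push_cast at hR h2
  exact add_le_add (mul_le_mul_of_nonneg_left hR hA) (mul_le_mul_of_nonneg_left h2 hB)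

theorem card_cols_group_le (hTS : T ⊆ S) (hqW : ∀ v, ((cols S).filter fun c => q c = v).card ≤ W)
    (v : ℕ) : (cols (T.filter fun p => q p.2 = v)).card ≤ W := by
  refine le_trans (card_le_card fun c hc => ?_) (hqW v)
  obtain ⟨p, hp, rfl⟩ := mem_cols.1 hc
  have hp' := mem_filter.1 hp
  exact mem_filter.2 ⟨mem_cols.2 ⟨p, hTS hp'.1, rfl⟩, hp'.2⟩

variable {X : Finset ℕ} {e : ℕ} {μ β : ℝ}

theorem card_local_le (hμ : 0 ≤ μ) (hβ : 0 ≤ β) (hB : WeightBound ρ X W μ β)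
    (hS : ¬ HasPattern ρ X S) (hqb : ∀ c ∈ cols S, q c < b)
    (hqW : ∀ v, ((cols S).filter fun c => q c = v).card ≤ W) (hTS : T ⊆ S)
    (hT : ∀ p ∈ T, ¬ HasEarlier S q p) :
    (T.card : ℝ) ≤ μ * ((rows T).card + β * (cols S).card) := by
  have hR : ((∑ v ∈ range b, (rows (T.filter fun p => q p.2 = v)).card : ℕ) : ℝ) ≤
      (rows T).card := by
    refine Nat.cast_le.2 (sum_card_rows_le fun p hp p' hp' h => ?_)
    refine le_antisymm (not_lt.1 fun hlt => ?_) (not_lt.1 fun hlt => ?_)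
    · exact hT p hp ⟨p', hTS hp', h.symm, hlt⟩
    · exact hT p' hp' ⟨p, hTS hp, h, hlt⟩
  have := card_le_of_group_bounds hμ (mul_nonneg hμ hβ) hTS hqb hR fun v => by
    have hsub : (T.filter fun p => q p.2 = v) ⊆ S := (filter_subset _ _).trans hTS
    have := hB _ (fun h => hS (h.mono subset_rfl hsub)) (card_cols_group_le hTS hqW v)
    rw [mul_add, ← mul_assoc] at this
    exact this
  linarith

/-- A row has only one first group, so rows add up. Its ones in later groups lie to the right of the
whole group and can supply the last column of the pattern. -/
theorem card_first_le (hμ : 0 ≤ μ) (hβ : 0 ≤ β) (hB : WeightBound ρ X W μ β)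
    (he : ∀ x ∈ X, x < e) (hX : X.Nonempty) (hS : ¬ HasPattern ρ (insert e X) S)
    (hq : Monotone q) (hqb : ∀ c ∈ cols S, q c < b)
    (hqW : ∀ v, ((cols S).filter fun c => q c = v).card ≤ W) (hTS : T ⊆ S)
    (hT : ∀ p ∈ T, ¬ HasEarlier S q p ∧ HasLater S q p) :
    (T.card : ℝ) ≤ μ * ((rows T).card + 2 * β * (cols S).card) + 2 * (cols S).card := by
  have hR : ((∑ v ∈ range b, (rows (T.filter fun p => q p.2 = v)).card : ℕ) : ℝ) ≤
      (rows T).card := by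
    refine Nat.cast_le.2 (sum_card_rows_le fun p hp p' hp' h => ?_)
    refine le_antisymm (not_lt.1 fun hlt => ?_) (not_lt.1 fun hlt => ?_)
    · exact (hT p hp).1 ⟨p', hTS hp', h.symm, hlt⟩
    · exact (hT p' hp').1 ⟨p, hTS hp, h, hlt⟩
  have := card_le_of_group_bounds hμ (B := μ * (2 * β) + 2) (by positivity) hTS hqb hR fun v => by
    have hsub : (T.filter fun p => q p.2 = v) ⊆ T := filter_subset _ _
    have := card_le_of_one_sided hμ hβ hB (fun h => lt_irrefl _ (he _ h)) hX hS (hsub.trans hTS)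
      (card_cols_group_le hTS hqW v) fun z hz => by
        obtain ⟨p, hp, rfl⟩ := mem_rows.1 hz
        have hp' := mem_filter.1 hp
        obtain ⟨p', hp'S, hpp, hlt⟩ := (hT p hp'.1).2
        refine ⟨p', hp'S, hpp, fun x _ _ t ht => hq.reflect_lt ?_,
          fun x hx hxe => absurd hxe (he x hx).asymm⟩
        rw [(mem_filter.1 ht).2, ← hp'.2]
        exact hlt
    linarith
  linarith

theorem card_last_le (hμ : 0 ≤ μ) (hβ : 0 ≤ β) (hB : WeightBound ρ X W μ β)
    (he : ∀ x ∈ X, e < x) (hX : X.Nonempty) (hS : ¬ HasPattern ρ (insert e X) S)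
    (hq : Monotone q) (hqb : ∀ c ∈ cols S, q c < b)
    (hqW : ∀ v, ((cols S).filter fun c => q c = v).card ≤ W) (hTS : T ⊆ S)
    (hT : ∀ p ∈ T, HasEarlier S q p ∧ ¬ HasLater S q p) :
    (T.card : ℝ) ≤ μ * ((rows T).card + 2 * β * (cols S).card) + 2 * (cols S).card := by
  have hR : ((∑ v ∈ range b, (rows (T.filter fun p => q p.2 = v)).card : ℕ) : ℝ) ≤
      (rows T).card := by
    refine Nat.cast_le.2 (sum_card_rows_le fun p hp p' hp' h => ?_)
    refine le_antisymm (not_lt.1 fun hlt => ?_) (not_lt.1 fun hlt => ?_)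
    · exact (hT p' hp').2 ⟨p, hTS hp, h, hlt⟩
    · exact (hT p hp).2 ⟨p', hTS hp', h.symm, hlt⟩
  have := card_le_of_group_bounds hμ (B := μ * (2 * β) + 2) (by positivity) hTS hqb hR fun v => by
    have hsub : (T.filter fun p => q p.2 = v) ⊆ T := filter_subset _ _
    have := card_le_of_one_sided hμ hβ hB (fun h => lt_irrefl _ (he _ h)) hX hS (hsub.trans hTS)
      (card_cols_group_le hTS hqW v) fun z hz => by
        obtain ⟨p, hp, rfl⟩ := mem_rows.1 hz
        have hp' := mem_filter.1 hp
        obtain ⟨p', hp'S, hpp, hlt⟩ := (hT p hp'.1).1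
        refine ⟨p', hp'S, hpp, fun x hx hxe => absurd hxe (he x hx).asymm,
          fun x _ _ t ht => hq.reflect_lt ?_⟩
        rw [(mem_filter.1 ht).2, ← hp'.2]
        exact hlt
    linarith
  linarith

/-- Middle ones have ones of their row on both sides of the group, so both extreme columns of the
pattern can be removed. -/
theorem card_hat_part_le {e₁ e₂ : ℕ} {R : ℝ} (hμ : 0 ≤ μ) (hβ : 0 ≤ β)
    (hB : WeightBound ρ X W μ β) (he : e₁ < e₂) (he₁ : ∀ x ∈ X, e₁ < x) (he₂ : ∀ x ∈ X, x < e₂)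
    (hX : X.Nonempty) (hS : ¬ HasPattern ρ (insert e₂ (insert e₁ X)) S)
    (hq : Monotone q) (hqb : ∀ c ∈ cols S, q c < b)
    (hqW : ∀ v, ((cols S).filter fun c => q c = v).card ≤ W) (hTS : T ⊆ S)
    (hT : ∀ p ∈ T, HasEarlier S q p ∧ HasLater S q p)
    (hR : ((∑ v ∈ range b, (rows (T.filter fun p => q p.2 = v)).card : ℕ) : ℝ) ≤ R) :
    (T.card : ℝ) ≤ μ * (R + 4 * β * (cols S).card) + 6 * (cols S).card := by
  have := card_le_of_group_bounds hμ (B := μ * (4 * β) + 6) (by positivity) hTS hqb hR fun v => by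
    have hsub : (T.filter fun p => q p.2 = v) ⊆ T := filter_subset _ _
    have := card_le_of_two_sided hμ hβ hB he he₁ he₂ hX hS (hsub.trans hTS)
      (card_cols_group_le hTS hqW v)
      (fun z hz => by
        obtain ⟨p, hp, rfl⟩ := mem_rows.1 hz
        have hp' := mem_filter.1 hp
        obtain ⟨p', hp'S, hpp, hlt⟩ := (hT p hp'.1).1
        refine ⟨p', hp'S, hpp, fun t ht => hq.reflect_lt ?_⟩
        rw [(mem_filter.1 ht).2, ← hp'.2]
        exact hlt)
      (fun z hz => by
        obtain ⟨p, hp, rfl⟩ := mem_rows.1 hz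
        have hp' := mem_filter.1 hp
        obtain ⟨p', hp'S, hpp, hlt⟩ := (hT p hp'.1).2
        refine ⟨p', hp'S, hpp, fun t ht => hq.reflect_lt ?_⟩
        rw [(mem_filter.1 ht).2, ← hp'.2]
        exact hlt)
    linarith
  linarith

/-- Splitting the columns into groups: local, first, last and middle ones. -/
theorem exists_middle {l d : ℕ} {μ₀ β₀ μ₁ β₁ : ℝ} (hμ₀ : 0 ≤ μ₀) (hβ₀ : 0 ≤ β₀)
    (hμ₁ : 0 ≤ μ₁) (hβ₁ : 0 ≤ β₁) (hB₀ : WeightBound ρ (Ico l (l + d + 3)) W μ₀ β₀)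
    (hB₁ : WeightBound ρ (Ico l (l + d + 2)) W μ₁ β₁)
    (hB₁' : WeightBound ρ (Ico (l + 1) (l + d + 3)) W μ₁ β₁)
    (hS : ¬ HasPattern ρ (Ico l (l + d + 3)) S)
    (hq : Monotone q) (hqb : ∀ c ∈ cols S, q c < b)
    (hqW : ∀ v, ((cols S).filter fun c => q c = v).card ≤ W) :
    ∃ (n g : ℕ) (M : Finset (ℕ × ℕ)), n + g ≤ (rows S).card ∧ M ⊆ S ∧
      (∀ p ∈ M, HasEarlier S q p ∧ HasLater S q p) ∧ (rows M).card ≤ g ∧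
      (S.card : ℝ) ≤ μ₀ * (n + β₀ * (cols S).card) +
        2 * (μ₁ * (g + 2 * β₁ * (cols S).card) + 2 * (cols S).card) + M.card := by
  classical
  set Loc := S.filter fun p => ¬ HasEarlier S q p ∧ ¬ HasLater S q p with hLoc
  set Fst := S.filter fun p => ¬ HasEarlier S q p ∧ HasLater S q p with hFst
  set Lst := S.filter fun p => HasEarlier S q p ∧ ¬ HasLater S q p with hLst
  set Mid := S.filter fun p => HasEarlier S q p ∧ HasLater S q p with hMid
  -- The global rows. They are disjoint from the rows of local ones, which allows the two kinds of
  -- rows to be charged separately.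
  set G := rows (S.filter fun p => HasEarlier S q p ∨ HasLater S q p) with hG
  have hFG : rows Fst ⊆ G := by
    refine rows_mono fun p hp => ?_
    simp only [Fst, mem_filter] at hp ⊢
    exact ⟨hp.1, Or.inr hp.2.2⟩
  have hLG : rows Lst ⊆ G := by
    refine rows_mono fun p hp => ?_
    simp only [Lst, mem_filter] at hp ⊢
    exact ⟨hp.1, Or.inl hp.2.1⟩
  have hMG : rows Mid ⊆ G := by
    refine rows_mono fun p hp => ?_
    simp only [Mid, mem_filter] at hp ⊢
    exact ⟨hp.1, Or.inl hp.2.1⟩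
  have h0 := card_local_le hμ₀ hβ₀ hB₀ hS hqb hqW (T := Loc) (filter_subset _ _)
    fun p hp => (mem_filter.1 hp).2.1
  have h1 := card_first_le hμ₁ hβ₁ hB₁ (e := l + d + 2) (fun x hx => (mem_Ico.1 hx).2)
    ⟨l, mem_Ico.2 (by omega)⟩ (S := S) (T := Fst) (by
      intro h
      refine hS (h.mono (fun x hx => ?_) subset_rfl)
      rw [mem_insert]
      simp only [mem_Ico] at hx ⊢
      omega) hq hqb hqW (filter_subset _ _) fun p hp => (mem_filter.1 hp).2
  have h2 := card_last_le hμ₁ hβ₁ hB₁' (e := l) (fun x hx => (mem_Ico.1 hx).1)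
    ⟨l + 1, mem_Ico.2 (by omega)⟩ (S := S) (T := Lst) (by
      intro h
      refine hS (h.mono (fun x hx => ?_) subset_rfl)
      rw [mem_insert]
      simp only [mem_Ico] at hx ⊢
      omega) hq hqb hqW (filter_subset _ _) fun p hp => (mem_filter.1 hp).2
  refine ⟨(rows Loc).card, G.card, Mid, ?_, filter_subset _ _,
    fun p hp => (mem_filter.1 hp).2, card_le_card hMG, ?_⟩
  · rw [← card_union_of_disjoint]
    · exact card_le_card (union_subset (rows_mono (filter_subset _ _))
        (rows_mono (filter_subset _ _)))
    · rw [disjoint_left]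
      intro r hr hr'
      obtain ⟨p, hp, rfl⟩ := mem_rows.1 hr
      obtain ⟨p', hp', hpp⟩ := mem_rows.1 hr'
      obtain ⟨hpS, hE, hL⟩ := mem_filter.1 hp
      obtain ⟨hpS', h⟩ := mem_filter.1 hp'
      have heq : q p'.2 = q p.2 := le_antisymm
        (not_lt.1 fun h => hL ⟨p', hpS', hpp, h⟩) (not_lt.1 fun h => hE ⟨p', hpS', hpp, h⟩)
      rcases h with ⟨x, hx, hxp, hlt⟩ | ⟨x, hx, hxp, hlt⟩
      · exact hE ⟨x, hx, hxp.trans hpp, by rwa [← heq]⟩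
      · exact hL ⟨x, hx, hxp.trans hpp, by rwa [← heq]⟩
  · have hcov : S ⊆ (Loc ∪ Fst) ∪ (Lst ∪ Mid) := by
      intro p hp
      simp only [Loc, Fst, Lst, Mid, mem_union, mem_filter, hp, true_and]
      tauto
    have h3 := card_le_card hcov
    have h4 := card_union_le (Loc ∪ Fst) (Lst ∪ Mid)
    have h5 := card_union_le Loc Fst
    have h6 := card_union_le Lst Mid
    have h7 : (S.card : ℝ) ≤ Loc.card + Fst.card + Lst.card + Mid.card := by
      exact_mod_cast (by omega : S.card ≤ Loc.card + Fst.card + Lst.card + Mid.card)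
    have h8 : ((rows Fst).card : ℝ) ≤ G.card := Nat.cast_le.2 (card_le_card hFG)
    have h9 : ((rows Lst).card : ℝ) ≤ G.card := Nat.cast_le.2 (card_le_card hLG)
    have h10 := mul_le_mul_of_nonneg_left h8 hμ₁
    have h11 := mul_le_mul_of_nonneg_left h9 hμ₁
    linarith

end Decomposition

/-! ### The recursive inequality -/

/-- Index 0 is for local ones, 1 for first and last ones (one column removed), 2 for ones in hat
blocks (two columns removed), and 3 for the matrix with contracted columns. Here `n` and `g` count
local and global rows; only the latter pay for the terms beyond the local one. -/
theorem recursion_step {σ : ℕ → ℕ} {k : ℕ} (hσ : ∀ v < k + 1, σ v < k + 1)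
    (hσi : ∀ v v', v < k + 1 → v' < k + 1 → σ v = σ v' → v = v')
    {l d W b : ℕ} {μ₀ β₀ μ₁ β₁ μ₂ β₂ μ₃ β₃ : ℝ} (hl : l + d + 3 ≤ 3 * (k + 1))
    (hμ₀ : 0 ≤ μ₀) (hβ₀ : 0 ≤ β₀) (hμ₁ : 0 ≤ μ₁) (hβ₁ : 0 ≤ β₁) (hμ₂ : 0 ≤ μ₂) (hβ₂ : 0 ≤ β₂)
    (hμ₃ : 0 ≤ μ₃) (hβ₃ : 0 ≤ β₃)
    (hB₀ : WeightBound (hatRank σ) (Ico l (l + d + 3)) W μ₀ β₀)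
    (hB₁ : WeightBound (hatRank σ) (Ico l (l + d + 2)) W μ₁ β₁)
    (hB₁' : WeightBound (hatRank σ) (Ico (l + 1) (l + d + 3)) W μ₁ β₁)
    (hB₂ : WeightBound (hatRank σ) (Ico (l + 1) (l + d + 2)) W μ₂ β₂)
    (hB₃ : WeightBound (hatRank σ) (Ico l (l + d + 3)) b μ₃ β₃)
    {S : Finset (ℕ × ℕ)} (hS : ¬ HasPattern (hatRank σ) (Ico l (l + d + 3)) S) (hW : 0 < W)
    (hWm : W ≤ (cols S).card) (hmb : (cols S).card ≤ W * b) (hbm : W * b ≤ 2 * (cols S).card) :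
    ∃ n g : ℕ, n + g ≤ (rows S).card ∧
      (S.card : ℝ) ≤ μ₀ * (n + β₀ * (cols S).card) +
        2 * (μ₁ * (g + 2 * β₁ * (cols S).card) + 2 * (cols S).card) +
        2 * (μ₃ * (g + β₃ * b)) + (segConst k + 1) * (g + 3 * (cols S).card) +
        (μ₂ * (gridConst k * (g + 3 * (cols S).card) + 4 * β₂ * (cols S).card) +
          6 * (cols S).card) := by
  obtain ⟨q, hq, hqc, hqW⟩ := exists_groups (cols S) hW
  have hqb : ∀ c ∈ cols S, q c < b := fun c hc => by
    have h1 := (hqc c hc).trans_le hmb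
    rw [mul_comm W b] at h1
    exact lt_of_mul_lt_mul_right h1 (Nat.zero_le _)
  obtain ⟨n, g, M, hng, hMS, hM, hMg, hcard⟩ :=
    exists_middle hμ₀ hβ₀ hμ₁ hβ₁ hB₀ hB₁ hB₁' hS hq hqb hqW
  refine ⟨n, g, hng, ?_⟩
  -- Row groups have the same size `W` as column groups, so a bound linear in the number of groups,
  -- multiplied by `W`, is linear in `g` and the number of columns.
  obtain ⟨ω, hω, hωc, hωW⟩ := exists_groups (rows M) hW
  have hωn : ∀ r ∈ rows M, ω r < g / W + 1 := fun r hr => by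
    have h1 := (hωc r hr).trans_le hMg
    rw [Nat.lt_succ_iff, Nat.le_div_iff_mul_le hW]
    exact h1.le
  have hcM := cols_mono hMS
  have hMpat : ¬ HasPattern (hatRank σ) (range (3 * (k + 1))) M := fun h => by
    refine hS (h.mono (fun x hx => ?_) hMS)
    rw [mem_Ico] at hx
    rw [mem_range]
    omega
  obtain ⟨H, hHM, hMc, hHr⟩ := exists_hat_part hσ hσi hMpat hω hq hωn
    (fun c hc => hqb c (hcM hc)) hωW
    (fun v => (card_le_card (filter_subset_filter _ hcM)).trans (hqW v))
  have hWg : (W : ℝ) * (((g / W + 1 : ℕ) : ℝ) + b) ≤ g + 3 * (cols S).card := by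
    have h1 : W * (g / W + 1) ≤ g + W := by
      rw [mul_add, mul_one]
      exact Nat.add_le_add_right (Nat.mul_div_le g W) W
    have : W * ((g / W + 1) + b) ≤ g + 3 * (cols S).card := by
      rw [mul_add]; omega
    exact_mod_cast this
  have hP : (((M.image fun p => (p.1, q p.2)).card : ℕ) : ℝ) ≤ μ₃ * (g + β₃ * b) := by
    set P := M.image fun p => (p.1, q p.2) with hPdef
    have hPc : (cols P).card ≤ b := by
      have : cols P ⊆ range b := by
        intro c hc
        obtain ⟨x, hx, rfl⟩ := mem_cols.1 hc
        obtain ⟨p, hp, rfl⟩ := mem_image.1 hx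
        exact mem_range.2 (hqb _ (mem_cols.2 ⟨p, hMS hp, rfl⟩))
      simpa using card_le_card this
    have hPr : (rows P).card ≤ g := by
      refine (card_le_card fun r hr => ?_).trans hMg
      obtain ⟨x, hx, rfl⟩ := mem_rows.1 hr
      obtain ⟨p, hp, rfl⟩ := mem_image.1 hx
      exact mem_rows.2 ⟨p, hp, rfl⟩
    refine (hB₃ P ?_ hPc).trans ?_
    · rintro ⟨p, hp, h1, h2, h3⟩
      have : ∀ x ∈ Ico l (l + d + 3), ∃ y ∈ M, (y.1, q y.2) = p x :=
        fun x hx => mem_image.1 (hp x hx)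
      choose! y hy hyp using this
      refine hS ⟨y, fun x hx => hMS (hy x hx), fun x hx x' hx' h => hq.reflect_lt ?_,
        fun x hx x' hx' h => ?_, fun x hx x' hx' h => ?_⟩
      · have := h1 x hx x' hx' h
        rwa [← hyp x hx, ← hyp x' hx'] at this
      · have := h2 x hx x' hx' h
        rwa [← hyp x hx, ← hyp x' hx'] at this
      · have := h3 x hx x' hx' h
        rwa [← hyp x hx, ← hyp x' hx'] at this
    · have h1 : ((rows P).card : ℝ) ≤ g := Nat.cast_le.2 hPr
      have h2 : ((cols P).card : ℝ) ≤ b := Nat.cast_le.2 hPc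
      gcongr
  have hHc : (H.card : ℝ) ≤ μ₂ * (gridConst k * (g + 3 * (cols S).card) +
      4 * β₂ * (cols S).card) + 6 * (cols S).card := by
    refine card_hat_part_le hμ₂ hβ₂ hB₂ (e₁ := l) (e₂ := l + d + 2) (by omega)
      (fun x hx => (mem_Ico.1 hx).1) (fun x hx => (mem_Ico.1 hx).2) ⟨l + 1, mem_Ico.2 (by omega)⟩
      (fun h => hS (h.mono (fun x hx => ?_) subset_rfl)) hq hqb hqW (hHM.trans hMS)
      (fun p hp => hM p (hHM hp)) ?_
    · rw [mem_insert, mem_insert]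
      simp only [mem_Ico] at hx ⊢
      omega
    · have h1 : ((∑ v ∈ range b, (rows (H.filter fun p => q p.2 = v)).card : ℕ) : ℝ) ≤
          (W : ℝ) * (gridConst k * (((g / W + 1 : ℕ) : ℝ) + b)) := by exact_mod_cast hHr
      refine h1.trans ?_
      calc (W : ℝ) * (gridConst k * (((g / W + 1 : ℕ) : ℝ) + b)) =
          gridConst k * (W * (((g / W + 1 : ℕ) : ℝ) + b)) := by ring
        _ ≤ _ := mul_le_mul_of_nonneg_left hWg (Nat.cast_nonneg _)
  have hMc' : (M.card : ℝ) ≤ 2 * ((M.image fun p => (p.1, q p.2)).card : ℕ) +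
      W * ((segConst k + 1) * (((g / W + 1 : ℕ) : ℝ) + b)) + H.card := by exact_mod_cast hMc
  have h1 : (W : ℝ) * ((segConst k + 1) * (((g / W + 1 : ℕ) : ℝ) + b)) ≤
      (segConst k + 1) * (g + 3 * (cols S).card) := by
    calc (W : ℝ) * ((segConst k + 1) * (((g / W + 1 : ℕ) : ℝ) + b)) =
        (segConst k + 1) * (W * (((g / W + 1 : ℕ) : ℝ) + b)) := by ring
      _ ≤ _ := mul_le_mul_of_nonneg_left hWg (by positivity)
  linarith

/-! ### Base cases: at most two pattern columns, and halving -/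

theorem WeightBound.anti {ρ : ℕ → ℕ} {X : Finset ℕ} {M M' : ℕ} {μ β : ℝ} (h : M' ≤ M)
    (hB : WeightBound ρ X M μ β) : WeightBound ρ X M' μ β :=
  fun S hS hM => hB S hS (hM.trans h)

theorem WeightBound.mono {ρ : ℕ → ℕ} {X : Finset ℕ} {M : ℕ} {μ β μ' β' : ℝ}
    (hμ : μ ≤ μ') (hμβ : μ * β ≤ μ' * β') (hB : WeightBound ρ X M μ β) :
    WeightBound ρ X M μ' β' := by
  intro S hS hM
  refine (hB S hS hM).trans ?_
  have h1 := mul_le_mul_of_nonneg_right hμ (Nat.cast_nonneg (α := ℝ) (rows S).card)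
  have h2 := mul_le_mul_of_nonneg_right hμβ (Nat.cast_nonneg (α := ℝ) (cols S).card)
  linarith

theorem weightBound_one (ρ : ℕ → ℕ) (l M : ℕ) {μ β : ℝ} (hμ : 0 ≤ μ) (hβ : 0 ≤ β) :
    WeightBound ρ (Ico l (l + 1)) M μ β := by
  intro S hS _
  have : S = ∅ := by
    rw [eq_empty_iff_forall_notMem]
    intro p hp
    refine hS ⟨fun _ => p, fun _ _ => hp, ?_, ?_, fun _ _ _ _ _ => rfl⟩
    · intro x hx y hy hxy
      rw [mem_Ico] at hx hy
      omega
    · intro x hx y hy hxy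
      rw [mem_Ico] at hx hy
      obtain rfl : x = y := by omega
      omega
  rw [this]
  simp only [card_empty, Nat.cast_zero]
  positivity

theorem card_le_of_not_hasPattern_two {ρ : ℕ → ℕ} {l : ℕ} {S : Finset (ℕ × ℕ)}
    (hS : ¬ HasPattern ρ (Ico l (l + 2)) S) : S.card ≤ (rows S).card + (cols S).card := by
  classical
  have key : ∀ p ∈ S, ∀ p' ∈ S, p.2 < p'.2 → ¬ ((ρ l < ρ (l + 1) → p.1 < p'.1) ∧
      (ρ (l + 1) < ρ l → p'.1 < p.1) ∧ (ρ l = ρ (l + 1) → p.1 = p'.1)) := by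
    rintro p hp p' hp' hlt ⟨h1, h2, h3⟩
    have hx : ∀ x ∈ Ico l (l + 2), x = l ∨ x = l + 1 := fun x hx => by
      rw [mem_Ico] at hx
      omega
    refine hS ⟨fun x => if x = l then p else p', ?_, ?_, ?_, ?_⟩
    · intro x _
      dsimp only
      split_ifs <;> assumption
    all_goals
      intro x hx₁ y hy₁ hxy
      rcases hx x hx₁ with rfl | rfl <;> rcases hx y hy₁ with rfl | rfl <;> simp at hxy ⊢ <;>
        omega
  set A := S.filter fun p => ∃ p' ∈ S, p'.1 = p.1 ∧ p.2 < p'.2 with hA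
  have h1 : A.card ≤ (cols S).card := by
    refine card_le_card_of_injOn Prod.snd ?_ ?_
    · intro p hp
      exact mem_coe.2 (mem_cols.2 ⟨p, (mem_filter.1 (mem_coe.1 hp)).1, rfl⟩)
    · intro p hp p' hp' h
      obtain ⟨hpS, x, hx, hxp, hlt⟩ := mem_filter.1 (mem_coe.1 hp)
      obtain ⟨hpS', x', hx', hxp', hlt'⟩ := mem_filter.1 (mem_coe.1 hp')
      refine Prod.ext ?_ h
      by_contra hne
      have k1 := key p hpS x hx hlt
      have k2 := key p hpS x' hx' (by rw [h]; exact hlt')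
      have k3 := key p' hpS' x hx (by rw [← h]; exact hlt)
      omega
  have h2 : (S.filter fun p => ¬ ∃ p' ∈ S, p'.1 = p.1 ∧ p.2 < p'.2).card ≤ (rows S).card := by
    refine card_le_card_of_injOn Prod.fst ?_ ?_
    · intro p hp
      exact mem_coe.2 (mem_rows.2 ⟨p, (mem_filter.1 (mem_coe.1 hp)).1, rfl⟩)
    · intro p hp p' hp' h
      obtain ⟨hpS, hn⟩ := mem_filter.1 (mem_coe.1 hp)
      obtain ⟨hpS', hn'⟩ := mem_filter.1 (mem_coe.1 hp')
      refine Prod.ext h (le_antisymm ?_ ?_)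
      · exact not_lt.1 fun hlt => hn' ⟨p, hpS, h, hlt⟩
      · exact not_lt.1 fun hlt => hn ⟨p', hpS', h.symm, hlt⟩
  have h3 := card_filter_add_card_filter_not (s := S) fun p => ∃ p' ∈ S, p'.1 = p.1 ∧ p.2 < p'.2
  change A.card + _ = _ at h3
  omega

theorem weightBound_two (ρ : ℕ → ℕ) (l M : ℕ) {μ β : ℝ} (hμ : 1 ≤ μ) (hβ : 1 ≤ β) :
    WeightBound ρ (Ico l (l + 2)) M μ β := by
  intro S hS _
  have h : (S.card : ℝ) ≤ (rows S).card + (cols S).card := by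
    exact_mod_cast card_le_of_not_hasPattern_two hS
  have h1 : ((cols S).card : ℝ) ≤ β * (cols S).card := le_mul_of_one_le_left (by positivity) hβ
  refine h.trans ((add_le_add_right h1 _).trans ?_)
  exact le_mul_of_one_le_left (by positivity) hμ

/-- With only two column groups there are no middle ones, so halving the columns gives a bound
polylogarithmic in their number. This covers the first row `2 ^ j` of the Ackermann table. -/
theorem weightBound_halving (ρ : ℕ → ℕ) (u : ℕ) : ∀ t l : ℕ,
    WeightBound ρ (Ico l (l + u + 1)) (2 ^ t) (2 ^ (u + 1)) ((4 * ((t : ℝ) + 1)) ^ (u + 1)) := by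
  induction u with
  | zero => exact fun t l => weightBound_one ρ l _ (by positivity) (by positivity)
  | succ d ihd =>
    rcases Nat.eq_zero_or_pos d with rfl | hd
    · intro t l
      refine weightBound_two ρ l _ (by norm_num) (one_le_pow₀ ?_)
      have : (0 : ℝ) ≤ t := by positivity
      linarith
    obtain ⟨d, rfl⟩ : ∃ d', d = d' + 1 := ⟨d - 1, by omega⟩
    intro t
    induction t with
    | zero =>
      intro l S _ hM
      have h1 : S.card ≤ (rows S).card := by
        have := card_le_card_rows_mul S
        have h2 : (rows S).card * (cols S).card ≤ (rows S).card * 1 :=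
          Nat.mul_le_mul_left _ (by simpa using hM)
        omega
      have h2 : (S.card : ℝ) ≤ (rows S).card := Nat.cast_le.2 h1
      have h3 : (1 : ℝ) ≤ 2 ^ (d + 1 + 1 + 1) := one_le_pow₀ (by norm_num)
      have h4 : (0 : ℝ) ≤ (4 * (((0 : ℕ) : ℝ) + 1)) ^ (d + 1 + 1 + 1) * (cols S).card := by positivity
      refine h2.trans (le_trans ?_ (le_mul_of_one_le_left (by positivity) h3))
      linarith
    | succ t iht =>
      intro l S hS hM
      obtain ⟨q, hq, hqc, hqW⟩ := exists_groups (cols S) (w := 2 ^ t) (by positivity)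
      have hqb : ∀ c ∈ cols S, q c < 2 := fun c hc => by
        have h1 := (hqc c hc).trans_le hM
        rw [pow_succ, mul_comm (2 ^ t) 2] at h1
        exact lt_of_mul_lt_mul_right h1 (Nat.zero_le _)
      have hB₁' : WeightBound ρ (Ico (l + 1) (l + d + 3)) (2 ^ t) (2 ^ (d + 2))
          ((4 * ((t : ℝ) + 1)) ^ (d + 2)) := by
        have := ihd t (l + 1)
        rwa [show l + 1 + (d + 1) + 1 = l + d + 3 by ring] at this
      obtain ⟨n, g, M, hng, hMS, hM, -, hcard⟩ := exists_middle (d := d) (by positivity)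
        (by positivity) (by positivity) (by positivity) (iht l) (ihd t l) hB₁' hS hq hqb hqW
      -- A middle one needs three distinct group indices, but these are all less than 2.
      have hM0 : M = ∅ := by
        rw [eq_empty_iff_forall_notMem]
        intro p hp
        obtain ⟨⟨x, -, -, hx⟩, y, hy, -, hy'⟩ := hM p hp
        have := hqb _ (mem_cols.2 ⟨y, hy, rfl⟩)
        omega
      rw [hM0, card_empty, Nat.cast_zero, add_zero] at hcard
      refine hcard.trans ?_
      have hng' : (n : ℝ) + g ≤ (rows S).card := by exact_mod_cast hng
      set m : ℝ := ((cols S).card : ℝ) with hm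
      set y : ℝ := 4 * ((t : ℝ) + 1) with hy
      have hy4 : 4 ≤ y := by
        have : (0 : ℝ) ≤ t := by positivity
        linarith
      have hy' : 4 * (((t + 1 : ℕ) : ℝ) + 1) = y + 4 := by rw [hy]; push_cast; ring
      rw [hy']
      have e1 : (2 : ℝ) ^ (d + 1 + 1 + 1) = 2 * 2 ^ (d + 2) := by ring
      have e2 : y ^ (d + 1 + 1 + 1) + 2 * y ^ (d + 2) + 2 ≤ (y + 4) ^ (d + 1 + 1 + 1) := by
        have h1 : y ^ (d + 2) * (y + 4) ≤ (y + 4) ^ (d + 2) * (y + 4) := by gcongr; linarith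
        have h2 : (1 : ℝ) ≤ y ^ (d + 2) := one_le_pow₀ (by linarith)
        calc _ ≤ y ^ (d + 2) * (y + 4) := by
              rw [show y ^ (d + 1 + 1 + 1) = y ^ (d + 2) * y by ring]; linarith
          _ ≤ _ := h1
      have e3 : (1 : ℝ) ≤ 2 ^ (d + 2) := one_le_pow₀ (by norm_num)
      have hm0 : 0 ≤ m := by positivity
      rw [show d + 1 + 1 = d + 2 by ring]
      rw [e1]
      have e4 := mul_le_mul_of_nonneg_left (mul_le_mul_of_nonneg_right e2 hm0)
        (by positivity : (0 : ℝ) ≤ 2 * 2 ^ (d + 2))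
      have e5 := mul_le_mul_of_nonneg_left hng' (by positivity : (0 : ℝ) ≤ 2 * 2 ^ (d + 2))
      have e6 := mul_le_mul_of_nonneg_right e3 hm0
      linarith

/-! ### Induction along the Ackermann table -/

theorem two_le_ackTable (i j : ℕ) : 2 ≤ ackTable (i + 1) (j + 1) := by
  rcases Nat.eq_zero_or_pos j with rfl | hj
  · rcases i with _ | i
    · simp [ackTable]
    · simp [ackTable]
  · exact (Nat.le_self_pow (by omega) 2).trans (two_pow_le_ackTable i (j + 1) (by omega))

theorem ackTable_one (i : ℕ) : ackTable (i + 1) 1 = 2 := by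
  rcases i with _ | i <;> simp [ackTable]

theorem ackTable_succ (i j : ℕ) : ackTable (i + 2) (j + 2) =
    ackTable (i + 2) (j + 1) * ackTable (i + 1) (ackTable (i + 2) (j + 1)) := by
  rw [ackTable]

theorem column_coefficient_le {d : ℕ} {x : ℝ} (hx : 20 ≤ x) :
    x ^ (d + 3) + 2 * x ^ (d + 2) + 4 * x ^ (d + 1) + 2 * 20 ^ (d + 3) + 11 ≤
      (x + 20) ^ (d + 3) := by
  have h1 : x ^ d * (x + 20) ^ 3 ≤ (x + 20) ^ d * (x + 20) ^ 3 := by gcongr; linarith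
  have h2 : (20 : ℝ) ^ (d + 2) ≤ x ^ (d + 2) := by gcongr
  have h3 : (1 : ℝ) ≤ x ^ d := one_le_pow₀ (by linarith)
  have h4 : x ^ d * (20 * x) ≤ x ^ d * (x * x) := by gcongr
  have h5 : x ^ d * 20 ≤ x ^ d * x := by gcongr
  have h6 : x ^ d * (x + 20) ^ 3 = x ^ (d + 3) + 60 * (x ^ (d + 2)) + 1200 * (x ^ d * x) +
      8000 * x ^ d := by ring
  have h7 : x ^ (d + 2) = x ^ d * (x * x) := by ring
  have h8 : x ^ (d + 1) = x ^ d * x := by ring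
  have h9 : (20 : ℝ) ^ (d + 3) = 20 * 20 ^ (d + 2) := by ring
  have h10 : (x + 20) ^ (d + 3) = (x + 20) ^ d * (x + 20) ^ 3 := by ring
  have h11 : 0 ≤ x ^ d * x := by positivity
  rw [h10, h9, h8]
  linarith

/-- Compares the coefficients of local rows, global rows and columns separately. The recursion
`hrec` pays for the global rows, and also makes `μ₀` dominate the other row coefficients so that
`hcol` pays for the columns. -/
theorem combine_step {μ₀ μ₁ μ₂ μ₃ c s G n g R m x₁ x₂ x₃ y b z K : ℝ} (p0 : 0 ≤ μ₀) (p1 : 0 ≤ μ₂)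
    (p2 : 0 ≤ μ₁) (p3 : 0 ≤ μ₃) (hc₁ : 3 * (s + 1) ≤ c) (hc₂ : 3 * G ≤ c) (hc3 : 3 ≤ c)
    (hrec : 2 * μ₁ + 2 * μ₃ + c * μ₂ + c ≤ μ₀) (hm : 0 ≤ m) (hg : 0 ≤ g) (h₁ : 0 ≤ x₁)
    (h₂ : 0 ≤ x₂) (hK : 0 ≤ K) (hcol : x₃ + 2 * x₂ + 4 * x₁ + 2 * K + 11 ≤ z)
    (hR : n + g ≤ R) (hb : y * b ≤ 2 * K * m) :
    μ₀ * (n + x₃ * m) + 2 * (μ₁ * (g + 2 * x₂ * m) + 2 * m) + 2 * (μ₃ * (g + y * b)) +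
        (s + 1) * (g + 3 * m) + (μ₂ * (G * (g + 3 * m) + 4 * x₁ * m) + 6 * m) ≤
      μ₀ * (R + z * m) := by
  have hcμ : 3 * μ₂ ≤ c * μ₂ := mul_le_mul_of_nonneg_right hc3 p1
  have hG : G * μ₂ ≤ c / 3 * μ₂ := mul_le_mul_of_nonneg_right (by linarith) p1
  have f1 : μ₀ * (n + g) ≤ μ₀ * R := mul_le_mul_of_nonneg_left hR p0
  have f2 : (2 * μ₁ + 2 * μ₃ + G * μ₂ + (s + 1)) * g ≤ μ₀ * g :=
    mul_le_mul_of_nonneg_right (by linarith) hg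
  have f3 : μ₃ * (y * b) ≤ μ₃ * (2 * K * m) := mul_le_mul_of_nonneg_left hb p3
  have f4 : (2 * μ₁) * (x₂ * m) ≤ μ₀ * (x₂ * m) :=
    mul_le_mul_of_nonneg_right (by linarith) (mul_nonneg h₂ hm)
  have f5 : μ₂ * (x₁ * m) ≤ μ₀ * (x₁ * m) :=
    mul_le_mul_of_nonneg_right (by linarith) (mul_nonneg h₁ hm)
  have f6 : (2 * μ₃) * (K * m) ≤ μ₀ * (K * m) :=
    mul_le_mul_of_nonneg_right (by linarith) (mul_nonneg hK hm)
  have f7 : (3 * (s + 1) + 3 * (G * μ₂)) * m ≤ μ₀ * m :=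
    mul_le_mul_of_nonneg_right (by linarith) hm
  have f8 : 1 * m ≤ μ₀ * m := mul_le_mul_of_nonneg_right (by linarith) hm
  have f9 := mul_le_mul_of_nonneg_left (mul_le_mul_of_nonneg_right hcol hm) p0
  linarith

/-- With w = a(i+1,j), using groups of w^D columns leaves at most a(i,w)^D groups, since a(i+1,j+1)
= w · a(i,w). The power D = 3(k+1) makes the group size absorb the contracted column coefficient,
which is of order w to the number of pattern columns. -/
theorem weightBound_ackTable {σ : ℕ → ℕ} {k : ℕ} (hσ : ∀ v < k + 1, σ v < k + 1)
    (hσi : ∀ v v', v < k + 1 → v' < k + 1 → σ v = σ v' → v = v') {c : ℝ} {μ : ℕ → ℕ → ℝ}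
    (hc₁ : 3 * ((segConst k : ℝ) + 1) ≤ c) (hc₂ : 3 * (gridConst k : ℝ) ≤ c)
    (h₀ : ∀ u i, 0 ≤ μ u i) (h₂ : ∀ i, 1 ≤ μ 2 i)
    (h₃ : ∀ d, d + 3 ≤ 3 * (k + 1) → ((3 * (k + 1) : ℕ) : ℝ) ^ (d + 3) ≤ μ (d + 3) 1)
    (hμ : ∀ d i, 1 ≤ i → 2 * μ (d + 2) (i + 1) + 2 * μ (d + 3) i + c * μ (d + 1) (i + 1) + c ≤
      μ (d + 3) (i + 1)) (u : ℕ) : ∀ i j l : ℕ, l + (u + 1) ≤ 3 * (k + 1) →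
    WeightBound (hatRank σ) (Ico l (l + u + 1)) (ackTable (i + 1) (j + 1) ^ (3 * (k + 1)))
      (μ (u + 1) (i + 1)) ((20 * ((j : ℝ) + 1)) ^ (u + 1)) := by
  have hc3 : 3 ≤ c := by
    have : (0 : ℝ) ≤ segConst k := Nat.cast_nonneg _
    linarith
  set D := 3 * (k + 1) with hD
  induction u using Nat.strong_induction_on with
  | _ u ihu =>
  rcases Nat.eq_zero_or_pos u with rfl | hu
  · exact fun i j l _ => weightBound_one _ l _ (h₀ _ _) (by positivity)
  rcases Nat.eq_or_lt_of_le hu with rfl | hu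
  · intro i j l _
    refine weightBound_two _ l _ (h₂ _) (one_le_pow₀ ?_)
    have : (0 : ℝ) ≤ j := Nat.cast_nonneg _
    linarith
  obtain ⟨d, rfl⟩ : ∃ d, u = d + 2 := ⟨u - 2, by omega⟩
  intro i
  induction i with
  | zero =>
    intro j l hl
    have ha : ackTable (0 + 1) (j + 1) ^ D = 2 ^ ((j + 1) * D) := by
      rw [show ackTable (0 + 1) (j + 1) = 2 ^ (j + 1) by simp [ackTable], pow_mul 2 (j + 1) D]
    rw [ha]
    have hμ1 := h₃ d (by omega)
    have hD3 : (3 : ℝ) ≤ D := by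
      rw [hD]; push_cast
      have : (0 : ℝ) ≤ k := Nat.cast_nonneg _
      linarith
    -- The column bound from halving is a power of about (j+1)D; the factor D is moved into the row
    -- coefficient, which is what `h₃` is for.
    refine (weightBound_halving (hatRank σ) (d + 2) ((j + 1) * D) l).mono ?_ ?_
    · refine le_trans ?_ hμ1
      exact pow_le_pow_left₀ (by norm_num) (by linarith) _
    · refine le_trans ?_ (mul_le_mul_of_nonneg_right hμ1 (by positivity))
      rw [← mul_pow, ← mul_pow]
      refine pow_le_pow_left₀ (by positivity) ?_ _
      push_cast
      have hj : (1 : ℝ) ≤ (j : ℝ) + 1 := by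
        have : (0 : ℝ) ≤ j := Nat.cast_nonneg _
        linarith
      have : (1 : ℝ) * 1 ≤ ((j : ℝ) + 1) * D := mul_le_mul hj (by linarith) (by norm_num) (by linarith)
      linarith
  | succ i ihi =>
    have hrec := hμ d (i + 1) (by omega)
    have p1 := h₀ (d + 1) (i + 1 + 1)
    have p2 := h₀ (d + 2) (i + 1 + 1)
    have p3 := h₀ (d + 3) (i + 1)
    have p0 := h₀ (d + 3) (i + 1 + 1)
    have p1c : 3 * μ (d + 1) (i + 1 + 1) ≤ c * μ (d + 1) (i + 1 + 1) :=
      mul_le_mul_of_nonneg_right hc3 p1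
    intro j
    induction j with
    | zero =>
      intro l hl
      -- The first entry is 2 at every level, so the previous level already gives the bound.
      have := ihi 0 l hl
      rw [zero_add, ackTable_one] at this
      rw [zero_add, ackTable_one]
      have hle : μ (d + 2 + 1) (i + 1) ≤ μ (d + 2 + 1) (i + 1 + 1) := by
        change μ (d + 3) (i + 1) ≤ μ (d + 3) (i + 1 + 1)
        linarith
      exact this.mono hle (mul_le_mul_of_nonneg_right hle (by positivity))
    | succ j ihj =>
      intro l hl S hS hM
      set w := ackTable (i + 1 + 1) (j + 1) with hw
      have hw2 : 2 ≤ w := two_le_ackTable _ _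
      have hrecA : ackTable (i + 1 + 1) (j + 1 + 1) = w * ackTable (i + 1) w := ackTable_succ i j
      set x : ℝ := 20 * ((j : ℝ) + 1) with hx
      have hx20 : 20 ≤ x := by
        have : (0 : ℝ) ≤ j := Nat.cast_nonneg _
        linarith
      have hx' : 20 * (((j + 1 : ℕ) : ℝ) + 1) = x + 20 := by rw [hx]; push_cast; ring
      rw [hx']
      rcases le_or_gt (cols S).card (w ^ D) with hmW | hmW
      · refine (ihj l hl S hS hmW).trans ?_
        gcongr
        linarith
      set W := w ^ D with hWdef
      have hW0 : 0 < W := by positivity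
      set b := ((cols S).card + W - 1) / W with hb
      have hbM : b ≤ ackTable (i + 1) w ^ D := by
        rw [hrecA, mul_pow, ← hWdef] at hM
        rw [hb, ← Nat.lt_succ_iff, Nat.div_lt_iff_lt_mul hW0, Nat.succ_mul, mul_comm _ W]
        omega
      have hWb : W * b ≤ 2 * (cols S).card := by
        have : W * b ≤ (cols S).card + W - 1 := by
          rw [hb]; exact Nat.mul_div_le _ _
        omega
      have hmb : (cols S).card ≤ W * b := by
        have := Nat.div_add_mod ((cols S).card + W - 1) W
        have h2 := Nat.mod_lt ((cols S).card + W - 1) hW0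
        rw [← hb] at this
        omega
      have hB₁' := ihu (d + 1) (by omega) (i + 1) j (l + 1) (by omega)
      rw [show l + 1 + (d + 1) + 1 = l + d + 3 by ring] at hB₁'
      have hB₂ := ihu d (by omega) (i + 1) j (l + 1) (by omega)
      rw [show l + 1 + d + 1 = l + d + 2 by ring] at hB₂
      have hB₃ := ihi (w - 1) l hl
      rw [show w - 1 + 1 = w by omega] at hB₃
      obtain ⟨n, g, hng, hcard⟩ := recursion_step hσ hσi (d := d) (by omega) p0 (by positivity)
        p2 (by positivity) p1 (by positivity) p3 (by positivity) (ihj l hl)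
        (ihu (d + 1) (by omega) (i + 1) j l (by omega)) hB₁' hB₂ (hB₃.anti hbM) hS hW0 hmW.le
        hmb hWb
      refine hcard.trans ?_
      have hw1 : ((w - 1 : ℕ) : ℝ) + 1 = w := by
        rw [Nat.cast_sub (by omega), Nat.cast_one, sub_add_cancel]
      rw [hw1]
      set m : ℝ := ((cols S).card : ℝ) with hm
      have hm0 : 0 ≤ m := Nat.cast_nonneg _
      -- The power of `w` in the coefficient is at most `W = w ^ D`, and `W * b` is at most twice
      -- the number of columns.
      have hbm : (20 * (w : ℝ)) ^ (d + 2 + 1) * b ≤ 2 * 20 ^ (d + 3) * m := by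
        have h1 : (w : ℝ) ^ (d + 3) ≤ (w : ℝ) ^ D :=
          pow_le_pow_right₀ (by exact_mod_cast (by omega : 1 ≤ w)) (by omega)
        have h2 : (w : ℝ) ^ D * b ≤ 2 * m := by
          have := Nat.cast_le (α := ℝ).2 hWb
          push_cast [hWdef] at this
          exact this
        have h3 : (w : ℝ) ^ (d + 3) * b ≤ 2 * m :=
          (mul_le_mul_of_nonneg_right h1 (Nat.cast_nonneg _)).trans h2
        calc (20 * (w : ℝ)) ^ (d + 2 + 1) * b = 20 ^ (d + 3) * ((w : ℝ) ^ (d + 3) * b) := by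
              rw [mul_pow]; ring
          _ ≤ 20 ^ (d + 3) * (2 * m) := by gcongr
          _ = _ := by ring
      have hng' : (n : ℝ) + g ≤ (rows S).card := by exact_mod_cast hng
      have hg0 : (0 : ℝ) ≤ g := Nat.cast_nonneg _
      have hcol := column_coefficient_le (d := d) hx20
      have hgrid : (gridConst k : ℝ) * μ (d + 1) (i + 1 + 1) ≤ c / 3 * μ (d + 1) (i + 1 + 1) :=
        mul_le_mul_of_nonneg_right (by linarith) p1
      change _ ≤ μ (d + 3) (i + 1 + 1) * ((rows S).card + (x + 20) ^ (d + 3) * m)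
      change μ (d + 3) (i + 1 + 1) * (n + x ^ (d + 3) * m) +
        2 * (μ (d + 2) (i + 1 + 1) * (g + 2 * x ^ (d + 2) * m) + 2 * m) +
        2 * (μ (d + 3) (i + 1) * (g + (20 * (w : ℝ)) ^ (d + 2 + 1) * b)) +
        (segConst k + 1) * (g + 3 * m) +
        (μ (d + 1) (i + 1 + 1) * (gridConst k * (g + 3 * m) + 4 * x ^ (d + 1) * m) + 6 * m) ≤ _
      exact combine_step p0 p1 p2 p3 hc₁ hc₂ hc3 hrec hm0 hg0 (by positivity) (by positivity)
        (by positivity) hcol hng' hbm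

/-! ### Solving the recursion for the row coefficients -/

/-- The coefficient of the number of rows in the bound at level `i` for patterns with `u` columns. -/
noncomputable def rowCoeff (κ : ℝ) (u i : ℕ) : ℝ :=
  if u ≤ 1 then 0 else 2 ^ i * (κ * (2 - (1 / 2) ^ i) + 4 * i) ^ (u - 2)

theorem rowCoeff_base_nonneg {κ : ℝ} (hκ : 0 ≤ κ) (i : ℕ) :
    κ ≤ κ * (2 - (1 / 2) ^ i) + 4 * i := by
  have h : ((1 : ℝ) / 2) ^ i ≤ 1 := pow_le_one₀ (by norm_num) (by norm_num)
  have h2 : κ * 1 ≤ κ * (2 - (1 / 2) ^ i) := mul_le_mul_of_nonneg_left (by linarith) hκ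
  have : (0 : ℝ) ≤ i := Nat.cast_nonneg _
  linarith

theorem rowCoeff_nonneg {κ : ℝ} (hκ : 0 ≤ κ) (u i : ℕ) : 0 ≤ rowCoeff κ u i := by
  unfold rowCoeff
  have := rowCoeff_base_nonneg hκ i
  split_ifs
  · exact le_rfl
  · exact mul_nonneg (by positivity) (pow_nonneg (hκ.trans this) _)

/-- From `i` to `i + 1` the base grows by 4 + κ/2^(i+1). The 4 covers the terms with one and two
columns removed, using c ≤ κ ≤ base; the remainder times 2^(i+1) is κ and covers the additive `c`.
The damping factor keeps the total contribution of κ below 2κ. -/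
theorem rowCoeff_rec {κ c : ℝ} (hc : 1 ≤ c) (hκ : c ≤ κ) (d i : ℕ) :
    2 * rowCoeff κ (d + 2) (i + 1) + 2 * rowCoeff κ (d + 3) i + c * rowCoeff κ (d + 1) (i + 1) + c ≤
      rowCoeff κ (d + 3) (i + 1) := by
  set x := κ * (2 - (1 / 2) ^ i) + 4 * (i : ℝ) with hx
  set y := κ * (2 - (1 / 2) ^ (i + 1)) + 4 * ((i + 1 : ℕ) : ℝ) with hy
  have hκ0 : 0 ≤ κ := by linarith
  have hxκ : κ ≤ x := rowCoeff_base_nonneg hκ0 i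
  have hyκ : κ ≤ y := rowCoeff_base_nonneg hκ0 (i + 1)
  have hyx : y = x + 4 + κ * (1 / 2) ^ (i + 1) := by
    rw [hx, hy, pow_succ]; push_cast; ring
  have hP : (2 : ℝ) ^ (i + 1) * (1 / 2) ^ (i + 1) = 1 := by
    rw [← mul_pow]; norm_num
  set P : ℝ := 2 ^ (i + 1) with hPdef
  set h : ℝ := (1 / 2) ^ (i + 1) with hhdef
  have hP0 : 0 < P := by positivity
  have hh0 : 0 < h := by positivity
  have e1 : rowCoeff κ (d + 2) (i + 1) = P * y ^ d := by
    simp only [rowCoeff, hPdef, hy, hhdef, show ¬ d + 2 ≤ 1 by omega, if_false,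
      show d + 2 - 2 = d by omega]
  have e2 : 2 * rowCoeff κ (d + 3) i = P * x ^ (d + 1) := by
    simp only [rowCoeff, hPdef, hx, show ¬ d + 3 ≤ 1 by omega, if_false,
      show d + 3 - 2 = d + 1 by omega]
    ring
  have e3 : rowCoeff κ (d + 3) (i + 1) = P * y ^ (d + 1) := by
    simp only [rowCoeff, hPdef, hy, hhdef, show ¬ d + 3 ≤ 1 by omega, if_false,
      show d + 3 - 2 = d + 1 by omega]
  have e4 : c * rowCoeff κ (d + 1) (i + 1) ≤ P * y ^ d := by
    rcases Nat.eq_zero_or_pos d with rfl | hd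
    · simp only [rowCoeff, zero_add, le_refl, if_true, mul_zero]
      positivity
    · obtain ⟨d, rfl⟩ : ∃ d', d = d' + 1 := ⟨d - 1, by omega⟩
      have : rowCoeff κ (d + 1 + 1) (i + 1) = P * y ^ d := by
        simp only [rowCoeff, hPdef, hy, hhdef, show ¬ d + 1 + 1 ≤ 1 by omega, if_false,
          show d + 1 + 1 - 2 = d by omega]
      rw [this, pow_succ]
      have h1 : c * (P * y ^ d) ≤ y * (P * y ^ d) :=
        mul_le_mul_of_nonneg_right (hκ.trans hyκ)
          (mul_nonneg hP0.le (pow_nonneg (by linarith) _))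
      linarith
  have hyd : 1 ≤ y ^ d := one_le_pow₀ (by linarith)
  have hxy : x ≤ y := by
    have : 0 ≤ κ * h := mul_nonneg hκ0 hh0.le
    linarith
  have e5 : x ^ (d + 1) ≤ y ^ d * x := by
    rw [pow_succ]
    exact mul_le_mul_of_nonneg_right (pow_le_pow_left₀ (by linarith) hxy d) (by linarith)
  have e6 : y ^ (d + 1) = y ^ d * x + 4 * y ^ d + κ * h * y ^ d := by
    rw [pow_succ]; nth_rw 2 [hyx]; ring
  have e7 : P * x ^ (d + 1) ≤ P * (y ^ d * x) := mul_le_mul_of_nonneg_left e5 hP0.le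
  have e8 : c ≤ P * (κ * h * y ^ d) := by
    have h1 : P * (κ * h * y ^ d) = κ * y ^ d * (P * h) := by ring
    rw [h1, hP, mul_one]
    exact hκ.trans (le_mul_of_one_le_right hκ0 hyd)
  have e9 : 0 ≤ P * y ^ d := by positivity
  rw [e1, e2, e3, e6]
  linarith

theorem card_le_ackTable {σ : ℕ → ℕ} {k : ℕ} (hσ : ∀ v < k + 1, σ v < k + 1)
    (hσi : ∀ v v', v < k + 1 → v' < k + 1 → σ v = σ v' → v = v') {κ : ℝ}
    (hκ : 3 * ((segConst k : ℝ) + 1) + 3 * gridConst k + (3 * ((k : ℝ) + 1)) ^ 3 ≤ κ)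
    {i n : ℕ} (hn : n ≤ ackTable (i + 1) 3) {S : Finset (ℕ × ℕ)}
    (hS : ¬ HasPattern (hatRank σ) (range (3 * (k + 1))) S) (hr : (rows S).card ≤ n)
    (hc : (cols S).card ≤ n) :
    (S.card : ℝ) ≤ 2 ^ (i + 1) * (2 * κ + 4 * ((i + 1 : ℕ) : ℝ)) ^ (3 * k + 1) *
      (n + 60 ^ (3 * k + 3) * n) := by
  have hk0 : (0 : ℝ) ≤ k := Nat.cast_nonneg _
  have hs0 : (0 : ℝ) ≤ segConst k := Nat.cast_nonneg _
  have hg0 : (0 : ℝ) ≤ gridConst k := Nat.cast_nonneg _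
  have hD1 : 1 ≤ 3 * ((k : ℝ) + 1) := by linarith
  have hD0 : 0 ≤ (3 * ((k : ℝ) + 1)) ^ 3 := by positivity
  have hκ0 : 0 ≤ κ := by linarith
  have hB := weightBound_ackTable hσ hσi (c := 3 * ((segConst k : ℝ) + 1) + 3 * gridConst k)
    (μ := rowCoeff κ) (by linarith) (by linarith) (rowCoeff_nonneg hκ0)
    (fun i => by simpa [rowCoeff] using one_le_pow₀ (one_le_two : (1 : ℝ) ≤ 2))
    (fun d _ => by
      simp only [rowCoeff, show ¬ d + 3 ≤ 1 by omega, if_false, show d + 3 - 2 = d + 1 by omega]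
      push_cast
      -- The cube in `hκ` is there because d + 3 ≤ 3(d + 1), while `rowCoeff` has only the power d +
      -- 1.
      calc (3 * ((k : ℝ) + 1)) ^ (d + 3) ≤ (3 * ((k : ℝ) + 1)) ^ (3 * (d + 1)) :=
            pow_le_pow_right₀ hD1 (by omega)
        _ = ((3 * ((k : ℝ) + 1)) ^ 3) ^ (d + 1) := by rw [pow_mul]
        _ ≤ (κ * (2 - (1 / 2) ^ 1) + 4 * 1) ^ (d + 1) :=
            pow_le_pow_left₀ hD0 (by linarith) _
        _ ≤ 2 ^ 1 * (κ * (2 - (1 / 2) ^ 1) + 4 * 1) ^ (d + 1) :=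
            le_mul_of_one_le_left (by positivity) (by norm_num))
    (fun d i _ => rowCoeff_rec (by linarith) (by linarith) d i) (3 * k + 2) i 2 0 (by omega)
  have hX : Ico 0 (0 + (3 * k + 2) + 1) = range (3 * (k + 1)) := by
    rw [range_eq_Ico]; congr 1; ring
  rw [hX] at hB
  have h1 := hB S hS (hc.trans (hn.trans (Nat.le_self_pow (by omega) _)))
  refine h1.trans ?_
  have hbase : κ * (2 - (1 / 2) ^ (i + 1)) + 4 * ((i + 1 : ℕ) : ℝ) ≤
      2 * κ + 4 * ((i + 1 : ℕ) : ℝ) := by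
    have : κ * (2 - (1 / 2) ^ (i + 1)) ≤ κ * 2 :=
      mul_le_mul_of_nonneg_left (by
        have : (0 : ℝ) ≤ (1 / 2) ^ (i + 1) := by positivity
        linarith) hκ0
    linarith
  have hbase0 := rowCoeff_base_nonneg hκ0 (i + 1)
  have hμ : rowCoeff κ (3 * k + 2 + 1) (i + 1) ≤
      2 ^ (i + 1) * (2 * κ + 4 * ((i + 1 : ℕ) : ℝ)) ^ (3 * k + 1) := by
    simp only [rowCoeff, show ¬ 3 * k + 2 + 1 ≤ 1 by omega, if_false,
      show 3 * k + 2 + 1 - 2 = 3 * k + 1 by omega]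
    exact mul_le_mul_of_nonneg_left (pow_le_pow_left₀ (hκ0.trans hbase0) hbase _) (by positivity)
  have hr' : ((rows S).card : ℝ) ≤ n := Nat.cast_le.2 hr
  have hc' : ((cols S).card : ℝ) ≤ n := Nat.cast_le.2 hc
  have h60 : (20 * (((2 : ℕ) : ℝ) + 1)) = 60 := by norm_num
  rw [h60]
  refine mul_le_mul hμ ?_ (by positivity) (by positivity)
  gcongr

/-! ### Explicit constants -/

theorem natCast_le_two_pow (n : ℕ) : (n : ℝ) ≤ 2 ^ n := by
  exact_mod_cast (Nat.lt_two_pow_self (n := n)).le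

theorem constants_le (k : ℕ) :
    3 * ((segConst k : ℝ) + 1) + 3 * gridConst k + (3 * ((k : ℝ) + 1)) ^ 3 ≤ 2 ^ (19 * (k + 1)) := by
  set Y : ℝ := 2 ^ (k + 1) with hY
  have hY2 : 2 ≤ Y := by
    have : (2 : ℝ) ^ 1 ≤ 2 ^ (k + 1) := pow_le_pow_right₀ (by norm_num) (by omega)
    linarith
  have hk : (k : ℝ) + 1 ≤ Y := by
    have := natCast_le_two_pow (k + 1)
    push_cast at this
    exact this
  have h4 : (4 : ℝ) ^ (k + 1) = Y ^ 2 := by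
    rw [hY, ← pow_mul, mul_comm, pow_mul]; norm_num
  have h4' : (4 : ℝ) ^ (k + 2) = 4 * Y ^ 2 := by rw [pow_succ, h4]; ring
  have h2 : (2 : ℝ) ^ k ≤ Y := pow_le_pow_right₀ (by norm_num) (by omega)
  have hp : ∀ a b : ℕ, a ≤ b → Y ^ a ≤ Y ^ b := fun a b h => pow_le_pow_right₀ (by linarith) h
  have hY0 : 0 < Y := by linarith
  have hg : (gridConst k : ℝ) ≤ 8 * Y ^ 7 := by
    have : (gridConst k : ℝ) = 8 * ((k : ℝ) + 1) * (4 ^ (k + 1)) ^ 3 := by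
      rw [gridConst]; push_cast; ring
    rw [this, h4]
    calc 8 * ((k : ℝ) + 1) * (Y ^ 2) ^ 3 ≤ 8 * Y * (Y ^ 2) ^ 3 := by gcongr
      _ = 8 * Y ^ 7 := by ring
  have hs : (segConst k : ℝ) ≤ 72 * Y ^ 8 := by
    have : (segConst k : ℝ) = 4 * (2 * (((k : ℝ) + 1) * 4 ^ (k + 2) + 1) + 2 ^ k * gridConst k) := by
      rw [segConst]; push_cast; ring
    rw [this, h4']
    have a1 : ((k : ℝ) + 1) * (4 * Y ^ 2) ≤ Y * (4 * Y ^ 2) := by gcongr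
    have a2 : (2 : ℝ) ^ k * gridConst k ≤ Y * (8 * Y ^ 7) := by gcongr
    have a3 := hp 3 8 (by norm_num)
    have a4 := hp 0 8 (by norm_num)
    have a5 : Y * (4 * Y ^ 2) = 4 * Y ^ 3 := by ring
    have a6 : Y * (8 * Y ^ 7) = 8 * Y ^ 8 := by ring
    rw [pow_zero] at a4
    linarith
  have hd : (3 * ((k : ℝ) + 1)) ^ 3 ≤ 27 * Y ^ 3 := by
    calc (3 * ((k : ℝ) + 1)) ^ 3 ≤ (3 * Y) ^ 3 := by gcongr
      _ = 27 * Y ^ 3 := by ring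
  have a1 := hp 7 8 (by norm_num)
  have a2 := hp 3 8 (by norm_num)
  have a3 := hp 0 8 (by norm_num)
  rw [pow_zero] at a3
  have h19 : (2 : ℝ) ^ (19 * (k + 1)) = Y ^ 19 := by rw [hY, ← pow_mul, mul_comm]
  rw [h19]
  have h11 : (2 : ℝ) ^ 11 * Y ^ 8 ≤ Y ^ 11 * Y ^ 8 := by gcongr
  have : Y ^ 11 * Y ^ 8 = Y ^ 19 := by ring
  linarith

/-- Separates the part of the base depending on `k` from the part depending on the level. -/
theorem add_pow_le_two_mul_pow {a b : ℝ} (ha : 0 ≤ a) (hb : 0 ≤ b) (p : ℕ) :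
    (a + b) ^ p ≤ (2 * a) ^ p + (2 * b) ^ p := by
  rcases le_total a b with h | h
  · have h1 : (a + b) ^ p ≤ (2 * b) ^ p := pow_le_pow_left₀ (by linarith) (by linarith) p
    have h2 : 0 ≤ (2 * a) ^ p := by positivity
    linarith
  · have h1 : (a + b) ^ p ≤ (2 * a) ^ p := pow_le_pow_left₀ (by linarith) (by linarith) p
    have h2 : 0 ≤ (2 * b) ^ p := by positivity
    linarith

theorem card_le_explicit {σ : ℕ → ℕ} {k : ℕ} (hσ : ∀ v < k + 1, σ v < k + 1)
    (hσi : ∀ v v', v < k + 1 → v' < k + 1 → σ v = σ v' → v = v')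
    {i n : ℕ} (hi : 1 ≤ i) (hn : n ≤ ackTable i 3) {S : Finset (ℕ × ℕ)}
    (hS : ¬ HasPattern (hatRank σ) (range (3 * (k + 1))) S) (hr : (rows S).card ≤ n)
    (hc : (cols S).card ≤ n) :
    (S.card : ℝ) ≤ n * ((2 : ℝ) ^ (135 * (k + 1) ^ 2) + (8 * 60 ^ 4 * (i : ℝ)) ^ (3 * k + 1)) *
      2 ^ i := by
  obtain ⟨i, rfl⟩ : ∃ i', i = i' + 1 := ⟨i - 1, by omega⟩
  refine (card_le_ackTable hσ hσi (constants_le k) hn hS hr hc).trans ?_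
  set I : ℝ := ((i + 1 : ℕ) : ℝ) with hI
  have hI0 : 0 ≤ I := Nat.cast_nonneg _
  set κ : ℝ := 2 ^ (19 * (k + 1)) with hκ
  have h1 := add_pow_le_two_mul_pow (a := 2 * κ) (b := 4 * I) (by positivity) (by positivity)
    (3 * k + 1)
  -- The column factor is absorbed into a constant raised to the same power 3k + 1, as 3k + 4 ≤ 4(3k
  -- + 1).
  have h2 : (n : ℝ) + 60 ^ (3 * k + 3) * n ≤ (60 ^ 4) ^ (3 * k + 1) * n := by
    have h3 : (1 : ℝ) + 60 ^ (3 * k + 3) ≤ (60 ^ 4) ^ (3 * k + 1) := by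
      rw [← pow_mul]
      have a1 : (60 : ℝ) ^ (3 * k + 4) ≤ 60 ^ (4 * (3 * k + 1)) :=
        pow_le_pow_right₀ (by norm_num) (by omega)
      have a2 : (1 : ℝ) ≤ 60 ^ (3 * k + 3) := one_le_pow₀ (by norm_num)
      have a3 : (60 : ℝ) ^ (3 * k + 4) = 60 * 60 ^ (3 * k + 3) := by ring
      linarith
    have := mul_le_mul_of_nonneg_right h3 (Nat.cast_nonneg (α := ℝ) n)
    linarith
  have h4 : (60 ^ 4 * (2 * (2 * κ))) ^ (3 * k + 1) ≤ (2 : ℝ) ^ (135 * (k + 1) ^ 2) := by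
    have a1 : 60 ^ 4 * (2 * (2 * κ)) ≤ 2 ^ (45 * (k + 1)) := by
      calc 60 ^ 4 * (2 * (2 * κ)) ≤ 2 ^ 26 * κ := by
            have : 0 ≤ κ := by positivity
            linarith
        _ = 2 ^ (26 + 19 * (k + 1)) := by rw [hκ, ← pow_add]
        _ ≤ _ := pow_le_pow_right₀ (by norm_num) (by omega)
    have h3 : 45 * (k + 1) * (3 * k + 1) ≤ 135 * (k + 1) ^ 2 := by
      calc 45 * (k + 1) * (3 * k + 1) ≤ 45 * (k + 1) * (3 * (k + 1)) :=
            Nat.mul_le_mul_left _ (by omega)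
        _ = 135 * (k + 1) ^ 2 := by ring
    calc (60 ^ 4 * (2 * (2 * κ))) ^ (3 * k + 1) ≤ (2 ^ (45 * (k + 1))) ^ (3 * k + 1) := by gcongr
      _ = 2 ^ (45 * (k + 1) * (3 * k + 1)) := by rw [← pow_mul]
      _ ≤ _ := pow_le_pow_right₀ (by norm_num) h3
  calc 2 ^ (i + 1) * (2 * κ + 4 * I) ^ (3 * k + 1) * (n + 60 ^ (3 * k + 3) * n) ≤
      2 ^ (i + 1) * ((2 * (2 * κ)) ^ (3 * k + 1) + (2 * (4 * I)) ^ (3 * k + 1)) *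
        ((60 ^ 4) ^ (3 * k + 1) * n) := by gcongr
    _ = n * ((60 ^ 4 * (2 * (2 * κ))) ^ (3 * k + 1) + (8 * 60 ^ 4 * I) ^ (3 * k + 1)) *
        2 ^ (i + 1) := by
      rw [mul_pow (60 ^ 4) (2 * (2 * κ)), show 8 * 60 ^ 4 * I = 60 ^ 4 * (2 * (4 * I)) by ring,
        mul_pow (60 ^ 4) (2 * (4 * I))]
      ring
    _ ≤ _ := by gcongr

/-! ### Growth of the inverse-Ackermann function -/

theorem invAck_spec {n : ℕ} (hn : 1 ≤ n) : 1 ≤ invAck n ∧ n ≤ ackTable (invAck n) 3 := by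
  have h := Nat.find_spec (exists_le_ackTable n (max 3 ⌈(n : ℚ) / (n : ℚ)⌉₊)
    (le_max_of_le_left (by norm_num)))
  have hj : max 3 ⌈(n : ℚ) / (n : ℚ)⌉₊ = 3 := by
    rw [div_self (by exact_mod_cast (by omega : n ≠ 0))]
    simp
  change 1 ≤ invAck n ∧ n ≤ ackTable (invAck n) (max 3 ⌈(n : ℚ) / (n : ℚ)⌉₊) at h
  rw [hj] at h
  exact h

/-- If α(n) < N, then n is at most one of the finitely many values `ackTable i 3` with i < N. -/
theorem tendsto_invAck : Filter.Tendsto invAck Filter.atTop Filter.atTop := by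
  rw [Filter.tendsto_atTop]
  intro N
  filter_upwards [Filter.eventually_ge_atTop (1 + ∑ i ∈ range N, ackTable i 3)] with n hn
  by_contra! h
  have h1 := (invAck_spec (n := n) (by omega)).2
  have h2 : ackTable (invAck n) 3 ≤ ∑ i ∈ range N, ackTable i 3 :=
    single_le_sum (f := fun i => ackTable i 3) (fun i _ => Nat.zero_le _) (mem_range.2 h)
  omega

theorem tendsto_logb_sq_div {C : ℝ} (hC : 0 < C) :
    Filter.Tendsto (fun x : ℝ => (Real.logb 2 (C * x)) ^ 2 / x) Filter.atTop (nhds 0) := by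
  have h1 : Filter.Tendsto (fun x : ℝ => Real.log x ^ 2 / x) Filter.atTop (nhds 0) :=
    (Real.isLittleO_pow_log_id_atTop (n := 2)).tendsto_div_nhds_zero
  have h2 := (h1.comp (Filter.tendsto_id.const_mul_atTop hC)).const_mul (C / Real.log 2 ^ 2)
  rw [mul_zero] at h2
  refine h2.congr fun x => ?_
  simp only [Function.comp_apply, id, Real.logb, div_pow]
  rcases eq_or_ne x 0 with rfl | hx
  · simp
  · have : Real.log 2 ≠ 0 := (Real.log_pos one_lt_two).ne'
    field_simp

end HatPattern

namespace ZeroOneMatrix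

open HatPattern

/-! ### Transfer to zero-one matrices -/

/-- The positions of the ones. -/
def ones {n m : ℕ} (A : ZeroOneMatrix n m) : Finset (ℕ × ℕ) :=
  (univ.filter fun p : Fin n × Fin m => A p.1 p.2 = 1).image fun p => (p.1.val, p.2.val)

theorem mem_ones {n m : ℕ} {A : ZeroOneMatrix n m} {p : ℕ × ℕ} :
    p ∈ ones A ↔ ∃ (h₁ : p.1 < n) (h₂ : p.2 < m), A ⟨p.1, h₁⟩ ⟨p.2, h₂⟩ = 1 := by
  simp only [ones, mem_image, mem_filter, mem_univ, true_and, Prod.exists]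
  constructor
  · rintro ⟨a, b, h, rfl⟩
    exact ⟨a.2, b.2, h⟩
  · rintro ⟨h₁, h₂, h⟩
    exact ⟨_, _, h, rfl⟩

theorem card_ones {n m : ℕ} (A : ZeroOneMatrix n m) : (ones A).card = weight A := by
  refine card_image_of_injective _ fun p q h => ?_
  simp only [Prod.mk.injEq] at h
  exact Prod.ext (Fin.ext h.1) (Fin.ext h.2)

theorem card_rows_ones_le {n m : ℕ} (A : ZeroOneMatrix n m) : (rows (ones A)).card ≤ n := by
  have : rows (ones A) ⊆ range n := fun r hr => by
    obtain ⟨p, hp, rfl⟩ := mem_rows.1 hr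
    exact mem_range.2 (mem_ones.1 hp).1
  simpa using card_le_card this

theorem card_cols_ones_le {n m : ℕ} (A : ZeroOneMatrix n m) : (cols (ones A)).card ≤ m := by
  have : cols (ones A) ⊆ range m := fun c hc => by
    obtain ⟨p, hp, rfl⟩ := mem_cols.1 hc
    exact mem_range.2 (mem_ones.1 hp).2.1
  simpa using card_le_card this

/-- The row block of the one in column block `v` of the permutation matrix. -/
def blockRow {k : ℕ} (π : Equiv.Perm (Fin k)) (v : ℕ) : ℕ :=
  if h : v < k then (π.symm ⟨v, h⟩).val else 0

theorem blockRow_lt {k : ℕ} (π : Equiv.Perm (Fin k)) (v : ℕ) (hv : v < k) : blockRow π v < k := by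
  rw [blockRow, dif_pos hv]
  exact Fin.is_lt _

theorem blockRow_inj {k : ℕ} (π : Equiv.Perm (Fin k)) (v v' : ℕ) (hv : v < k) (hv' : v' < k)
    (h : blockRow π v = blockRow π v') : v = v' := by
  rw [blockRow, blockRow, dif_pos hv, dif_pos hv'] at h
  simpa using π.symm.injective (Fin.ext h)

theorem blockRow_apply {k : ℕ} (π : Equiv.Perm (Fin k)) (a : Fin k) :
    blockRow π (π a).val = a.val := by
  simp [blockRow]

/-- The ones of the permutation matrix sit at `(i, π i)`, so column block `v` has its hat in row
block `π.symm v`. This identifies the column description with the Kronecker product. -/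
theorem permHat_eq_one {k : ℕ} {π : Equiv.Perm (Fin k)} {i : Fin (k * 2)} {j : Fin (k * 3)}
    (h : permHat π i j = 1) :
    hatRank (blockRow π) j.val = i.val := by
  obtain ⟨⟨a, e⟩, rfl⟩ := finProdFinEquiv.surjective i
  obtain ⟨⟨b, f⟩, rfl⟩ := finProdFinEquiv.surjective j
  have h' : Equiv.Perm.permMatrix (ZMod 2) π a b * hat e f = 1 := by
    simpa [permHat, kron] using h
  have hab : π a = b := by
    by_contra hne
    rw [Equiv.Perm.permMatrix, PEquiv.toMatrix_apply] at h'
    simp [hne] at h'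
  have hef : (if f.val = 1 then 0 else 1) = e.val := by
    have h2 : hat e f ≠ 0 := fun h0 => by simp [h0] at h'
    revert h2
    revert e f
    intro e f _ _
    fin_cases e <;> fin_cases f <;> simp [hat]
  subst hab
  simp only [finProdFinEquiv_apply_val, hatRank]
  have h1 : (f.val + 3 * (π a).val) / 3 = (π a).val := by omega
  have h2 : (f.val + 3 * (π a).val) % 3 = f.val := by omega
  rw [h1, h2, blockRow_apply, hef]
  omega

/-- Every row of the pattern contains a 1, so a row of the copy can be read off from any pattern
column of that rank; equal ranks give equal rows. -/
theorem contains_of_hasPattern {k n : ℕ} {π : Equiv.Perm (Fin k)} {A : ZeroOneMatrix n n}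
    (h : HasPattern (hatRank (blockRow π)) (range (3 * k)) (ones A)) : Contains (permHat π) A := by
  obtain ⟨p, hp, hc, hr, he⟩ := h
  have hcol : ∀ i : Fin (k * 2), ∃ x ∈ range (3 * k), hatRank (blockRow π) x = i.val := by
    intro i
    obtain ⟨⟨a, e⟩, rfl⟩ := finProdFinEquiv.surjective i
    refine ⟨3 * (π a).val + if e.val = 0 then 1 else 0, ?_, ?_⟩
    · rw [mem_range]
      have := (π a).is_lt
      split_ifs <;> omega
    · simp only [finProdFinEquiv_apply_val, hatRank]
      have h1 : (3 * (π a).val + if e.val = 0 then 1 else 0) / 3 = (π a).val := by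
        split_ifs <;> omega
      have h2 : (3 * (π a).val + if e.val = 0 then 1 else 0) % 3 = if e.val = 0 then 1 else 0 := by
        split_ifs <;> omega
      have := e.is_lt
      rw [h1, h2, blockRow_apply]
      by_cases he : e.val = 0
      · simp [he]
      · simp only [he, if_false, zero_ne_one]
        omega
  choose x hx hxe using hcol
  have hj : ∀ j : Fin (k * 3), j.val ∈ range (3 * k) := fun j => by
    have := j.is_lt
    rw [mem_range]
    omega
  refine ⟨fun i => ⟨(p (x i)).1, (mem_ones.1 (hp _ (hx i))).1⟩,
    fun j => ⟨(p j.val).2, (mem_ones.1 (hp _ (hj j))).2.1⟩, ?_, ?_, ?_⟩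
  · intro i i' hii
    refine hr _ (hx i) _ (hx i') ?_
    rw [hxe, hxe]
    exact hii
  · intro j j' hjj
    exact hc _ (hj j) _ (hj j') hjj
  · intro i j hij
    obtain ⟨h1, h2, h3⟩ := mem_ones.1 (hp _ (hj j))
    have hrow : (p (x i)).1 = (p j.val).1 :=
      he _ (hx i) _ (hj j) (by rw [hxe, permHat_eq_one hij])
    simpa only [hrow] using h3

theorem ex_permHat_le {k n : ℕ} (π : Equiv.Perm (Fin (k + 1))) (hn : 1 ≤ n) :
    (ex (permHat π) n : ℝ) ≤ n * ((2 : ℝ) ^ (135 * (k + 1) ^ 2) +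
      (8 * 60 ^ 4 * (invAck n : ℝ)) ^ (3 * k + 1)) * 2 ^ invAck n := by
  classical
  obtain ⟨h1, h2⟩ := invAck_spec hn
  have : ex (permHat π) n ≤ ⌊(n : ℝ) * ((2 : ℝ) ^ (135 * (k + 1) ^ 2) +
      (8 * 60 ^ 4 * (invAck n : ℝ)) ^ (3 * k + 1)) * 2 ^ invAck n⌋₊ := by
    refine Finset.sup_le fun A hA => Nat.le_floor ?_
    rw [← card_ones]
    exact card_le_explicit (blockRow_lt π) (blockRow_inj π) h1 h2
      (fun h => (mem_filter.1 hA).2 (contains_of_hasPattern h)) (card_rows_ones_le A)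
      (card_cols_ones_le A)
  exact (Nat.cast_le.2 this).trans (Nat.floor_le (by positivity))

end ZeroOneMatrix

/-! ### The theorem -/

theorem mainTheorem1 :
    ∃ (C D : ℝ) (ε : ℕ → ℝ), 0 < C ∧ 0 < D ∧ Filter.Tendsto ε Filter.atTop (nhds 0) ∧
      ∀ (k : ℕ) (π : Equiv.Perm (Fin k)) (n : ℕ), 1 ≤ k → 1 ≤ n →
        (ZeroOneMatrix.ex (ZeroOneMatrix.permHat π) n : ℝ) ≤
            (n : ℝ) * ((2 : ℝ) ^ (C * (k : ℝ) ^ 2) + (C * (invAck n : ℝ)) ^ (3 * k - 2)) *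
              (2 : ℝ) ^ invAck n ∧
          (n : ℝ) * ((2 : ℝ) ^ (C * (k : ℝ) ^ 2) + (C * (invAck n : ℝ)) ^ (3 * k - 2)) *
              (2 : ℝ) ^ invAck n ≤
            (n : ℝ) * (2 : ℝ) ^ (D * (k : ℝ) ^ 2 + (1 + ε n) * (invAck n : ℝ)) := by
  have hC0 : (0 : ℝ) < 8 * 60 ^ 4 := by norm_num
  -- With L = log₂(Cα), the polynomial factor is at most 2^(3kL), and 3kL ≤ L² + 9k²/4. The L² goes
  -- into ε(n)·α(n), independently of `k`, and the k² into the first term of the exponent; D = C + 1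
  -- leaves a factor 2^(k²) for the sum of two terms.
  refine ⟨8 * 60 ^ 4, 8 * 60 ^ 4 + 1,
    fun n => (Real.logb 2 (8 * 60 ^ 4 * (invAck n : ℝ))) ^ 2 / (invAck n : ℝ), hC0, by norm_num,
    (HatPattern.tendsto_logb_sq_div hC0).comp
      (tendsto_natCast_atTop_atTop.comp HatPattern.tendsto_invAck), ?_⟩
  intro k π n hk hn
  obtain ⟨k, rfl⟩ : ∃ k', k = k' + 1 := ⟨k - 1, by omega⟩
  rw [show 3 * (k + 1) - 2 = 3 * k + 1 by omega]
  have hα : (1 : ℝ) ≤ invAck n := by exact_mod_cast (HatPattern.invAck_spec hn).1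
  set α := invAck n with hαdef
  set K : ℝ := ((k + 1 : ℕ) : ℝ) with hK
  have hK1 : 1 ≤ K := by rw [hK]; exact_mod_cast (by omega : 1 ≤ k + 1)
  have hKsq : 1 ≤ K ^ 2 := one_le_pow₀ hK1
  constructor
  · refine (ZeroOneMatrix.ex_permHat_le π hn).trans ?_
    have : (2 : ℝ) ^ (135 * (k + 1) ^ 2) ≤ (2 : ℝ) ^ (8 * 60 ^ 4 * K ^ 2) := by
      rw [← Real.rpow_natCast]
      refine Real.rpow_le_rpow_of_exponent_le (by norm_num) ?_
      have : (((135 * (k + 1) ^ 2 : ℕ)) : ℝ) = 135 * K ^ 2 := by rw [hK]; push_cast; ring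
      rw [this]
      gcongr
      norm_num
    gcongr
  · set L := Real.logb 2 (8 * 60 ^ 4 * (α : ℝ)) with hL
    have hCα : 1 ≤ 8 * 60 ^ 4 * (α : ℝ) := by
      have : (8 * 60 ^ 4 : ℝ) * 1 ≤ 8 * 60 ^ 4 * α := mul_le_mul_of_nonneg_left hα hC0.le
      linarith
    have hL0 : 0 ≤ L := Real.logb_nonneg (by norm_num) hCα
    have hpow : (8 * 60 ^ 4 * (α : ℝ)) ^ (3 * k + 1) ≤ (2 : ℝ) ^ (8 * 60 ^ 4 * K ^ 2 + L ^ 2) := by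
      have h1 : 8 * 60 ^ 4 * (α : ℝ) = (2 : ℝ) ^ L :=
        (Real.rpow_logb (by norm_num) (by norm_num) (by linarith)).symm
      rw [h1, ← Real.rpow_natCast, ← Real.rpow_mul (by norm_num)]
      refine Real.rpow_le_rpow_of_exponent_le (by norm_num) ?_
      have h2 : ((3 * k + 1 : ℕ) : ℝ) ≤ 3 * K := by
        rw [hK]; push_cast; linarith
      have h3 : L * ((3 * k + 1 : ℕ) : ℝ) ≤ L * (3 * K) := mul_le_mul_of_nonneg_left h2 hL0
      -- The inequality 3LK ≤ L² + (9/4)K².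
      nlinarith [sq_nonneg (L - 3 / 2 * K)]
    have hpow2 : (2 : ℝ) ^ (8 * 60 ^ 4 * K ^ 2) ≤ (2 : ℝ) ^ (8 * 60 ^ 4 * K ^ 2 + L ^ 2) :=
      Real.rpow_le_rpow_of_exponent_le (by norm_num) (by nlinarith [sq_nonneg L])
    have hexp : (8 * 60 ^ 4 + 1) * K ^ 2 + (1 + L ^ 2 / (α : ℝ)) * (α : ℝ) =
        (K ^ 2 + (8 * 60 ^ 4 * K ^ 2 + L ^ 2)) + (α : ℝ) := by
      field_simp
      ring
    have htwo : (2 : ℝ) ≤ (2 : ℝ) ^ (K ^ 2) := by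
      calc (2 : ℝ) = (2 : ℝ) ^ (1 : ℝ) := by rw [Real.rpow_one]
        _ ≤ _ := Real.rpow_le_rpow_of_exponent_le (by norm_num) hKsq
    rw [hexp, Real.rpow_add (by norm_num), Real.rpow_add (by norm_num), Real.rpow_natCast,
      mul_assoc]
    have hsum : (2 : ℝ) ^ (8 * 60 ^ 4 * K ^ 2) + (8 * 60 ^ 4 * (α : ℝ)) ^ (3 * k + 1) ≤
        (2 : ℝ) ^ (K ^ 2) * (2 : ℝ) ^ (8 * 60 ^ 4 * K ^ 2 + L ^ 2) := by
      have := mul_le_mul_of_nonneg_right htwo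
        (by positivity : (0 : ℝ) ≤ (2 : ℝ) ^ (8 * 60 ^ 4 * K ^ 2 + L ^ 2))
      linarith
    gcongr
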